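/- Let $D\subset\mathbb R^2$ be a bounded, connected, nonempty open set with $C^\infty$ boundary; all functions are complex valued. For a complex Hilbert space $X$ let $B^2(\mathbb R;X)$ be the closure, within $L^2_{\rm loc}(\mathbb R;X)$, of the trigonometric polynomials $\sum_{k=1}^n e^{i\xi_k t}x_k$ ($\xi_k\in\mathbb R$, $x_k\in X$) for the seminorm $$\|u\|_{B^2(X)}=\limsup_{R\to\infty}\Big(\frac1{2R}\int_{-R}^R\|u(t)\|_X^2\,dt\Big)^{1/2},$$ and write $B^2(\mathbb R)=B^2(\mathbb R;\mathbb C)$. For $u\in B^2(\mathbb R;X)$ and $\xi\in\mathbb R$ let $\hat u(\xi)=\lim_{R\to\infty}\frac1{2R}\int_{-R}^R e^{-i\xi t}u(t)\,dt\in X$, and write $u\sim v$ if $\hat u(\xi)=\hat v(\xi)$ for all $\xi\in\mathbb R$. A function $v\in B^2(\mathbb R;X)$ represents the derivative of $u$ (written $u'$ or $\partial_tu$, determined up to $\sim$) if $\hat v(\xi)=i\xi\,\hat u(\xi)$ for all $\xi\in\mathbb R$. Finally, $f\in B^{1,2}(\mathbb R)$ means that $f\in B^2(\mathbb R)$ and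 $\sum_{\xi}(1+|\xi|^2)|\hat f(\xi)|^2<\infty$; such an $f$ has a derivative $f'\in B^2(\mathbb R)$. For $\nu>0$ and $f\in B^{1,2}(\mathbb R)$, a solution of the basic-flow problem is a pair $(w,\pi)$ with $w\in B^2(\mathbb R;H^2(D))$, $\partial_tw\in B^2(\mathbb R;L^2(D))$ and $\pi\in B^2(\mathbb R)$ such that $$\partial_t w-\nu\Delta w\sim\pi,\qquad \int_D w(t,x)\,dx\sim f(t),\qquad w\sim 0\ \text{ on }\partial D,$$ where in the first relation $\pi(t)$ is regarded as a constant function in $L^2(D)$, and the last relation means $\hat w(\xi)\in H^1_0(D)$ for all $\xi\in\mathbb R$. **Theorem.** There is a constant $c>0$, depending only on $D$, such that for every $\nu>0$ and every $f\in B^{1,2}(\mathbb R)$: 1. There is a solution $(w,\pi)$. It can be chosen such that $w(t)\in H^1_0(D)$ for every $t\in\mathbb R$ and such that the distributional derivative of $t\mapsto w(t)\in L^2(D)$ belongs to $B^2(\mathbb R;L^2(D))$ and represents $\partial_tw$. 2. If $(w_1,\pi_1)$ and $(w_2,\pi_2)$ are solutions, then $w_1\sim w_2$, $\partial_tw_1\sim\partial_tw_2$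 and $\pi_1\sim\pi_2$. 3. Every solution satisfies $$\|\Delta w\|_{B^2(L^2(D))}\le c\,\|f\|_{B^2}+\frac c\nu\,\|f'\|_{B^2},$$ $$\|\pi\|_{B^2}+\|\partial_tw\|_{B^2(L^2(D))}\le c\,\nu\,\|f\|_{B^2}+c\,\|f'\|_{B^2}.$$ -/

import Mathlib

open MeasureTheory Filter Topology
open scoped ENNReal ContDiff

noncomputable section

/-! ### Besicovitch almost periodic functions -/

section Besicovitch

variable {X : Type*} [NormedAddCommGroup X] [NormedSpace ℂ X]

/-- The trigonometric polynomial `t ↦ ∑_{ξ ∈ s} e^{iξt} c_ξ` with coefficients in `X`. -/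
def trigPoly (s : Finset ℝ) (c : ℝ → X) (t : ℝ) : X :=
  ∑ ξ ∈ s, Complex.exp (Complex.I * (ξ : ℂ) * (t : ℂ)) • c ξ

/-- The Besicovitch seminorm
`‖u‖_{B²(X)} = limsup_{R → ∞} ((1/2R) ∫_{-R}^{R} ‖u(t)‖² dt)^{1/2}`, with values in `[0, ∞]`. -/
def besSeminorm (u : ℝ → X) : ℝ≥0∞ :=
  limsup (fun R : ℝ =>
    ((∫⁻ t in Set.Icc (-R) R, ‖u t‖ₑ ^ 2) / ENNReal.ofReal (2 * R)) ^ (1 / 2 : ℝ)) atTop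

/-- `u ∈ B²(ℝ; X)`: `u` is in `L²_loc(ℝ; X)` and in the closure of the `X`-valued trigonometric
polynomials for the Besicovitch seminorm. -/
structure MemBes (u : ℝ → X) : Prop where
  locL2 : ∀ R : ℝ, MemLp u 2 (volume.restrict (Set.Icc (-R) R))
  approx : ∀ ε : ℝ≥0∞, 0 < ε → ∃ (s : Finset ℝ) (c : ℝ → X),
    besSeminorm (fun t => u t - trigPoly s c t) ≤ ε

/-- The mean over `[-R, R]` of `t ↦ e^{-iξt} u(t)`. -/
def modeMean (u : ℝ → X) (ξ R : ℝ) : X :=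
  (2 * R)⁻¹ • ∫ t in (-R)..R, Complex.exp (-(Complex.I * (ξ : ℂ) * (t : ℂ))) • u t

/-- The generalized Fourier coefficient of `u` at `ξ` exists and equals `a`:
the mean `lim_{R → ∞} (1/2R) ∫_{-R}^{R} e^{-iξt} u(t) dt` exists and is `a`. -/
def HasBesCoeff (u : ℝ → X) (ξ : ℝ) (a : X) : Prop :=
  Tendsto (modeMean u ξ) atTop (𝓝 a)

/-- The generalized Fourier coefficient `û(ξ)`. The limit exists for every `u ∈ B²(ℝ; X)`
with `X` complete; the definition is only used for such `u`. -/
def besCoeff (u : ℝ → X) (ξ : ℝ) : X :=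
  limUnder atTop (modeMean u ξ)

/-- The identification of almost periodic functions: `u ∼ v` if all generalized Fourier
coefficients of `u - v` vanish. -/
def ApEquiv (u v : ℝ → X) : Prop :=
  ∀ ξ : ℝ, HasBesCoeff (fun t => u t - v t) ξ 0

/-- `f ∈ B^{s,2}(ℝ)`: `f ∈ B²(ℝ)` and `∑_ξ (1 + |ξ|²)^s |f̂(ξ)|² < ∞`. The sum runs over all of `ℝ`;
the terms outside the spectrum of `f` are zero. -/
structure MemBesSobolev (s : ℝ) (f : ℝ → X) : Prop where
  mem : MemBes f
  summable : Summable fun ξ : ℝ => (1 + ξ ^ 2) ^ s * ‖besCoeff f ξ‖ ^ 2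

/-- `v` represents the (formal) derivative of the almost periodic function `u` in `B²(ℝ; X)`:
`v ∈ B²(ℝ; X)` and the Fourier series of `v` is the termwise derivative of that of `u`. -/
structure IsBesDeriv (u v : ℝ → X) : Prop where
  mem : MemBes v
  coeff : ∀ ξ : ℝ, HasBesCoeff v ξ ((Complex.I * (ξ : ℂ)) • besCoeff u ξ)

/-- `v` is the distributional derivative of `u : ℝ → X`; used for `u, v ∈ L²_loc(ℝ; X)`. -/
def IsDistribDeriv (u v : ℝ → X) : Prop :=
  ∀ φ : ℝ → ℝ, ContDiff ℝ ∞ φ → HasCompactSupport φ →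
    ∫ t, deriv φ t • u t = -∫ t, φ t • v t

end Besicovitch

/-! ### The cross section and its Sobolev spaces -/

/-- The Euclidean plane. -/
abbrev Plane := EuclideanSpace ℝ (Fin 2)

/-- `D` has a smooth (`C^∞`) boundary: near each of its boundary points and in suitable Cartesian
coordinates, `D` is the region strictly above the graph of a smooth function. -/
def HasSmoothBoundary (D : Set Plane) : Prop :=
  ∀ x ∈ frontier D, ∃ r : ℝ, 0 < r ∧ ∃ (L : Plane ≃ₗᵢ[ℝ] Plane) (γ : ℝ → ℝ),
    ContDiff ℝ ∞ γ ∧ ∀ y ∈ Metric.ball x r, (y ∈ D ↔ γ ((L y) 0) < (L y) 1)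

/-- The cross section of a pipe: a smooth, bounded, connected, nonempty open set in the plane. -/
structure CrossSection where
  carrier : Set Plane
  isOpen : IsOpen carrier
  isConnected : IsConnected carrier
  isBounded : Bornology.IsBounded carrier
  smooth : HasSmoothBoundary carrier

/-- Lebesgue measure on `D`. -/
def CrossSection.vol (D : CrossSection) : Measure Plane := volume.restrict D.carrier

instance (D : CrossSection) : IsFiniteMeasure D.vol :=
  ⟨by
    rw [CrossSection.vol, Measure.restrict_apply_univ]
    exact D.isBounded.measure_lt_top⟩

/-- `L²(D)`, complex valued. -/
abbrev L2 (D : CrossSection) := Lp ℂ 2 D.vol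

/-- Complex-valued test functions `φ ∈ C_c^∞(D)`. -/
structure IsTest (D : CrossSection) (φ : Plane → ℂ) : Prop where
  smooth : ContDiff ℝ ∞ φ
  compact : HasCompactSupport φ
  support : tsupport φ ⊆ D.carrier

/-- The classical partial derivative `∂_i φ`. -/
def pderiv (i : Fin 2) (φ : Plane → ℂ) (x : Plane) : ℂ :=
  fderiv ℝ φ x (EuclideanSpace.single i 1)

/-- `g` is the weak partial derivative `∂_i u` in `D`. -/
def IsWeakDeriv {D : CrossSection} (i : Fin 2) (u g : L2 D) : Prop :=
  ∀ φ : Plane → ℂ, IsTest D φ →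
    ∫ x, u x * pderiv i φ x ∂D.vol = -∫ x, g x * φ x ∂D.vol

theorem IsTest.memLp {D : CrossSection} {φ : Plane → ℂ} (h : IsTest D φ) : MemLp φ 2 D.vol :=
  h.smooth.continuous.memLp_of_hasCompactSupport h.compact

theorem IsTest.pderiv_memLp {D : CrossSection} {φ : Plane → ℂ} (h : IsTest D φ) (i : Fin 2) :
    MemLp (pderiv i φ) 2 D.vol := by
  have h1 : Continuous (pderiv i φ) :=
    (h.smooth.continuous_fderiv (by simp)).clm_apply continuous_const
  have h2 : HasCompactSupport (pderiv i φ) :=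
    (h.compact.fderiv (𝕜 := ℝ)).mono' fun x hx => by
      apply subset_tsupport
      intro h0
      apply hx
      simp [pderiv, h0]
  exact h1.memLp_of_hasCompactSupport h2

theorem IsWeakDeriv.zero {D : CrossSection} (i : Fin 2) : IsWeakDeriv i (0 : L2 D) 0 := by
  intro φ _
  have e : ∀ ψ : Plane → ℂ, ∫ x, (0 : L2 D) x * ψ x ∂D.vol = 0 := fun ψ => by
    rw [integral_congr_ae (g := fun _ => (0 : ℂ)), integral_zero]
    filter_upwards [Lp.coeFn_zero ℂ 2 D.vol] with x hx
    rw [hx, Pi.zero_apply, zero_mul]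
  rw [e, e, neg_zero]

theorem IsWeakDeriv.add {D : CrossSection} {i : Fin 2} {u g u' g' : L2 D}
    (h : IsWeakDeriv i u g) (h' : IsWeakDeriv i u' g') : IsWeakDeriv i (u + u') (g + g') := by
  intro φ hφ
  have e : ∀ (a b : L2 D) (ψ : Plane → ℂ), MemLp ψ 2 D.vol →
      ∫ x, (a + b) x * ψ x ∂D.vol = ∫ x, a x * ψ x ∂D.vol + ∫ x, b x * ψ x ∂D.vol := by
    intro a b ψ hψ
    have ha : Integrable (fun x => a x * ψ x) D.vol := (Lp.memLp a).integrable_mul hψ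
    have hb : Integrable (fun x => b x * ψ x) D.vol := (Lp.memLp b).integrable_mul hψ
    rw [← integral_add ha hb]
    apply integral_congr_ae
    filter_upwards [Lp.coeFn_add a b] with x hx
    rw [hx, Pi.add_apply, add_mul]
  rw [e _ _ _ (hφ.pderiv_memLp i), e _ _ _ hφ.memLp, h φ hφ, h' φ hφ, neg_add]

theorem IsWeakDeriv.smul {D : CrossSection} {i : Fin 2} {u g : L2 D} (c : ℂ)
    (h : IsWeakDeriv i u g) : IsWeakDeriv i (c • u) (c • g) := by
  intro φ hφ
  have e : ∀ (a : L2 D) (ψ : Plane → ℂ),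
      ∫ x, (c • a) x * ψ x ∂D.vol = c * ∫ x, a x * ψ x ∂D.vol := by
    intro a ψ
    rw [← integral_const_mul]
    apply integral_congr_ae
    filter_upwards [Lp.coeFn_smul c a] with x hx
    simp [hx, mul_assoc]
  rw [e, e, h φ hφ, mul_neg]

/-- Indices for the derivatives of order at most two: `0`, `i`, and `(i, j)`. -/
abbrev Jet := Unit ⊕ Fin 2 ⊕ (Fin 2 × Fin 2)

/-- `H²(D)`: an element is a function `u ∈ L²(D)` together with its weak derivatives of first and
second order, all in `L²(D)` (they are determined by `u`). The norm is
`(‖u‖² + ∑_i ‖∂_i u‖² + ∑_{i,j} ‖∂_i ∂_j u‖²)^{1/2}`, with `L²(D)` norms. -/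
def H2 (D : CrossSection) : Submodule ℂ (PiLp 2 fun _ : Jet => L2 D) where
  carrier := {U | (∀ i, IsWeakDeriv i (U (.inl ())) (U (.inr (.inl i)))) ∧
    ∀ i j, IsWeakDeriv i (U (.inr (.inl j))) (U (.inr (.inr (i, j))))}
  zero_mem' := ⟨fun i => IsWeakDeriv.zero i, fun i _ => IsWeakDeriv.zero i⟩
  add_mem' := fun h h' =>
    ⟨fun i => (h.1 i).add (h'.1 i), fun i j => (h.2 i j).add (h'.2 i j)⟩
  smul_mem' := fun c _ h => ⟨fun i => (h.1 i).smul c, fun i j => (h.2 i j).smul c⟩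

/-- Pairing with a square integrable function is continuous on `L²(D)`. -/
theorem continuous_integral_mul {D : CrossSection} {ψ : Plane → ℂ} (hψ : MemLp ψ 2 D.vol) :
    Continuous fun u : L2 D => ∫ x, u x * ψ x ∂D.vol := by
  have e : (fun u : L2 D => ∫ x, u x * ψ x ∂D.vol) =
      fun u : L2 D => inner ℂ hψ.star.toLp u := by
    funext u
    rw [L2.inner_def]
    apply integral_congr_ae
    filter_upwards [hψ.star.coeFn_toLp] with x hx
    simp [hx]
  rw [e]
  exact continuous_const.inner continuous_id

/-- `H²(D)` is complete, so Bochner integrals with values in `H²(D)` have their usual meaning. -/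
instance (D : CrossSection) : CompleteSpace (H2 D) := by
  have key : ∀ (i : Fin 2) (a b : Jet),
      IsClosed {U : PiLp 2 fun _ : Jet => L2 D | IsWeakDeriv i (U a) (U b)} := by
    intro i a b
    simp only [IsWeakDeriv, Set.ofPred_forall]
    refine isClosed_iInter fun φ => isClosed_iInter fun hφ => isClosed_eq ?_ ?_
    · exact (continuous_integral_mul (hφ.pderiv_memLp i)).comp (PiLp.continuous_apply 2 _ a)
    · exact ((continuous_integral_mul hφ.memLp).comp (PiLp.continuous_apply 2 _ b)).neg
  have hc : IsClosed (H2 D : Set (PiLp 2 fun _ : Jet => L2 D)) := by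
    have : (H2 D : Set (PiLp 2 fun _ : Jet => L2 D)) =
        (⋂ i, {U | IsWeakDeriv i (U (.inl ())) (U (.inr (.inl i)))}) ∩
        ⋂ i, ⋂ j, {U | IsWeakDeriv i (U (.inr (.inl j))) (U (.inr (.inr (i, j))))} := by
      ext U
      simp [H2]
    rw [this]
    exact (isClosed_iInter fun i => key i _ _).inter
      (isClosed_iInter fun i => isClosed_iInter fun j => key i _ _)
  exact hc.completeSpace_coe

/-- The function underlying an element of `H²(D)`. -/
def H2.fn {D : CrossSection} (u : H2 D) : L2 D := u.1 (.inl ())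

/-- The Laplacian `Δu = ∂₁∂₁u + ∂₂∂₂u ∈ L²(D)` of `u ∈ H²(D)`. -/
def H2.lap {D : CrossSection} (u : H2 D) : L2 D :=
  ∑ i : Fin 2, u.1 (.inr (.inr (i, i)))

/-- `u ∈ H¹₀(D)`: `u` is in the closure of `C_c^∞(D)` for the `H¹` norm (the limit `g` of the
gradients is then the weak gradient of `u`). -/
def MemH10 {D : CrossSection} (u : L2 D) : Prop :=
  ∃ g : Fin 2 → L2 D, ∀ ε : ℝ≥0∞, 0 < ε → ∃ φ : Plane → ℂ, IsTest D φ ∧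
    eLpNorm (fun x => u x - φ x) 2 D.vol ≤ ε ∧
    ∀ i, eLpNorm (fun x => g i x - pderiv i φ x) 2 D.vol ≤ ε

/-! ### The basic flow -/

/-- `(w, π)` solves the basic-flow problem with viscosity `ν` and flux `f` in the sense of
Besicovitch, and `w'` represents `∂_t w`. Here `w ∈ B²(ℝ; H²(D))`, `∂_t w ∈ B²(ℝ; L²(D))`,
`π ∈ B²(ℝ)`, and each condition of the problem is understood up to the identification of almost
periodic functions. For the boundary condition `w = 0` on `∂D` this means that the Fourier
coefficients of `w` have zero trace. -/
structure IsBasicFlow (D : CrossSection) (ν : ℝ) (f : ℝ → ℂ)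
    (w : ℝ → H2 D) (w' : ℝ → L2 D) (π : ℝ → ℂ) : Prop where
  mem_w : MemBes w
  deriv_w : IsBesDeriv (fun t => H2.fn (w t)) w'
  mem_π : MemBes π
  eqn : ApEquiv (fun t => w' t - (ν : ℂ) • H2.lap (w t)) (fun t => Lp.const 2 D.vol (π t))
  boundary : ∀ ξ : ℝ, MemH10 (besCoeff (fun t => H2.fn (w t)) ξ)
  flux : ApEquiv (fun t => ∫ x, (H2.fn (w t)) x ∂D.vol) f

end

/-! The Fourier coefficients decouple the frequencies. With `W`, `P`, `F` the coefficients of `w`,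
`π`, `f` at `ξ`, the problem becomes the elliptic one `iξW - νΔW = P`, `∫W = F`, with `W` in `H² ∩
H¹₀` (`IsFlowMode`).

The heart is a bound for one mode with a constant depending on `D` alone
(`IsFlowMode.exists_bound`). Pairing with `W` and taking imaginary and real parts gives `|ξ|‖W‖² ≤
|P||F|` and `ν‖∇W‖² ≤ |P||F|`. Pairing with one fixed test function of nonzero mean gives `|P| ≲
|ξ|‖W‖ + ν‖∇W‖`. Together, `|P|² ≲ (|ξ| + ν)|P||F|`, so `|P| ≲ (|ξ| + ν)|F|`; the same bound for
`|ξ|‖W‖` and `ν‖ΔW‖` follows. The case `F = 0` is uniqueness. For existence, `(-Δ)⁻¹` is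
self-adjoint and the mode equation is its resolvent equation at a non-real point (at `ξ = 0` it is
trivial); this gives a solution with pressure `1`, whose flux is nonzero by uniqueness, and
rescaling adjusts the flux.

Two tools are built by hand. One is `H²` regularity of the Dirichlet problem
(`exists_H2_dirichletInv`): difference quotients along shears that slide along the boundary graph
control tangential derivatives of the gradient, and the equation supplies the normal one. The other
is harmonic analysis in `B²`: Bessel (`sqrt_sum_le_besSeminorm`) and Parseval
(`MemBes.besSeminorm_le`) turn bounds on modes into bounds on functions, and a Riesz-Fischer theorem
(`exists_memBes_of_summable`) sums the modes. The latter adds blocks of the series, each switched on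
smoothly only at late times, so the sum is locally finite, takes values in the span of the modes and
can be differentiated term by term. -/

noncomputable section

/-! ### Window means and the Besicovitch seminorm -/

/-- The normalized Lebesgue measure on `[-R, R]`. -/
def winMeasure (R : ℝ) : Measure ℝ :=
  (ENNReal.ofReal (2 * R))⁻¹ • volume.restrict (Set.Icc (-R) R)

theorem isProbabilityMeasure_winMeasure {R : ℝ} (hR : 0 < R) :
    IsProbabilityMeasure (winMeasure R) := by
  constructor
  have h : ENNReal.ofReal (2 * R) ≠ 0 := by simpa using hR
  rw [winMeasure, Measure.smul_apply, Measure.restrict_apply_univ, Real.volume_Icc, smul_eq_mul,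
    show R - -R = 2 * R by ring, ENNReal.inv_mul_cancel h ENNReal.ofReal_ne_top]

section Normed

variable {X : Type*} [NormedAddCommGroup X]

theorem besSeminorm_eq_limsup (u : ℝ → X) :
    besSeminorm u = limsup (fun R => eLpNorm u 2 (winMeasure R)) atTop := by
  refine limsup_congr (Eventually.of_forall fun R => ?_)
  rw [eLpNorm_eq_lintegral_rpow_enorm_toReal (by norm_num) (by norm_num)]
  simp only [ENNReal.toReal_ofNat, winMeasure, lintegral_smul_measure, smul_eq_mul,
    ENNReal.div_eq_inv_mul, ENNReal.rpow_ofNat]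

theorem memLp_winMeasure {u : ℝ → X}
    (hu : ∀ R : ℝ, MemLp u 2 (volume.restrict (Set.Icc (-R) R))) {R : ℝ} (hR : 0 < R) :
    MemLp u 2 (winMeasure R) := by
  refine (hu R).smul_measure ?_
  simpa using hR

theorem besSeminorm_add_le {u v : ℝ → X}
    (hu : ∀ R : ℝ, MemLp u 2 (volume.restrict (Set.Icc (-R) R)))
    (hv : ∀ R : ℝ, MemLp v 2 (volume.restrict (Set.Icc (-R) R))) :
    besSeminorm (fun t => u t + v t) ≤ besSeminorm u + besSeminorm v := by
  simp only [besSeminorm_eq_limsup]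
  refine ENNReal.le_of_forall_pos_le_add fun ε hε hfin => ?_
  obtain ⟨h1, h2⟩ := ENNReal.add_lt_top.1 hfin
  have hε' : (ε / 2 : ℝ≥0∞) ≠ 0 := by simpa using hε.ne'
  refine limsup_le_of_le (h := ?_)
  filter_upwards [eventually_gt_atTop 0,
    eventually_lt_of_limsup_lt (ENNReal.lt_add_right h1.ne hε'),
    eventually_lt_of_limsup_lt (ENNReal.lt_add_right h2.ne hε')] with R hR e1 e2
  refine (eLpNorm_add_le (memLp_winMeasure hu hR).1
    (memLp_winMeasure hv hR).1 (by norm_num)).trans ((add_le_add e1.le e2.le).trans ?_)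
  rw [add_add_add_comm, ENNReal.add_halves]

theorem besSeminorm_le_smul {Y : Type*} [NormedAddCommGroup Y] {u : ℝ → X} {v : ℝ → Y} {C : ℝ}
    (h : ∀ t, ‖u t‖ ≤ C * ‖v t‖) : besSeminorm u ≤ ENNReal.ofReal C * besSeminorm v := by
  simp only [besSeminorm_eq_limsup]
  rw [← ENNReal.limsup_const_mul_of_ne_top ENNReal.ofReal_ne_top]
  exact limsup_le_limsup (Eventually.of_forall fun R =>
    eLpNorm_le_mul_eLpNorm_of_ae_le_mul (Eventually.of_forall h) 2)

theorem memLp_of_continuous {u : ℝ → X} (hu : Continuous u) (R : ℝ) :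
    MemLp u 2 (volume.restrict (Set.Icc (-R) R)) := by
  obtain ⟨C, hC⟩ := (isCompact_Icc (a := -R) (b := R)).exists_bound_of_continuousOn hu.continuousOn
  refine MemLp.of_bound (hu.continuousOn.aestronglyMeasurable_of_isCompact isCompact_Icc
      measurableSet_Icc) C ?_
  filter_upwards [ae_restrict_mem measurableSet_Icc] with x hx using hC x hx

end Normed

/-! ### Characters and generalized Fourier coefficients -/

section Coefficients

variable {X : Type*} [NormedAddCommGroup X] [NormedSpace ℂ X]
variable {Y : Type*} [NormedAddCommGroup Y] [NormedSpace ℂ Y]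

/-- The character `t ↦ e^{iξt}`. -/
def besChar (ξ t : ℝ) : ℂ := Complex.exp (Complex.I * (ξ : ℂ) * (t : ℂ))

theorem norm_besChar (ξ t : ℝ) : ‖besChar ξ t‖ = 1 := by
  rw [besChar, show Complex.I * (ξ : ℂ) * (t : ℂ) = ((ξ * t : ℝ) : ℂ) * Complex.I by
    push_cast; ring, Complex.norm_exp_ofReal_mul_I]

theorem continuous_besChar (ξ : ℝ) : Continuous (besChar ξ) := by
  unfold besChar; fun_prop

theorem besChar_mul (ξ η t : ℝ) : besChar ξ t * besChar η t = besChar (ξ + η) t := by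
  rw [besChar, besChar, besChar, ← Complex.exp_add]
  congr 1
  push_cast
  ring

theorem besChar_neg (ξ t : ℝ) :
    besChar (-ξ) t = Complex.exp (-(Complex.I * (ξ : ℂ) * (t : ℂ))) := by
  simp [besChar]

theorem conj_besChar (ξ t : ℝ) : (starRingEnd ℂ) (besChar ξ t) = besChar (-ξ) t := by
  simp [besChar, ← Complex.exp_conj]

theorem hasDerivAt_besChar (ξ t : ℝ) :
    HasDerivAt (besChar ξ) (Complex.I * ξ * besChar ξ t) t := by
  have h : HasDerivAt (fun z : ℂ => Complex.exp (Complex.I * (ξ : ℂ) * z))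
      (Complex.exp (Complex.I * (ξ : ℂ) * t) * (Complex.I * ξ * 1)) t :=
    ((hasDerivAt_id (t : ℂ)).const_mul (Complex.I * (ξ : ℂ))).cexp
  exact h.comp_ofReal.congr_deriv (by rw [besChar]; ring)

theorem modeMean_eq_integral (u : ℝ → X) (ξ : ℝ) {R : ℝ} (hR : 0 < R) :
    modeMean u ξ R = ∫ t, besChar (-ξ) t • u t ∂(winMeasure R) := by
  rw [modeMean, winMeasure, integral_smul_measure, intervalIntegral.integral_of_le (by linarith),
    ← integral_Icc_eq_integral_Ioc]
  simp only [besChar_neg, ENNReal.toReal_inv]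
  rw [ENNReal.toReal_ofReal (by positivity)]

theorem hasBesCoeff_iff {u : ℝ → X} {ξ : ℝ} {a : X} :
    HasBesCoeff u ξ a ↔
      Tendsto (fun R => ∫ t, besChar (-ξ) t • u t ∂(winMeasure R)) atTop (𝓝 a) := by
  refine tendsto_congr' ?_
  filter_upwards [eventually_gt_atTop 0] with R hR using modeMean_eq_integral u ξ hR

theorem memLp_besChar_smul {u : ℝ → X} {μ : Measure ℝ} (hu : MemLp u 2 μ) (ξ : ℝ) :
    MemLp (fun t => besChar ξ t • u t) 2 μ :=
  hu.of_le ((continuous_besChar ξ).aestronglyMeasurable.smul hu.1)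
    (Eventually.of_forall fun t => by simp [norm_smul, norm_besChar])

theorem integrable_besChar_smul {u : ℝ → X}
    (hu : ∀ R : ℝ, MemLp u 2 (volume.restrict (Set.Icc (-R) R))) (ξ : ℝ) {R : ℝ} (hR : 0 < R) :
    Integrable (fun t => besChar ξ t • u t) (winMeasure R) := by
  have := isProbabilityMeasure_winMeasure hR
  exact (memLp_besChar_smul (memLp_winMeasure hu hR) ξ).integrable (by norm_num)

theorem HasBesCoeff.const_smul {u : ℝ → X} {ξ : ℝ} {a : X} (c : ℂ)
    (ha : HasBesCoeff u ξ a) : HasBesCoeff (fun t => c • u t) ξ (c • a) := by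
  rw [hasBesCoeff_iff] at *
  refine (ha.const_smul c).congr' (Eventually.of_forall fun R => ?_)
  simp only
  rw [← integral_smul]
  simp only [smul_comm c]

theorem HasBesCoeff.sub {u v : ℝ → X} {ξ : ℝ} {a b : X}
    (hu : ∀ R : ℝ, MemLp u 2 (volume.restrict (Set.Icc (-R) R)))
    (hv : ∀ R : ℝ, MemLp v 2 (volume.restrict (Set.Icc (-R) R)))
    (ha : HasBesCoeff u ξ a) (hb : HasBesCoeff v ξ b) :
    HasBesCoeff (fun t => u t - v t) ξ (a - b) := by
  rw [hasBesCoeff_iff] at *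
  refine (ha.sub hb).congr' ?_
  filter_upwards [eventually_gt_atTop 0] with R hR
  rw [← integral_sub (integrable_besChar_smul hu _ hR) (integrable_besChar_smul hv _ hR)]
  simp only [smul_sub]

theorem HasBesCoeff.clm_apply [CompleteSpace X] [CompleteSpace Y] {u : ℝ → X} {ξ : ℝ} {a : X}
    (T : X →L[ℂ] Y) (hu : ∀ R : ℝ, MemLp u 2 (volume.restrict (Set.Icc (-R) R)))
    (ha : HasBesCoeff u ξ a) : HasBesCoeff (fun t => T (u t)) ξ (T a) := by
  rw [hasBesCoeff_iff] at *
  refine ((T.continuous.tendsto a).comp ha).congr' ?_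
  filter_upwards [eventually_gt_atTop 0] with R hR
  rw [Function.comp_apply, ← T.integral_comp_comm (integrable_besChar_smul hu _ hR)]
  simp only [map_smul]

theorem HasBesCoeff.eq_besCoeff {u : ℝ → X} {ξ : ℝ} {a : X} (h : HasBesCoeff u ξ a) :
    besCoeff u ξ = a := Tendsto.limUnder_eq h

theorem HasBesCoeff.unique {u : ℝ → X} {ξ : ℝ} {a b : X} (h : HasBesCoeff u ξ a)
    (h' : HasBesCoeff u ξ b) : a = b := tendsto_nhds_unique h h'

theorem continuous_trigPoly (s : Finset ℝ) (c : ℝ → X) : Continuous (trigPoly s c) := by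
  unfold trigPoly; fun_prop

theorem trigPoly_eq (s : Finset ℝ) (c : ℝ → X) (t : ℝ) :
    trigPoly s c t = ∑ ξ ∈ s, besChar ξ t • c ξ := rfl

theorem map_trigPoly (T : X →L[ℂ] Y) (s : Finset ℝ) (c : ℝ → X) (t : ℝ) :
    T (trigPoly s c t) = trigPoly s (fun ξ => T (c ξ)) t := by
  simp [trigPoly]

/-- Orthogonality of characters: for `ξ ≠ 0` the integral over any window is at most `2 / |ξ|`, so
the normalization sends the mean to zero. -/
theorem tendsto_mean_besChar (ξ : ℝ) :
    Tendsto (fun R => ∫ t, besChar ξ t ∂(winMeasure R)) atTop (𝓝 (if ξ = 0 then 1 else 0)) := by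
  split_ifs with h
  · subst h
    refine tendsto_const_nhds.congr' ?_
    filter_upwards [eventually_gt_atTop 0] with R hR
    have := isProbabilityMeasure_winMeasure hR
    simp [besChar]
  · have h2 : Tendsto (fun R : ℝ => (2 * R)⁻¹ * (2 / |ξ|)) atTop (𝓝 0) := by
      have : Tendsto (fun R : ℝ => (2 * R)⁻¹) atTop (𝓝 0) :=
        tendsto_inv_atTop_zero.comp (tendsto_id.const_mul_atTop (by norm_num))
      simpa using this.mul_const (2 / |ξ|)
    refine squeeze_zero_norm' ?_ h2
    filter_upwards [eventually_gt_atTop 0] with R hR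
    have hI : (Complex.I * ξ) ≠ 0 := by simp [h]
    have e : ∫ t in (-R)..R, besChar ξ t = (besChar ξ R - besChar ξ (-R)) / (Complex.I * ξ) := by
      unfold besChar
      rw [integral_exp_mul_complex hI]
    rw [winMeasure, integral_smul_measure, integral_Icc_eq_integral_Ioc,
      ← intervalIntegral.integral_of_le (by linarith), e, ENNReal.toReal_inv,
      ENNReal.toReal_ofReal (by positivity), norm_smul, norm_div]
    have h3 : ‖besChar ξ R - besChar ξ (-R)‖ ≤ 2 := by
      refine (norm_sub_le _ _).trans ?_
      rw [norm_besChar, norm_besChar]; norm_num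
    have h4 : ‖Complex.I * (ξ : ℂ)‖ = |ξ| := by simp
    rw [h4, Real.norm_of_nonneg (by positivity)]
    gcongr

theorem hasBesCoeff_trigPoly [CompleteSpace X] (s : Finset ℝ) (c : ℝ → X) (ξ : ℝ) :
    HasBesCoeff (trigPoly s c) ξ (if ξ ∈ s then c ξ else 0) := by
  rw [hasBesCoeff_iff]
  have h : Tendsto (fun R => ∑ η ∈ s, (∫ t, besChar (η - ξ) t ∂(winMeasure R)) • c η) atTop
      (𝓝 (∑ η ∈ s, (if η - ξ = 0 then (1 : ℂ) else 0) • c η)) :=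
    tendsto_finsetSum _ fun η _ => (tendsto_mean_besChar (η - ξ)).smul_const _
  have e : ∑ η ∈ s, (if η - ξ = 0 then (1 : ℂ) else 0) • c η = if ξ ∈ s then c ξ else 0 := by
    simp [sub_eq_zero, ite_smul]
  rw [e] at h
  refine h.congr' ?_
  filter_upwards [eventually_gt_atTop 0] with R hR
  have hi : ∀ η : ℝ, Integrable (fun t => besChar (η - ξ) t) (winMeasure R) := fun η => by
    simpa using integrable_besChar_smul (u := fun _ => (1 : ℂ))
      (memLp_of_continuous continuous_const) (η - ξ) hR
  simp only [trigPoly_eq, Finset.smul_sum, smul_smul, besChar_mul]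
  rw [integral_finsetSum]
  · refine Finset.sum_congr rfl fun η _ => ?_
    rw [integral_smul_const, neg_add_eq_sub]
  · intro η _
    rw [neg_add_eq_sub]
    exact (hi η).smul_const _

/-- The window measure is a probability measure and characters are unimodular, so the `L¹` mean is
dominated by the `L²` mean. -/
theorem norm_integral_le_eLpNorm_winMeasure {u : ℝ → X}
    (hu : ∀ R : ℝ, MemLp u 2 (volume.restrict (Set.Icc (-R) R))) (ξ : ℝ) {R : ℝ} (hR : 0 < R) :
    ‖∫ t, besChar ξ t • u t ∂(winMeasure R)‖ₑ ≤ eLpNorm u 2 (winMeasure R) := by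
  have := isProbabilityMeasure_winMeasure hR
  have hm := memLp_winMeasure hu hR
  calc ‖∫ t, besChar ξ t • u t ∂(winMeasure R)‖ₑ
      ≤ ∫⁻ t, ‖besChar ξ t • u t‖ₑ ∂(winMeasure R) := enorm_integral_le_lintegral_enorm _
    _ = eLpNorm u 1 (winMeasure R) := by
      rw [eLpNorm_one_eq_lintegral_enorm]
      refine lintegral_congr fun t => ?_
      rw [enorm_smul, ← ofReal_norm, norm_besChar]; simp
    _ ≤ eLpNorm u 2 (winMeasure R) := eLpNorm_le_eLpNorm_of_exponent_le (by norm_num) hm.1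

/-- Means of functions that are close in the Besicovitch seminorm are eventually close. -/
theorem eventually_norm_sub_le_of_besSeminorm {u v : ℝ → X}
    (hu : ∀ R : ℝ, MemLp u 2 (volume.restrict (Set.Icc (-R) R)))
    (hv : ∀ R : ℝ, MemLp v 2 (volume.restrict (Set.Icc (-R) R))) (ξ : ℝ) {ε : ℝ}
    (h : besSeminorm (fun t => u t - v t) < ENNReal.ofReal ε) :
    ∀ᶠ R in atTop, ‖(∫ t, besChar ξ t • u t ∂(winMeasure R)) -
      ∫ t, besChar ξ t • v t ∂(winMeasure R)‖ < ε := by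
  rw [besSeminorm_eq_limsup] at h
  filter_upwards [eventually_lt_of_limsup_lt h, eventually_gt_atTop 0] with R h1 hR
  rw [← integral_sub (integrable_besChar_smul hu _ hR) (integrable_besChar_smul hv _ hR)]
  simp only [← smul_sub]
  have h2 := (norm_integral_le_eLpNorm_winMeasure (fun R => (hu R).sub (hv R)) ξ hR).trans_lt h1
  rw [← ofReal_norm] at h2
  exact (ENNReal.ofReal_lt_ofReal_iff_of_nonneg (norm_nonneg _)).1 h2

/-- The window means form a Cauchy family: they stay eventually close to those of an approximating
trigonometric polynomial, which converge. -/
theorem MemBes.exists_hasBesCoeff [CompleteSpace X] {u : ℝ → X} (hu : MemBes u) (ξ : ℝ) :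
    ∃ a, HasBesCoeff u ξ a := by
  simp only [hasBesCoeff_iff]
  rw [← cauchy_map_iff_exists_tendsto, Metric.cauchy_iff]
  refine ⟨inferInstance, fun ε hε => ?_⟩
  -- Approximation only gives a non-strict bound; `ε / 8` yields the strict bound `ε / 4` needed
  -- below. Four errors of `ε / 4` are then added.
  obtain ⟨s, c, hsc⟩ := hu.approx (ENNReal.ofReal (ε / 8)) (by simpa using hε)
  have h1 := eventually_norm_sub_le_of_besSeminorm hu.locL2
    (memLp_of_continuous (continuous_trigPoly s c)) (-ξ) (ε := ε / 4)
    (hsc.trans_lt ((ENNReal.ofReal_lt_ofReal_iff (by linarith)).2 (by linarith)))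
  have h2 := Metric.tendsto_nhds.1 (hasBesCoeff_iff.1 (hasBesCoeff_trigPoly s c ξ)) (ε / 4)
    (by linarith)
  refine ⟨_, image_mem_map (h1.and h2), ?_⟩
  rintro _ ⟨R, ⟨hR1, hR2⟩, rfl⟩ _ ⟨S, ⟨hS1, hS2⟩, rfl⟩
  rw [← dist_eq_norm] at hR1 hS1
  refine (dist_triangle4_right _ _ (∫ t, besChar (-ξ) t • trigPoly s c t ∂(winMeasure R))
    (∫ t, besChar (-ξ) t • trigPoly s c t ∂(winMeasure S))).trans_lt ?_
  have := dist_triangle_right (∫ t, besChar (-ξ) t • trigPoly s c t ∂(winMeasure R))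
    (∫ t, besChar (-ξ) t • trigPoly s c t ∂(winMeasure S)) (if ξ ∈ s then c ξ else 0)
  linarith

theorem MemBes.hasBesCoeff [CompleteSpace X] {u : ℝ → X} (hu : MemBes u) (ξ : ℝ) :
    HasBesCoeff u ξ (besCoeff u ξ) := by
  obtain ⟨a, ha⟩ := hu.exists_hasBesCoeff ξ
  rwa [ha.eq_besCoeff]

theorem MemBes.clm_apply {u : ℝ → X} (hu : MemBes u) (T : X →L[ℂ] Y) :
    MemBes (fun t => T (u t)) := by
  refine ⟨fun R => T.comp_memLp' (hu.locL2 R), fun ε hε => ?_⟩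
  obtain ⟨δ, hδ, hδε⟩ : ∃ δ : ℝ≥0∞, 0 < δ ∧ ENNReal.ofReal ‖T‖ * δ ≤ ε := by
    rcases eq_or_ne ε ⊤ with rfl | h
    · exact ⟨1, by simp, le_top⟩
    have h1 : ENNReal.ofReal (‖T‖ + 1) ≠ 0 := by simp; positivity
    refine ⟨ε / ENNReal.ofReal (‖T‖ + 1), ENNReal.div_pos hε.ne' ENNReal.ofReal_ne_top, ?_⟩
    calc _ ≤ ENNReal.ofReal (‖T‖ + 1) * (ε / ENNReal.ofReal (‖T‖ + 1)) := by
          gcongr; linarith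
      _ ≤ ε := ENNReal.mul_div_le
  obtain ⟨s, c, h⟩ := hu.approx δ hδ
  refine ⟨s, fun ξ => T (c ξ), le_trans ?_ hδε⟩
  refine (besSeminorm_le_smul (v := fun t => u t - trigPoly s c t) fun t => ?_).trans
    (by gcongr)
  rw [← map_trigPoly, ← map_sub]
  exact T.le_opNorm _

end Coefficients

/-! ### Bessel and Parseval inequalities -/

section Hilbert

variable {X : Type*} [NormedAddCommGroup X] [InnerProductSpace ℂ X] [CompleteSpace X]

theorem integral_inner_trigPoly {u : ℝ → X}
    (hu : ∀ R : ℝ, MemLp u 2 (volume.restrict (Set.Icc (-R) R))) (s : Finset ℝ) (c : ℝ → X)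
    {R : ℝ} (hR : 0 < R) :
    ∫ t, inner ℂ (trigPoly s c t) (u t) ∂(winMeasure R) =
      ∑ ξ ∈ s, inner ℂ (c ξ) (∫ t, besChar (-ξ) t • u t ∂(winMeasure R)) := by
  simp only [trigPoly_eq, sum_inner, inner_smul_left, conj_besChar, ← inner_smul_right]
  rw [integral_finsetSum]
  · exact Finset.sum_congr rfl fun ξ _ => integral_inner (integrable_besChar_smul hu _ hR) _
  · exact fun ξ _ => (integrable_besChar_smul hu _ hR).const_inner _

theorem tendsto_integral_inner_trigPoly {u : ℝ → X}
    (hu : ∀ R : ℝ, MemLp u 2 (volume.restrict (Set.Icc (-R) R))) (s : Finset ℝ) (c a : ℝ → X)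
    (ha : ∀ ξ ∈ s, HasBesCoeff u ξ (a ξ)) :
    Tendsto (fun R => ∫ t, inner ℂ (trigPoly s c t) (u t) ∂(winMeasure R)) atTop
      (𝓝 (∑ ξ ∈ s, inner ℂ (c ξ) (a ξ))) := by
  have h : Tendsto (fun R => ∑ ξ ∈ s, inner ℂ (c ξ) (∫ t, besChar (-ξ) t • u t ∂(winMeasure R)))
      atTop (𝓝 (∑ ξ ∈ s, inner ℂ (c ξ) (a ξ))) :=
    tendsto_finsetSum _ fun ξ hξ => tendsto_const_nhds.inner (hasBesCoeff_iff.1 (ha ξ hξ))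
  refine h.congr' ?_
  filter_upwards [eventually_gt_atTop 0] with R hR using (integral_inner_trigPoly hu s c hR).symm

theorem tendsto_mean_norm_sq_trigPoly (s : Finset ℝ) (c : ℝ → X) :
    Tendsto (fun R => ∫ t, ‖trigPoly s c t‖ ^ 2 ∂(winMeasure R)) atTop
      (𝓝 (∑ ξ ∈ s, ‖c ξ‖ ^ 2)) := by
  have h := tendsto_integral_inner_trigPoly (memLp_of_continuous (continuous_trigPoly s c)) s c c
    (fun ξ hξ => by simpa [hξ] using hasBesCoeff_trigPoly s c ξ)
  have h' := (Complex.continuous_re.tendsto _).comp h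
  have e : (∑ ξ ∈ s, inner ℂ (c ξ) (c ξ)).re = ∑ ξ ∈ s, ‖c ξ‖ ^ 2 := by
    rw [Complex.re_sum]
    exact Finset.sum_congr rfl fun ξ _ => (norm_sq_eq_re_inner (𝕜 := ℂ) (c ξ)).symm
  rw [e] at h'
  refine h'.congr fun R => ?_
  simp only [Function.comp_apply, inner_self_eq_norm_sq_to_K]
  norm_cast

theorem norm_sq_sub_expand {E : Type*} [NormedAddCommGroup E] [InnerProductSpace ℂ E] (x y : E) :
    ‖x‖ ^ 2 - ‖x - y‖ ^ 2 = 2 * (inner ℂ y x).re - ‖y‖ ^ 2 := by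
  rw [norm_sub_sq (𝕜 := ℂ), inner_re_symm, RCLike.re_eq_complex_re]
  ring

/-- The mean of `‖u‖²` alone need not converge here, but in this difference it cancels, leaving
terms that are determined by the coefficients on `s`. Bessel's inequality is the case `c = a`;
Parseval's takes for the polynomial an approximation of `u`. -/
theorem tendsto_mean_sub {u : ℝ → X}
    (hu : ∀ R : ℝ, MemLp u 2 (volume.restrict (Set.Icc (-R) R))) (s : Finset ℝ) (c a : ℝ → X)
    (ha : ∀ ξ ∈ s, HasBesCoeff u ξ (a ξ)) :
    Tendsto (fun R => (∫ t, ‖u t‖ ^ 2 ∂(winMeasure R)) -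
      ∫ t, ‖u t - trigPoly s c t‖ ^ 2 ∂(winMeasure R)) atTop
      (𝓝 (∑ ξ ∈ s, (‖a ξ‖ ^ 2 - ‖a ξ - c ξ‖ ^ 2))) := by
  have hp := memLp_of_continuous (continuous_trigPoly s c)
  have h1 := (((Complex.continuous_re.tendsto _).comp
    (tendsto_integral_inner_trigPoly hu s c a ha)).const_mul 2).sub
    (tendsto_mean_norm_sq_trigPoly s c)
  have e : 2 * (∑ ξ ∈ s, inner ℂ (c ξ) (a ξ)).re - ∑ ξ ∈ s, ‖c ξ‖ ^ 2 =
      ∑ ξ ∈ s, (‖a ξ‖ ^ 2 - ‖a ξ - c ξ‖ ^ 2) := by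
    rw [Complex.re_sum, Finset.mul_sum, ← Finset.sum_sub_distrib]
    exact Finset.sum_congr rfl fun ξ _ => (norm_sq_sub_expand _ _).symm
  rw [e] at h1
  refine h1.congr' ?_
  filter_upwards [eventually_gt_atTop 0] with R hR
  have hu' := memLp_winMeasure hu hR
  have hp' := memLp_winMeasure hp hR
  have i1 : Integrable (fun t => inner ℂ (trigPoly s c t) (u t)) (winMeasure R) := by
    simp only [trigPoly_eq, sum_inner, inner_smul_left, conj_besChar, ← inner_smul_right]
    exact integrable_finsetSum _ fun ξ _ => (integrable_besChar_smul hu _ hR).const_inner _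
  have i2 := hu'.integrable_norm_pow (p := 2) (by norm_num)
  have i3 := hp'.integrable_norm_pow (p := 2) (by norm_num)
  have i4 : Integrable (fun t => ‖u t - trigPoly s c t‖ ^ 2) (winMeasure R) :=
    (hu'.sub hp').integrable_norm_pow (p := 2) (by norm_num)
  have e1 : (∫ t, inner ℂ (trigPoly s c t) (u t) ∂(winMeasure R)).re =
      ∫ t, (inner ℂ (trigPoly s c t) (u t)).re ∂(winMeasure R) := (integral_re i1).symm
  simp only [Function.comp_apply]
  have i5 : Integrable (fun t => 2 * (inner ℂ (trigPoly s c t) (u t)).re) (winMeasure R) :=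
    i1.re.const_mul 2
  rw [e1, ← integral_const_mul, ← integral_sub i5 i3, ← integral_sub i2 i4]
  refine integral_congr_ae (Eventually.of_forall fun t => ?_)
  simpa using (norm_sq_sub_expand (u t) (trigPoly s c t)).symm

theorem eLpNorm_two_eq_sqrt {α E : Type*} [MeasurableSpace α] [NormedAddCommGroup E]
    {μ : Measure α} {u : α → E} (hu : MemLp u 2 μ) :
    eLpNorm u 2 μ = ENNReal.ofReal √(∫ t, ‖u t‖ ^ 2 ∂μ) := by
  rw [hu.eLpNorm_eq_integral_rpow_norm (by norm_num) (by norm_num), Real.sqrt_eq_rpow]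
  norm_num

/-- Bessel's inequality. -/
theorem sqrt_sum_le_besSeminorm {u : ℝ → X}
    (hu : ∀ R : ℝ, MemLp u 2 (volume.restrict (Set.Icc (-R) R))) (s : Finset ℝ) (a : ℝ → X)
    (ha : ∀ ξ ∈ s, HasBesCoeff u ξ (a ξ)) :
    ENNReal.ofReal √(∑ ξ ∈ s, ‖a ξ‖ ^ 2) ≤ besSeminorm u := by
  -- With the coefficients of `u` itself in the polynomial, the limit is exactly the partial sum of
  -- squares.
  have h := (ENNReal.continuous_ofReal.tendsto _).comp
    ((Real.continuous_sqrt.tendsto _).comp (tendsto_mean_sub hu s a a ha))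
  simp only [sub_self, norm_zero, ne_eq, OfNat.ofNat_ne_zero, not_false_eq_true, zero_pow,
    sub_zero] at h
  rw [← h.limsup_eq, besSeminorm_eq_limsup]
  refine limsup_le_limsup ?_
  filter_upwards [eventually_gt_atTop 0] with R hR
  rw [eLpNorm_two_eq_sqrt (memLp_winMeasure hu hR)]
  refine ENNReal.ofReal_le_ofReal (Real.sqrt_le_sqrt ?_)
  have : 0 ≤ ∫ t, ‖u t - trigPoly s a t‖ ^ 2 ∂(winMeasure R) :=
    integral_nonneg fun t => by positivity
  linarith

/-- No signs are needed since `√` is zero on negative reals. In the application `F - G` is a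
difference of mean squares and may be negative. -/
theorem sqrt_le_sqrt_sub_add_sqrt (F G : ℝ) : √F ≤ √(F - G) + √G := by
  rcases le_total G F with h | h
  · rcases le_total 0 G with h0 | h0
    · rw [Real.sqrt_le_left (by positivity), add_sq, Real.sq_sqrt (sub_nonneg.2 h),
        Real.sq_sqrt h0]
      nlinarith [mul_nonneg (Real.sqrt_nonneg (F - G)) (Real.sqrt_nonneg G)]
    · rw [Real.sqrt_eq_zero_of_nonpos h0, add_zero]
      exact Real.sqrt_le_sqrt (by linarith)
  · exact (Real.sqrt_le_sqrt h).trans (le_add_of_nonneg_left (Real.sqrt_nonneg _))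

/-- Parseval's inequality: the Besicovitch seminorm is bounded by the coefficients. -/
theorem MemBes.besSeminorm_le {u : ℝ → X} (hu : MemBes u) {M : ℝ≥0∞}
    (hM : ∀ s : Finset ℝ, ENNReal.ofReal √(∑ ξ ∈ s, ‖besCoeff u ξ‖ ^ 2) ≤ M) :
    besSeminorm u ≤ M := by
  refine ENNReal.le_of_forall_pos_le_add fun ε hε hfin => ?_
  have hε' : (ε / 2 : ℝ≥0∞) ≠ 0 := by simpa using hε.ne'
  obtain ⟨s, c, hsc⟩ := hu.approx (ε / 4) (by simpa using hε.ne')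
  have hlt : besSeminorm (fun t => u t - trigPoly s c t) < ε / 2 := by
    refine hsc.trans_lt ?_
    exact ENNReal.div_lt_div_left (by simpa using hε.ne') ENNReal.coe_ne_top (by norm_num)
  have h := (ENNReal.continuous_ofReal.tendsto _).comp
    ((Real.continuous_sqrt.tendsto _).comp
      (tendsto_mean_sub hu.locL2 s c _ fun ξ _ => hu.hasBesCoeff ξ))
  -- The limit only sees frequencies in `s`, and the coefficient errors enter with a minus sign; so
  -- the hypothesis for the finite set `s` suffices.
  have hle : ENNReal.ofReal √(∑ ξ ∈ s, (‖besCoeff u ξ‖ ^ 2 - ‖besCoeff u ξ - c ξ‖ ^ 2)) ≤ M := by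
    refine le_trans (ENNReal.ofReal_le_ofReal (Real.sqrt_le_sqrt ?_)) (hM s)
    exact Finset.sum_le_sum fun ξ _ => sub_le_self _ (by positivity)
  rw [besSeminorm_eq_limsup] at hlt ⊢
  refine limsup_le_of_le (h := ?_)
  filter_upwards [eventually_gt_atTop 0, eventually_lt_of_limsup_lt hlt,
    h.eventually_lt_const (hle.trans_lt (ENNReal.lt_add_right hfin.ne hε'))] with R hR e1 e2
  have hp := memLp_of_continuous (continuous_trigPoly s c)
  have hm : MemLp (fun t => u t - trigPoly s c t) 2 (winMeasure R) :=
    memLp_winMeasure (fun R => (hu.locL2 R).sub (hp R)) hR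
  rw [eLpNorm_two_eq_sqrt hm] at e1
  rw [eLpNorm_two_eq_sqrt (memLp_winMeasure hu.locL2 hR)]
  refine (ENNReal.ofReal_le_ofReal (sqrt_le_sqrt_sub_add_sqrt _
    (∫ t, ‖u t - trigPoly s c t‖ ^ 2 ∂(winMeasure R)))).trans ?_
  rw [ENNReal.ofReal_add (Real.sqrt_nonneg _) (Real.sqrt_nonneg _), ← ENNReal.add_halves (ε : ℝ≥0∞),
    ← add_assoc]
  exact add_le_add e2.le e1.le

theorem tendsto_eLpNorm_trigPoly (s : Finset ℝ) (c : ℝ → X) :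
    Tendsto (fun R => eLpNorm (trigPoly s c) 2 (winMeasure R)) atTop
      (𝓝 (ENNReal.ofReal √(∑ ξ ∈ s, ‖c ξ‖ ^ 2))) := by
  have h := (ENNReal.continuous_ofReal.tendsto _).comp
    ((Real.continuous_sqrt.tendsto _).comp (tendsto_mean_norm_sq_trigPoly s c))
  refine h.congr' ?_
  filter_upwards [eventually_gt_atTop 0] with R hR
  rw [eLpNorm_two_eq_sqrt
    (memLp_winMeasure (memLp_of_continuous (continuous_trigPoly s c)) hR)]
  rfl

end Hilbert

/-! ### Cutoffs in time -/

section Cutoff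

/-- A smooth even function vanishing on `[-r, r]` and equal to one outside `[-r-1, r+1]`. -/
def outerCutoff (r t : ℝ) : ℝ := Real.smoothTransition (t - r) + Real.smoothTransition (-t - r)

theorem contDiff_outerCutoff (r : ℝ) : ContDiff ℝ ∞ (outerCutoff r) :=
  (Real.smoothTransition.contDiff.comp (contDiff_id.sub contDiff_const)).add
    (Real.smoothTransition.contDiff.comp (contDiff_id.neg.sub contDiff_const))

theorem outerCutoff_eq_zero {r t : ℝ} (h : |t| ≤ r) : outerCutoff r t = 0 := by
  have := abs_le.1 h
  rw [outerCutoff, Real.smoothTransition.zero_of_nonpos (by linarith),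
    Real.smoothTransition.zero_of_nonpos (by linarith), add_zero]

theorem outerCutoff_eq_one {r t : ℝ} (hr : 0 ≤ r) (h : r + 1 ≤ |t|) : outerCutoff r t = 1 := by
  rcases le_abs.1 h with h | h
  · rw [outerCutoff, Real.smoothTransition.one_of_one_le (by linarith),
      Real.smoothTransition.zero_of_nonpos (by linarith), add_zero]
  · rw [outerCutoff, Real.smoothTransition.zero_of_nonpos (by linarith),
      Real.smoothTransition.one_of_one_le (by linarith), zero_add]

theorem abs_outerCutoff_le {r : ℝ} (hr : 0 ≤ r) (t : ℝ) : |outerCutoff r t| ≤ 1 := by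
  have h0 : 0 ≤ outerCutoff r t :=
    add_nonneg (Real.smoothTransition.nonneg _) (Real.smoothTransition.nonneg _)
  rw [abs_of_nonneg h0, outerCutoff]
  rcases le_total 0 t with h | h
  · rw [Real.smoothTransition.zero_of_nonpos (x := -t - r) (by linarith), add_zero]
    exact Real.smoothTransition.le_one _
  · rw [Real.smoothTransition.zero_of_nonpos (x := t - r) (by linarith), zero_add]
    exact Real.smoothTransition.le_one _

theorem exists_bound_deriv_smoothTransition :
    ∃ K : ℝ, 0 ≤ K ∧ ∀ t, |deriv Real.smoothTransition t| ≤ K := by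
  have hc : Continuous (deriv Real.smoothTransition) :=
    (Real.smoothTransition.contDiff (n := 1)).continuous_deriv le_rfl
  obtain ⟨K, hK⟩ := (isCompact_Icc (a := (0 : ℝ)) (b := 1)).exists_bound_of_continuousOn
    hc.continuousOn
  refine ⟨max K 0, le_max_right _ _, fun t => ?_⟩
  by_cases ht : t ∈ Set.Icc (0 : ℝ) 1
  · exact (hK t ht).trans (le_max_left _ _)
  have : deriv Real.smoothTransition t = 0 := by
    rw [Set.mem_Icc, not_and_or, not_le, not_le] at ht
    rcases ht with h | h
    · have : Real.smoothTransition =ᶠ[𝓝 t] fun _ => 0 := by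
        filter_upwards [Iio_mem_nhds h] with x hx
        exact Real.smoothTransition.zero_of_nonpos (le_of_lt hx)
      rw [this.deriv_eq, deriv_const]
    · have : Real.smoothTransition =ᶠ[𝓝 t] fun _ => 1 := by
        filter_upwards [Ioi_mem_nhds h] with x hx
        exact Real.smoothTransition.one_of_one_le (le_of_lt hx)
      rw [this.deriv_eq, deriv_const]
  rw [this, abs_zero]
  exact le_max_right _ _

/-- It matters that the bound does not depend on `r`: the transition zone always has unit width,
however late it is placed. -/
theorem exists_bound_deriv_outerCutoff :
    ∃ K : ℝ, 0 ≤ K ∧ ∀ r t, |deriv (outerCutoff r) t| ≤ K := by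
  obtain ⟨K, hK0, hK⟩ := exists_bound_deriv_smoothTransition
  refine ⟨K + K, by positivity, fun r t => ?_⟩
  have hd : Differentiable ℝ Real.smoothTransition :=
    (Real.smoothTransition.contDiff (n := 1)).differentiable (by norm_num)
  have h1 : HasDerivAt (fun t : ℝ => Real.smoothTransition (t - r))
      (deriv Real.smoothTransition (t - r) * 1) t :=
    (hd _).hasDerivAt.comp t ((hasDerivAt_id t).sub_const r)
  have h2 : HasDerivAt (fun t : ℝ => Real.smoothTransition (-t - r))
      (deriv Real.smoothTransition (-t - r) * (-1)) t :=
    (hd _).hasDerivAt.comp t ((hasDerivAt_id t).neg.sub_const r)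
  have e : deriv (outerCutoff r) t = _ := (h1.add h2).deriv
  rw [e]
  refine (abs_add_le _ _).trans (add_le_add ?_ ?_)
  · simpa using hK _
  · simpa using hK _

theorem deriv_outerCutoff_eq_zero {r t : ℝ} (h : |t| < r) : deriv (outerCutoff r) t = 0 := by
  have : outerCutoff r =ᶠ[𝓝 t] fun _ => 0 := by
    filter_upwards [continuous_abs.continuousAt.eventually_lt_const h] with x hx
    exact outerCutoff_eq_zero (le_of_lt hx)
  rw [this.deriv_eq, deriv_const]

theorem deriv_outerCutoff_eq_zero' {r t : ℝ} (hr : 0 ≤ r) (h : r + 1 < |t|) :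
    deriv (outerCutoff r) t = 0 := by
  have : outerCutoff r =ᶠ[𝓝 t] fun _ => 1 := by
    filter_upwards [continuous_abs.continuousAt.eventually_const_lt h] with x hx
    exact outerCutoff_eq_one hr (le_of_lt hx)
  rw [this.deriv_eq, deriv_const]

end Cutoff

/-! ### Locally finite sums of functions of time -/

section Glue

variable {Z : Type*} [NormedAddCommGroup Z]

/-- The total `L²` norm is finite and the factor `(2R)^(-1/2)` of the window tends to zero, so
changes at bounded times are invisible. -/
theorem besSeminorm_eq_zero_of_bounded_support {u : ℝ → Z} (hu : Continuous u) {T : ℝ}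
    (hT : ∀ t, T < |t| → u t = 0) : besSeminorm u = 0 := by
  have hc : HasCompactSupport u := HasCompactSupport.intro (isCompact_Icc (a := -T) (b := T))
    fun t ht => hT t (by
      by_contra! h
      exact ht ⟨(abs_le.1 h).1, (abs_le.1 h).2⟩)
  have hm : MemLp u 2 volume := hu.memLp_of_hasCompactSupport hc
  have hb : ∀ᶠ R in atTop, eLpNorm u 2 (winMeasure R) ≤
      (ENNReal.ofReal (2 * R))⁻¹ ^ (1 / (2 : ℝ)) * eLpNorm u 2 volume := by
    filter_upwards [eventually_gt_atTop 0] with R hR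
    rw [winMeasure, eLpNorm_smul_measure_of_ne_top (by norm_num), smul_eq_mul]
    simp only [ENNReal.toReal_ofNat, ENNReal.toReal_div, ENNReal.toReal_one]
    gcongr
    exact Measure.restrict_le_self
  have hl : Tendsto (fun R : ℝ => (ENNReal.ofReal (2 * R))⁻¹ ^ (1 / (2 : ℝ)) * eLpNorm u 2 volume)
      atTop (𝓝 0) := by
    have h1 : Tendsto (fun R : ℝ => ENNReal.ofReal (2 * R)) atTop (𝓝 ⊤) :=
      ENNReal.tendsto_ofReal_nhds_top.2 (tendsto_id.const_mul_atTop (by norm_num))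
    have h2 := (tendsto_inv_iff.2 h1)
    have h3 := (ENNReal.continuous_rpow_const (y := 1 / (2 : ℝ))).tendsto _ |>.comp h2
    have h4 := ENNReal.Tendsto.mul_const h3 (Or.inr hm.2.ne)
    simpa using h4
  rw [besSeminorm_eq_limsup]
  exact le_antisymm ((limsup_le_limsup hb).trans hl.limsup_eq.le) bot_le

/-- The sum of a sequence of functions of which only the first `⌈|t|⌉` can be nonzero at `t`. -/
def localSum (D : ℕ → ℝ → Z) (t : ℝ) : Z := ∑ n ∈ Finset.range ⌈|t|⌉₊, D n t

theorem localSum_eq {D : ℕ → ℝ → Z} (hD : ∀ (n : ℕ) (t : ℝ), |t| ≤ n → D n t = 0) {M : ℕ} {t : ℝ}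
    (h : |t| ≤ M) : localSum D t = ∑ n ∈ Finset.range M, D n t := by
  refine Finset.sum_subset ?_ fun n _ hn => hD n t ?_
  · exact Finset.range_mono (Nat.ceil_le.2 h)
  · rw [Finset.mem_range, not_lt] at hn
    exact Nat.ceil_le.1 hn

theorem localSum_eventuallyEq {D : ℕ → ℝ → Z} (hD : ∀ (n : ℕ) (t : ℝ), |t| ≤ n → D n t = 0)
    {M : ℕ} {t : ℝ} (hM : |t| < M) :
    localSum D =ᶠ[𝓝 t] fun t => ∑ n ∈ Finset.range M, D n t := by
  filter_upwards [continuous_abs.continuousAt.eventually_lt_const hM] with x hx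
  exact localSum_eq hD (le_of_lt hx)

theorem continuous_localSum {D : ℕ → ℝ → Z} (hD : ∀ (n : ℕ) (t : ℝ), |t| ≤ n → D n t = 0)
    (hc : ∀ n, Continuous (D n)) : Continuous (localSum D) := by
  rw [continuous_iff_continuousAt]
  intro t
  obtain ⟨M, hM⟩ := exists_nat_gt |t|
  refine ContinuousAt.congr ?_ (localSum_eventuallyEq hD hM).symm
  exact (continuous_finsetSum _ fun n _ => hc n).continuousAt

/-- Turns a bound for large windows into one for all windows: on windows inside `[-r, r]` the
function vanishes. -/
theorem eLpNorm_winMeasure_le_of_eq_zero {Z' : Type*} [NormedAddCommGroup Z'] {u : ℝ → Z}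
    {v : ℝ → Z'} {r b : ℝ} (h0 : ∀ t, |t| ≤ r → u t = 0)
    (hle : ∀ t, ‖u t‖ ≤ ‖v t‖)
    (hv : ∀ R, r ≤ R → eLpNorm v 2 (winMeasure R) ≤ ENNReal.ofReal b) (R : ℝ) :
    eLpNorm u 2 (winMeasure R) ≤ ENNReal.ofReal b := by
  rcases le_total r R with h | h
  · exact (eLpNorm_mono hle).trans (hv R h)
  · have : u =ᵐ[winMeasure R] fun _ => 0 := by
      have h1 : ∀ᵐ t ∂(volume.restrict (Set.Icc (-R) R)), u t = 0 := by
        filter_upwards [ae_restrict_mem measurableSet_Icc] with t ht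
        exact h0 t ((abs_le.2 ht).trans h)
      exact Measure.ae_smul_measure h1 _
    rw [eLpNorm_congr_ae this]
    simp

/-- On a fixed window only finitely many terms are nonzero, so Minkowski applies; the bounds `b n`
are uniform in the window, so the tail estimate survives the limit `R → ∞`. -/
theorem besSeminorm_localSum_sub_le {D : ℕ → ℝ → Z} (hD : ∀ (n : ℕ) (t : ℝ), |t| ≤ n → D n t = 0)
    (hc : ∀ n, Continuous (D n)) {b : ℕ → ℝ} (hb0 : ∀ n, 0 ≤ b n) (hb : Summable b)
    (h : ∀ n R, eLpNorm (D n) 2 (winMeasure R) ≤ ENNReal.ofReal (b n)) (N : ℕ) :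
    besSeminorm (fun t => localSum D t - ∑ n ∈ Finset.range N, D n t) ≤
      ENNReal.ofReal (∑' n, b (n + N)) := by
  rw [besSeminorm_eq_limsup]
  refine limsup_le_of_le (h := ?_)
  filter_upwards [eventually_gt_atTop 0] with R hR
  obtain ⟨M, hM⟩ := exists_nat_gt R
  have e : (fun t => localSum D t - ∑ n ∈ Finset.range N, D n t) =ᵐ[winMeasure R]
      ∑ n ∈ Finset.range M, D (n + N) := by
    have h1 : ∀ᵐ t ∂(volume.restrict (Set.Icc (-R) R)),
        localSum D t - ∑ n ∈ Finset.range N, D n t = (∑ n ∈ Finset.range M, D (n + N)) t := by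
      filter_upwards [ae_restrict_mem measurableSet_Icc] with t ht
      have ht' : |t| ≤ ((N + M : ℕ) : ℝ) := by
        push_cast
        have := abs_le.2 ht
        have : (0 : ℝ) ≤ N := Nat.cast_nonneg N
        linarith
      rw [localSum_eq hD ht', Finset.sum_range_add, add_sub_cancel_left, Finset.sum_apply]
      simp only [add_comm]
    exact Measure.ae_smul_measure h1 _
  rw [eLpNorm_congr_ae e]
  refine (eLpNorm_sum_le (fun n _ => (hc _).aestronglyMeasurable) (by norm_num)).trans ?_
  refine (Finset.sum_le_sum fun n _ => h _ R).trans ?_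
  rw [← ENNReal.ofReal_sum_of_nonneg fun n _ => hb0 _]
  exact ENNReal.ofReal_le_ofReal
    (((summable_nat_add_iff N).2 hb).sum_le_tsum _ fun n _ => hb0 _)

end Glue

/-! ### Riesz-Fischer theorem in `B²` -/

section RieszFischer

variable {X : Type*} [NormedAddCommGroup X] [InnerProductSpace ℂ X] [CompleteSpace X]
variable {Y : Type*} [NormedAddCommGroup Y] [InnerProductSpace ℂ Y] [CompleteSpace Y]

theorem hasBesCoeff_of_approx {u : ℝ → X}
    (hu : ∀ R : ℝ, MemLp u 2 (volume.restrict (Set.Icc (-R) R))) {ξ : ℝ} {a : X}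
    (h : ∀ ε : ℝ, 0 < ε → ∃ (s : Finset ℝ) (c : ℝ → X),
      besSeminorm (fun t => u t - trigPoly s c t) < ENNReal.ofReal ε ∧
      ‖(if ξ ∈ s then c ξ else 0) - a‖ < ε) : HasBesCoeff u ξ a := by
  rw [hasBesCoeff_iff, Metric.tendsto_nhds]
  intro ε hε
  obtain ⟨s, c, h1, h2⟩ := h (ε / 3) (by linarith)
  filter_upwards [eventually_norm_sub_le_of_besSeminorm hu
    (memLp_of_continuous (continuous_trigPoly s c)) (-ξ) h1,
    Metric.tendsto_nhds.1 (hasBesCoeff_iff.1 (hasBesCoeff_trigPoly s c ξ)) (ε / 3)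
    (by linarith)] with R hR1 hR2
  rw [← dist_eq_norm] at hR1 h2
  have := dist_triangle4 (∫ t, besChar (-ξ) t • u t ∂(winMeasure R))
    (∫ t, besChar (-ξ) t • trigPoly s c t ∂(winMeasure R)) (if ξ ∈ s then c ξ else 0) a
  linarith

theorem trigPoly_sum_sdiff {E : Type*} [NormedAddCommGroup E] [NormedSpace ℂ E]
    {s : ℕ → Finset ℝ} (hs : Monotone s) (h0 : s 0 = ∅) (c : ℝ → E) (N : ℕ) (t : ℝ) :
    ∑ n ∈ Finset.range N, trigPoly (s (n + 1) \ s n) c t = trigPoly (s N) c t := by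
  induction N with
  | zero => simp [h0, trigPoly]
  | succ N ih =>
    rw [Finset.sum_range_succ, ih, add_comm]
    exact Finset.sum_sdiff (hs (Nat.le_succ N))

/-- Given cut-off blocks of a trigonometric series, their sum is in `B²` with the expected
coefficients. -/
theorem memBes_localSum {s : ℕ → Finset ℝ} (hs : Monotone s) (h0 : s 0 = ∅) {c : ℝ → X}
    {D : ℕ → ℝ → X} (hD : ∀ (n : ℕ) (t : ℝ), |t| ≤ n → D n t = 0)
    (hc : ∀ n, Continuous (D n)) {b : ℕ → ℝ} (hb0 : ∀ n, 0 ≤ b n) (hb : Summable b)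
    (h : ∀ n R, eLpNorm (D n) 2 (winMeasure R) ≤ ENNReal.ofReal (b n))
    (hT : ∀ n, ∃ T, ∀ t, T < |t| → D n t = trigPoly (s (n + 1) \ s n) c t)
    (hcs : ∀ ξ, ∀ ε > 0, ∀ᶠ n in atTop, ‖(if ξ ∈ s n then c ξ else 0) - c ξ‖ < ε) :
    MemBes (localSum D) ∧ ∀ ξ, HasBesCoeff (localSum D) ξ (c ξ) := by
  have hcont := continuous_localSum hD hc
  have hle : ∀ N, besSeminorm (fun t => localSum D t - trigPoly (s N) c t) ≤
      ENNReal.ofReal (∑' n, b (n + N)) := by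
    intro N
    have hc1 : Continuous fun t => localSum D t - ∑ n ∈ Finset.range N, D n t :=
      hcont.sub (continuous_finsetSum _ fun n _ => hc n)
    have hc2 : Continuous fun t => ∑ n ∈ Finset.range N, D n t - trigPoly (s N) c t :=
      (continuous_finsetSum _ fun n _ => hc n).sub (continuous_trigPoly _ _)
    -- Beyond the largest of finitely many times, each cut-off block equals its trigonometric
    -- polynomial, and the blocks telescope.
    have hz : besSeminorm (fun t => ∑ n ∈ Finset.range N, D n t - trigPoly (s N) c t) = 0 := by
      choose T hT using hT
      refine besSeminorm_eq_zero_of_bounded_support hc2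
        (T := ∑ n ∈ Finset.range N, |T n|) fun t ht => ?_
      rw [← trigPoly_sum_sdiff hs h0, sub_eq_zero]
      refine Finset.sum_congr rfl fun n hn => hT n t (lt_of_le_of_lt ?_ ht)
      exact (le_abs_self _).trans (Finset.single_le_sum (f := fun n => |T n|)
        (fun n _ => abs_nonneg _) hn)
    have := besSeminorm_add_le (memLp_of_continuous hc1) (memLp_of_continuous hc2)
    simp only [sub_add_sub_cancel, hz, add_zero] at this
    exact this.trans (besSeminorm_localSum_sub_le hD hc hb0 hb h N)
  have hlim : Tendsto (fun N => ∑' n, b (n + N)) atTop (𝓝 0) := tendsto_sum_nat_add b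
  have hlim' : Tendsto (fun N => ENNReal.ofReal (∑' n, b (n + N))) atTop (𝓝 0) := by
    simpa [Function.comp_def] using (ENNReal.continuous_ofReal.tendsto _).comp hlim
  refine ⟨⟨memLp_of_continuous hcont, fun ε hε => ?_⟩, fun ξ => ?_⟩
  · obtain ⟨N, hN⟩ := (hlim'.eventually_lt_const hε).exists
    exact ⟨s N, c, (hle N).trans hN.le⟩
  · refine hasBesCoeff_of_approx (memLp_of_continuous hcont) fun ε hε => ?_
    obtain ⟨N, hN, hN'⟩ := ((hlim'.eventually_lt_const (ENNReal.ofReal_pos.2 hε)).and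
      (hcs ξ ε hε)).exists
    exact ⟨s N, c, (hle N).trans_lt hN, hN'⟩

/-- Kept in order to obtain the boundary condition at every single time: the final function takes
values in the algebraic span of its coefficients. -/
theorem trigPoly_mem_span {E : Type*} [NormedAddCommGroup E] [NormedSpace ℂ E] (s : Finset ℝ)
    (a : ℝ → E) (t : ℝ) : trigPoly s a t ∈ Submodule.span ℂ (Set.range a) :=
  Submodule.sum_mem _ fun ξ _ => Submodule.smul_mem _ _ (Submodule.subset_span ⟨ξ, rfl⟩)

theorem hasDerivAt_trigPoly {E : Type*} [NormedAddCommGroup E] [NormedSpace ℂ E] (s : Finset ℝ)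
    (a : ℝ → E) (t : ℝ) :
    HasDerivAt (trigPoly s a) (trigPoly s (fun ξ => (Complex.I * (ξ : ℂ)) • a ξ) t) t := by
  have h : HasDerivAt (fun t => ∑ ξ ∈ s, besChar ξ t • a ξ)
      (∑ ξ ∈ s, (Complex.I * (ξ : ℂ) * besChar ξ t) • a ξ) t :=
    HasDerivAt.fun_sum fun ξ _ => (hasDerivAt_besChar ξ t).smul_const (a ξ)
  refine h.congr_deriv (Finset.sum_congr rfl fun ξ _ => ?_)
  rw [smul_smul, mul_comm]
  rfl

/-- The rate `4⁻ⁿ` for sums of squares becomes the summable rate `2⁻ⁿ` after square roots. Starting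
from the empty set lets the block differences telescope. -/
theorem exists_exhaustion {g : ℝ → ℝ} (hg : Summable g) :
    ∃ s : ℕ → Finset ℝ, Monotone s ∧ s 0 = ∅ ∧
      ∀ n, ∀ t : Finset ℝ, Disjoint t (s (n + 1)) → |∑ ξ ∈ t, g ξ| < (1 / 4) ^ n := by
  have h : ∀ n : ℕ, ∃ s : Finset ℝ, ∀ t : Finset ℝ, Disjoint t s →
      ‖∑ ξ ∈ t, g ξ‖ < (1 / 4) ^ n := fun n =>
    summable_iff_vanishing_norm.1 hg _ (by positivity)
  choose S hS using h
  refine ⟨fun n => (Finset.range n).biUnion S, ?_, by simp, fun n t ht => hS n t ?_⟩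
  · exact fun m n hmn => Finset.biUnion_subset_biUnion_of_subset_left _ (Finset.range_mono hmn)
  · exact ht.mono_right (Finset.subset_biUnion_of_mem S (Finset.self_mem_range_succ n))

/-- Stated with a majorant `g` so that one exhaustion serves both a series and its termwise
derivative. -/
theorem tail_estimates {E : Type*} [NormedAddCommGroup E] {g : ℝ → ℝ} {c : ℝ → E}
    (hcg : ∀ ξ, ‖c ξ‖ ^ 2 ≤ g ξ) {s : ℕ → Finset ℝ}
    (hsg : ∀ n, ∀ t : Finset ℝ, Disjoint t (s (n + 1)) → |∑ ξ ∈ t, g ξ| < (1 / 4) ^ n) :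
    (Summable fun n => √(∑ ξ ∈ s (n + 1) \ s n, ‖c ξ‖ ^ 2)) ∧
    ∀ ξ, ∀ ε > 0, ∀ᶠ n in atTop, ‖(if ξ ∈ s n then c ξ else 0) - c ξ‖ < ε := by
  have hle : ∀ n, ∀ t : Finset ℝ, Disjoint t (s (n + 1)) →
      √(∑ ξ ∈ t, ‖c ξ‖ ^ 2) ≤ (1 / 2) ^ n := by
    intro n t ht
    rw [Real.sqrt_le_left (by positivity), ← pow_mul, mul_comm n, pow_mul]
    refine (Finset.sum_le_sum fun ξ _ => hcg ξ).trans ((le_abs_self _).trans ?_)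
    norm_num at *
    exact (hsg n t ht).le
  constructor
  -- The tail bound controls sets disjoint from `s (n + 1)`, hence the block with index `n + 1`
  -- rather than `n`.
  · rw [← summable_nat_add_iff 1]
    refine Summable.of_nonneg_of_le (fun n => Real.sqrt_nonneg _)
      (fun n => hle n _ Finset.sdiff_disjoint) ?_
    exact summable_geometric_of_lt_one (by norm_num) (by norm_num)
  · intro ξ ε hε
    have hl : Tendsto (fun n : ℕ => (1 / 2 : ℝ) ^ n) atTop (𝓝 0) :=
      tendsto_pow_atTop_nhds_zero_of_lt_one (by norm_num) (by norm_num)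
    rw [← map_add_atTop_eq_nat 1, eventually_map]
    filter_upwards [hl.eventually_lt_const hε] with n hn
    split_ifs with h
    · simpa using hε
    · refine lt_of_le_of_lt ?_ hn
      simpa using hle n {ξ} (by simpa using h)

/-- The Riesz-Fischer theorem for `B²`, with a representative that is differentiable in time. -/
theorem exists_memBes_of_summable (ι : X →L[ℂ] Y) (a : ℝ → X)
    (ha : Summable fun ξ => ‖a ξ‖ ^ 2)
    (ha' : Summable fun ξ : ℝ => ‖(Complex.I * (ξ : ℂ)) • ι (a ξ)‖ ^ 2) :
    ∃ (w : ℝ → X) (w' : ℝ → Y), (MemBes w ∧ ∀ ξ, HasBesCoeff w ξ (a ξ)) ∧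
      (MemBes w' ∧ ∀ ξ : ℝ, HasBesCoeff w' ξ ((Complex.I * (ξ : ℂ)) • ι (a ξ))) ∧
      (∀ t, w t ∈ Submodule.span ℂ (Set.range a)) ∧
      (∀ t, HasDerivAt (fun t => ι (w t)) (w' t) t) ∧ Continuous w' := by
  set a' : ℝ → Y := fun ξ => (Complex.I * (ξ : ℂ)) • ι (a ξ) with ha'def
  obtain ⟨s, hs, h0, hsg⟩ := exists_exhaustion (ha.add ha')
  obtain ⟨hE, hca⟩ := tail_estimates (c := a)
    (fun ξ => le_add_of_nonneg_right (by positivity)) hsg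
  obtain ⟨hE', hca'⟩ := tail_estimates (c := a')
    (fun ξ => le_add_of_nonneg_left (by positivity)) hsg
  obtain ⟨K, hK0, hK⟩ := exists_bound_deriv_outerCutoff
  set p : ℕ → ℝ → X := fun n => trigPoly (s (n + 1) \ s n) a with hp
  set q : ℕ → ℝ → Y := fun n => trigPoly (s (n + 1) \ s n) a' with hq
  -- The window means of a block only converge to the root of the sum of squares; the summable slack
  -- `2⁻ⁿ` makes the bound valid from some finite window on.
  set b : ℕ → ℝ := fun n => √(∑ ξ ∈ s (n + 1) \ s n, ‖a ξ‖ ^ 2) + (1 / 2) ^ n with hb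
  set b' : ℕ → ℝ := fun n => √(∑ ξ ∈ s (n + 1) \ s n, ‖a' ξ‖ ^ 2) + (1 / 2) ^ n with hb'
  have hgeo : Summable fun n : ℕ => (1 / 2 : ℝ) ^ n :=
    summable_geometric_of_lt_one (by norm_num) (by norm_num)
  have hbs : Summable b := hE.add hgeo
  have hbs' : Summable b' := hE'.add hgeo
  have hb0 : ∀ n, 0 ≤ b n := fun n => by positivity
  have hb0' : ∀ n, 0 ≤ b' n := fun n => by positivity
  -- Block `n` is switched on only after time `r n`, when its window means have settled. The
  -- condition `n + 1 ≤ r n` makes the sum locally finite.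
  have hr : ∀ n : ℕ, ∃ r : ℝ, (n : ℝ) + 1 ≤ r ∧ ∀ R, r ≤ R →
      eLpNorm (p n) 2 (winMeasure R) ≤ ENNReal.ofReal (b n) ∧
      eLpNorm (q n) 2 (winMeasure R) ≤ ENNReal.ofReal (b' n) := by
    intro n
    have hpos : (0 : ℝ) < (1 / 2) ^ n := by positivity
    have h1 := (tendsto_eLpNorm_trigPoly (s (n + 1) \ s n) a).eventually_lt_const
      (u := ENNReal.ofReal (b n))
      ((ENNReal.ofReal_lt_ofReal_iff (by positivity)).2 (lt_add_of_pos_right _ hpos))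
    have h2 := (tendsto_eLpNorm_trigPoly (s (n + 1) \ s n) a').eventually_lt_const
      (u := ENNReal.ofReal (b' n))
      ((ENNReal.ofReal_lt_ofReal_iff (by positivity)).2 (lt_add_of_pos_right _ hpos))
    obtain ⟨r, hr⟩ := eventually_atTop.1 (h1.and h2)
    exact ⟨max r (n + 1), le_max_right _ _, fun R hR =>
      ⟨(hr R ((le_max_left _ _).trans hR)).1.le, (hr R ((le_max_left _ _).trans hR)).2.le⟩⟩
  choose r hrn hr using hr
  have hr0 : ∀ n, 0 ≤ r n := fun n => le_trans (by positivity) (hrn n)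
  have hpc : ∀ n, Continuous (p n) := fun n => continuous_trigPoly _ _
  have hqc : ∀ n, Continuous (q n) := fun n => continuous_trigPoly _ _
  have hηd : ∀ n, Differentiable ℝ (outerCutoff (r n)) := fun n =>
    (contDiff_outerCutoff (r n)).differentiable (by simp)
  have hηc : ∀ n, Continuous (deriv (outerCutoff (r n))) := fun n =>
    (contDiff_outerCutoff (r n)).continuous_deriv (by simp)
  have hnr : ∀ (n : ℕ) (t : ℝ), |t| ≤ n → |t| < r n := fun n t ht => by
    linarith [hrn n]
  -- `D n` is the cut-off block; the product rule splits the time derivative of its image under `ι`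
  -- into `D₁ n`, the cut-off derivative block, and `D₂ n`, where the cutoff is differentiated.
  set D : ℕ → ℝ → X := fun n t => outerCutoff (r n) t • p n t with hD
  set D₁ : ℕ → ℝ → Y := fun n t => outerCutoff (r n) t • q n t with hD₁
  set D₂ : ℕ → ℝ → Y := fun n t => deriv (outerCutoff (r n)) t • ι (p n t) with hD₂
  have hDc : ∀ n, Continuous (D n) := fun n => (hηd n).continuous.smul (hpc n)
  have hD₁c : ∀ n, Continuous (D₁ n) := fun n => (hηd n).continuous.smul (hqc n)
  have hD₂c : ∀ n, Continuous (D₂ n) := fun n => (hηc n).smul (ι.continuous.comp (hpc n))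
  have hD0 : ∀ (n : ℕ) (t : ℝ), |t| ≤ n → D n t = 0 := fun n t ht => by
    simp only [hD, outerCutoff_eq_zero (hnr n t ht).le, zero_smul]
  have hD'0 : ∀ (n : ℕ) (t : ℝ), |t| ≤ n → (fun t => D₁ n t + D₂ n t) t = 0 := fun n t ht => by
    simp only [hD₁, hD₂, outerCutoff_eq_zero (hnr n t ht).le,
      deriv_outerCutoff_eq_zero (hnr n t ht), zero_smul, add_zero]
  have hDle : ∀ n R, eLpNorm (D n) 2 (winMeasure R) ≤ ENNReal.ofReal (b n) := fun n R =>
    eLpNorm_winMeasure_le_of_eq_zero (r := r n) (v := p n)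
      (fun t ht => by simp only [hD, outerCutoff_eq_zero ht, zero_smul])
      (fun t => by
        rw [norm_smul, Real.norm_eq_abs]
        exact mul_le_of_le_one_left (norm_nonneg _) (abs_outerCutoff_le (hr0 n) t))
      (fun R hR => (hr n R hR).1) R
  have hD₁le : ∀ n R, eLpNorm (D₁ n) 2 (winMeasure R) ≤ ENNReal.ofReal (b' n) := fun n R =>
    eLpNorm_winMeasure_le_of_eq_zero (r := r n) (v := q n)
      (fun t ht => by simp only [hD₁, outerCutoff_eq_zero ht, zero_smul])
      (fun t => by
        rw [norm_smul, Real.norm_eq_abs]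
        exact mul_le_of_le_one_left (norm_nonneg _) (abs_outerCutoff_le (hr0 n) t))
      (fun R hR => (hr n R hR).2) R
  have hDdc : ∀ n t, |t| ≤ r n → deriv (outerCutoff (r n)) t = 0 := fun n t ht => by
    rcases ht.lt_or_eq with h | h
    · exact deriv_outerCutoff_eq_zero h
    · refine IsLocalMin.deriv_eq_zero (Eventually.of_forall fun x => ?_)
      rw [outerCutoff_eq_zero ht]
      exact add_nonneg (Real.smoothTransition.nonneg _) (Real.smoothTransition.nonneg _)
  have hD₂le : ∀ n R, eLpNorm (D₂ n) 2 (winMeasure R) ≤ ENNReal.ofReal (K * ‖ι‖ * b n) := by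
    intro n R
    refine eLpNorm_winMeasure_le_of_eq_zero (r := r n) (v := fun t => (K * ‖ι‖) • p n t)
      (fun t ht => by simp only [hD₂, hDdc n t ht, zero_smul]) (fun t => ?_) (fun R hR => ?_) R
    · rw [norm_smul, norm_smul, Real.norm_eq_abs, Real.norm_of_nonneg (by positivity), mul_assoc]
      exact mul_le_mul (hK _ _) (ι.le_opNorm _) (norm_nonneg _) hK0
    · rw [show (fun t => (K * ‖ι‖) • p n t) = (K * ‖ι‖) • p n from rfl,
        eLpNorm_const_smul, Real.enorm_of_nonneg (by positivity),
          ENNReal.ofReal_mul (p := K * ‖ι‖) (by positivity)]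
      exact mul_le_mul_right (hr n R hR).1 _
  have hglue := memBes_localSum hs h0 (c := a) hD0 hDc hb0 hbs hDle
    (fun n => ⟨r n + 1, fun t ht => by
      simp only [hD, outerCutoff_eq_one (hr0 n) ht.le, one_smul, hp]⟩) hca
  -- Each `D₂ n` has bounded support and so adds no frequencies, while its means are bounded by
  -- multiples of the summable `b n`; the derivative therefore has exactly the coefficients `a'`.
  have hglue' := memBes_localSum hs h0 (c := a') hD'0 (fun n => (hD₁c n).add (hD₂c n))
    (b := fun n => b' n + K * ‖ι‖ * b n) (fun n => by have := hb0 n; have := hb0' n; positivity)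
    (hbs'.add (hbs.mul_left _)) (fun n R => by
      refine (eLpNorm_add_le (hD₁c n).aestronglyMeasurable (hD₂c n).aestronglyMeasurable
        (by norm_num)).trans ?_
      rw [ENNReal.ofReal_add (hb0' n) (by have := hb0 n; positivity)]
      exact add_le_add (hD₁le n R) (hD₂le n R))
    (fun n => ⟨r n + 1, fun t ht => by
      simp only [hD₁, hD₂, outerCutoff_eq_one (hr0 n) ht.le, one_smul,
        deriv_outerCutoff_eq_zero' (hr0 n) ht, zero_smul, add_zero, hq]⟩) hca'
  refine ⟨_, _, hglue, hglue', fun t => ?_, fun t => ?_,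
    continuous_localSum hD'0 fun n => (hD₁c n).add (hD₂c n)⟩
  · exact Submodule.sum_mem _ fun n _ =>
      Submodule.smul_of_tower_mem _ _ (trigPoly_mem_span _ _ _)
  · obtain ⟨M, hM⟩ := exists_nat_gt |t|
    rw [localSum_eq hD'0 hM.le]
    have hd : HasDerivAt (fun t => ∑ n ∈ Finset.range M, ι (D n t))
        (∑ n ∈ Finset.range M, (D₁ n t + D₂ n t)) t := by
      refine HasDerivAt.fun_sum fun n _ => ?_
      have h1 := (hηd n t).hasDerivAt.smul
        (hasDerivAt_trigPoly (s (n + 1) \ s n) (fun ξ => ι (a ξ)) t)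
      refine h1.congr_of_eventuallyEq (Eventually.of_forall fun x => ?_) |>.congr_deriv ?_
      · simp only [hD, hp, Pi.smul_apply', ← map_trigPoly]
        exact (ι.restrictScalars ℝ).map_smul _ _
      · simp only [hD₁, hD₂, hp, hq, ha'def, map_trigPoly]
    refine hd.congr_of_eventuallyEq ?_
    filter_upwards [localSum_eventuallyEq hD0 hM] with x hx
    rw [hx, map_sum]

end RieszFischer

/-! ### Real-valued `L²` norms and the bilinear pairing -/

section L2Norm

variable {α : Type*} [MeasurableSpace α] {μ : Measure α}

/-- The `L²` norm of a function as a real number. -/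
def l2norm (μ : Measure α) (F : α → ℂ) : ℝ := (eLpNorm F 2 μ).toReal

theorem l2norm_nonneg (F : α → ℂ) : 0 ≤ l2norm μ F := ENNReal.toReal_nonneg

theorem l2norm_add_le {F G : α → ℂ} (hF : MemLp F 2 μ) (hG : MemLp G 2 μ) :
    l2norm μ (fun x => F x + G x) ≤ l2norm μ F + l2norm μ G := by
  rw [l2norm, l2norm, l2norm, ← ENNReal.toReal_add hF.2.ne hG.2.ne]
  exact ENNReal.toReal_mono (ENNReal.add_lt_top.2 ⟨hF.2, hG.2⟩).ne
    (eLpNorm_add_le hF.1 hG.1 (by norm_num))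

theorem l2norm_sub_le {F G : α → ℂ} (hF : MemLp F 2 μ) (hG : MemLp G 2 μ) :
    l2norm μ (fun x => F x - G x) ≤ l2norm μ F + l2norm μ G := by
  rw [l2norm, l2norm, l2norm, ← ENNReal.toReal_add hF.2.ne hG.2.ne]
  exact ENNReal.toReal_mono (ENNReal.add_lt_top.2 ⟨hF.2, hG.2⟩).ne
    (eLpNorm_sub_le hF.1 hG.1 (by norm_num))

theorem l2norm_le_mul {F G : α → ℂ} (hG : MemLp G 2 μ) {C : ℝ} (hC : 0 ≤ C)
    (h : ∀ x, ‖F x‖ ≤ C * ‖G x‖) : l2norm μ F ≤ C * l2norm μ G := by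
  rw [l2norm, l2norm, ← ENNReal.toReal_ofReal hC, ← ENNReal.toReal_mul]
  refine ENNReal.toReal_mono (ENNReal.mul_lt_top (by simp) hG.2).ne ?_
  exact eLpNorm_le_mul_eLpNorm_of_ae_le_mul (Eventually.of_forall h) 2

theorem l2norm_mono {F G : α → ℂ} (hG : MemLp G 2 μ)
    (h : ∀ x, ‖F x‖ ≤ ‖G x‖) : l2norm μ F ≤ l2norm μ G := by
  simpa using l2norm_le_mul hG zero_le_one (by simpa using h)

theorem l2norm_comp {F : α → ℂ} {S : α → α} (hS : MeasurePreserving S μ μ) (hF : MemLp F 2 μ) :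
    l2norm μ (fun x => F (S x)) = l2norm μ F := by
  rw [l2norm, l2norm, ← eLpNorm_comp_measurePreserving hF.1 hS]
  rfl

theorem sq_l2norm {F : α → ℂ} (hF : MemLp F 2 μ) : l2norm μ F ^ 2 = ∫ x, ‖F x‖ ^ 2 ∂μ := by
  rw [l2norm, eLpNorm_two_eq_sqrt hF, ENNReal.toReal_ofReal (Real.sqrt_nonneg _), Real.sq_sqrt]
  exact integral_nonneg fun _ => by positivity

theorem norm_integral_mul_le {F G : α → ℂ} (hF : MemLp F 2 μ) (hG : MemLp G 2 μ) :
    ‖∫ x, F x * G x ∂μ‖ ≤ l2norm μ F * l2norm μ G := by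
  have h1 : ∫ x, F x * G x ∂μ = inner ℂ hF.star.toLp hG.toLp := by
    rw [L2.inner_def]
    apply integral_congr_ae
    filter_upwards [hF.star.coeFn_toLp, hG.coeFn_toLp] with x hx hx'
    simp [hx, hx', mul_comm]
  rw [h1]
  refine (norm_inner_le_norm _ _).trans (le_of_eq ?_)
  rw [Lp.norm_toLp, Lp.norm_toLp, l2norm, l2norm]
  congr 2
  exact eLpNorm_congr_norm_ae (Eventually.of_forall fun x => by simp)

theorem integral_sub_mul {F G H : α → ℂ} (hF : MemLp F 2 μ) (hG : MemLp G 2 μ)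
    (hH : MemLp H 2 μ) :
    ∫ x, (F x - G x) * H x ∂μ = (∫ x, F x * H x ∂μ) - ∫ x, G x * H x ∂μ := by
  have h1 : Integrable (fun x => F x * H x) μ := hF.integrable_mul hH
  have h2 : Integrable (fun x => G x * H x) μ := hG.integrable_mul hH
  rw [← integral_sub h1 h2]
  simp only [sub_mul]

end L2Norm

/-! ### Test functions and directional derivatives -/

section TestFunctions

/-- Smooth functions with compact support in `Ω`. -/
structure TestOn (Ω : Set Plane) (φ : Plane → ℂ) : Prop where
  smooth : ContDiff ℝ ∞ φ
  compact : HasCompactSupport φ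
  support : tsupport φ ⊆ Ω

/-- The directional derivative. -/
def dirDeriv (v : Plane) (φ : Plane → ℂ) (x : Plane) : ℂ := fderiv ℝ φ x v

variable {Ω : Set Plane} {φ ψ : Plane → ℂ}

theorem TestOn.mono {Ω' : Set Plane} (h : TestOn Ω φ) (hΩ : Ω ⊆ Ω') : TestOn Ω' φ :=
  ⟨h.smooth, h.compact, h.support.trans hΩ⟩

theorem TestOn.univ (h : TestOn Ω φ) : TestOn Set.univ φ := h.mono (Set.subset_univ _)

theorem TestOn.differentiable (h : TestOn Ω φ) : Differentiable ℝ φ :=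
  h.smooth.differentiable (by simp)

theorem TestOn.continuous (h : TestOn Ω φ) : Continuous φ := h.smooth.continuous

theorem TestOn.memLp (h : TestOn Ω φ) : MemLp φ 2 volume :=
  h.continuous.memLp_of_hasCompactSupport h.compact

theorem TestOn.add (h : TestOn Ω φ) (h' : TestOn Ω ψ) : TestOn Ω fun x => φ x + ψ x :=
  ⟨h.smooth.add h'.smooth, h.compact.add h'.compact,
    (tsupport_add φ ψ).trans (Set.union_subset h.support h'.support)⟩

theorem TestOn.smul_smooth {η : Plane → ℂ} (hη : ContDiff ℝ ∞ η) (h : TestOn Ω φ) :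
    TestOn Ω fun x => η x * φ x :=
  ⟨hη.mul h.smooth, h.compact.mul_left, (tsupport_mul_subset_right).trans h.support⟩

theorem TestOn.neg (h : TestOn Ω φ) : TestOn Ω fun x => - φ x := by
  simpa using h.smul_smooth (η := fun _ => -1) contDiff_const

theorem TestOn.sub (h : TestOn Ω φ) (h' : TestOn Ω ψ) : TestOn Ω fun x => φ x - ψ x := by
  simpa [sub_eq_add_neg] using h.add h'.neg

theorem TestOn.conj (h : TestOn Ω φ) : TestOn Ω fun x => (starRingEnd ℂ) (φ x) := by
  have e : tsupport (fun x => (starRingEnd ℂ) (φ x)) ⊆ tsupport φ :=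
    closure_mono fun x hx h0 => hx (by simp [h0])
  exact ⟨Complex.conjCLE.contDiff.comp h.smooth,
    h.compact.comp_left (g := starRingEnd ℂ) (by simp), e.trans h.support⟩

theorem TestOn.dirDeriv (h : TestOn Ω φ) (v : Plane) : TestOn Ω (dirDeriv v φ) := by
  have e : tsupport (_root_.dirDeriv v φ) ⊆ tsupport φ :=
    closure_minimal (fun x hx => tsupport_fderiv_subset ℝ (subset_tsupport _ fun h0 =>
      hx (by simp [_root_.dirDeriv, h0]))) (isClosed_tsupport _)
  refine ⟨?_, h.compact.of_isClosed_subset (isClosed_tsupport _) e, e.trans h.support⟩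
  exact (h.smooth.fderiv_right (m := ∞) (by simp)).clm_apply contDiff_const

theorem TestOn.integrable_mul {Ω' : Set Plane} (h : TestOn Ω φ) (h' : TestOn Ω' ψ) :
    Integrable fun x => φ x * ψ x :=
  MemLp.integrable_mul h.memLp h'.memLp

/-- The sum of the `L²` norms of two directional derivatives. -/
def gradNorm (e : Fin 2 → Plane) (φ : Plane → ℂ) : ℝ :=
  l2norm volume (dirDeriv (e 0) φ) + l2norm volume (dirDeriv (e 1) φ)

theorem gradNorm_nonneg (e : Fin 2 → Plane) (φ : Plane → ℂ) : 0 ≤ gradNorm e φ :=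
  add_nonneg (l2norm_nonneg _) (l2norm_nonneg _)

theorem l2norm_dirDeriv_le (e : Fin 2 → Plane) (φ : Plane → ℂ) (j : Fin 2) :
    l2norm volume (dirDeriv (e j) φ) ≤ gradNorm e φ := by
  fin_cases j
  · exact le_add_of_nonneg_right (l2norm_nonneg _)
  · exact le_add_of_nonneg_left (l2norm_nonneg _)

/-- The Dirichlet form in the frame `e`. -/
def dirichletForm (e : Fin 2 → Plane) (φ ψ : Plane → ℂ) : ℂ :=
  ∑ j, ∫ x, dirDeriv (e j) φ x * dirDeriv (e j) ψ x

theorem dirDeriv_mul {v : Plane} {φ ψ : Plane → ℂ} {x : Plane} (h : DifferentiableAt ℝ φ x)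
    (h' : DifferentiableAt ℝ ψ x) :
    dirDeriv v (fun x => φ x * ψ x) x = φ x * dirDeriv v ψ x + ψ x * dirDeriv v φ x := by
  simp only [dirDeriv]
  rw [fderiv_fun_mul h h']
  simp

theorem dirDeriv_sub {v : Plane} {φ ψ : Plane → ℂ} {x : Plane} (h : DifferentiableAt ℝ φ x)
    (h' : DifferentiableAt ℝ ψ x) :
    dirDeriv v (fun x => φ x - ψ x) x = dirDeriv v φ x - dirDeriv v ψ x := by
  simp only [dirDeriv]
  rw [fderiv_fun_sub h h']
  simp

theorem dirDeriv_conj {v : Plane} {φ : Plane → ℂ} {x : Plane} (h : DifferentiableAt ℝ φ x) :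
    dirDeriv v (fun x => (starRingEnd ℂ) (φ x)) x = (starRingEnd ℂ) (dirDeriv v φ x) := by
  have := (Complex.conjCLE.toContinuousLinearMap.hasFDerivAt.comp x h.hasFDerivAt).fderiv
  simp only [dirDeriv]
  erw [this]
  simp

end TestFunctions

/-! ### Shears along a graph -/

section Shear

/-- The orthonormal frame given by the columns of `L⁻¹`. -/
def frame (L : Plane ≃ₗᵢ[ℝ] Plane) (j : Fin 2) : Plane := L.symm (EuclideanSpace.single j 1)

/-- The flow of translations along the graph of `γ` in the coordinates given by `L`. -/
def shear (L : Plane ≃ₗᵢ[ℝ] Plane) (γ : ℝ → ℝ) (h : ℝ) (x : Plane) : Plane :=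
  x + (h • frame L 0 + (γ (L x 0 + h) - γ (L x 0)) • frame L 1)

variable (L : Plane ≃ₗᵢ[ℝ] Plane) (γ : ℝ → ℝ)

/-- In the coordinates `(s, t) = L x` the shear is `(s, t) ↦ (s + h, t + γ(s + h) - γ(s))`. It
leaves `t - γ(s)` unchanged, so it slides the region above the graph along itself. -/
theorem map_shear_zero (h : ℝ) (x : Plane) : L (shear L γ h x) 0 = L x 0 + h := by
  simp [shear, frame]

theorem map_shear_one (h : ℝ) (x : Plane) :
    L (shear L γ h x) 1 = L x 1 + (γ (L x 0 + h) - γ (L x 0)) := by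
  simp [shear, frame]

theorem shear_shear (h k : ℝ) (x : Plane) :
    shear L γ h (shear L γ k x) = shear L γ (k + h) x := by
  apply L.injective
  ext i
  fin_cases i
  · simp [map_shear_zero, add_assoc]
  · simp [map_shear_one, map_shear_zero, add_assoc]

theorem shear_zero (x : Plane) : shear L γ 0 x = x := by simp [shear]

theorem shear_neg_shear (h : ℝ) (x : Plane) : shear L γ (-h) (shear L γ h x) = x := by
  rw [shear_shear, add_neg_cancel, shear_zero]

theorem shear_shear_neg (h : ℝ) (x : Plane) : shear L γ h (shear L γ (-h) x) = x := by
  rw [shear_shear, neg_add_cancel, shear_zero]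

variable {γ}

theorem contDiff_coord (i : Fin 2) : ContDiff ℝ ∞ fun x : Plane => L x i :=
  (EuclideanSpace.proj (𝕜 := ℝ) i).contDiff.comp L.toContinuousLinearEquiv.contDiff

theorem continuous_shear_uncurry (hγ : ContDiff ℝ ∞ γ) :
    Continuous fun p : ℝ × Plane => shear L γ p.1 p.2 := by
  have h0 : Continuous fun p : ℝ × Plane => L p.2 0 :=
    (contDiff_coord L 0).continuous.comp continuous_snd
  have hc := hγ.continuous
  unfold shear
  fun_prop

theorem contDiff_shear (hγ : ContDiff ℝ ∞ γ) (h : ℝ) : ContDiff ℝ ∞ (shear L γ h) := by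
  have h0 := contDiff_coord L 0
  unfold shear
  fun_prop

/-- In the rotated coordinates this is a skew product of translations, so no Jacobian appears in any
change of variables. -/
theorem volume_preserving_shear (hγ : ContDiff ℝ ∞ γ) (h : ℝ) :
    MeasurePreserving (shear L γ h) (volume : Measure Plane) volume := by
  have hcont := hγ.continuous
  have h1 : MeasurePreserving (fun p : ℝ × ℝ => (p.1 + h, p.2 + (γ (p.1 + h) - γ p.1)))
      (volume.prod volume) (volume.prod volume) := by
    refine (measurePreserving_add_right volume h).skew_product
      (g := fun a b => b + (γ (a + h) - γ a)) ?_ (Eventually.of_forall fun a => ?_)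
    · exact (by fun_prop : Continuous (Function.uncurry fun a b => b + (γ (a + h) - γ a))).measurable
    · exact (measurePreserving_add_right volume _).map_eq
  have h2 := (EuclideanSpace.volume_preserving_symm_measurableEquiv_toLp (Fin 2)).trans
    (volume_preserving_finTwoArrow ℝ)
  have h3 := L.symm.measurePreserving.comp (h2.symm.comp (h1.comp (h2.comp L.measurePreserving)))
  refine (congrArg (fun f => MeasurePreserving f volume volume) ?_).mp h3
  funext x
  apply L.injective
  ext i
  fin_cases i
  · simp [map_shear_zero]
  · simp [map_shear_one]

theorem hasFDerivAt_coord (x : Plane) (i : Fin 2) :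
    HasFDerivAt (fun x : Plane => L x i)
      ((EuclideanSpace.proj (𝕜 := ℝ) i).comp (L.toContinuousLinearEquiv : Plane →L[ℝ] Plane)) x :=
  ((EuclideanSpace.proj (𝕜 := ℝ) i).comp
    (L.toContinuousLinearEquiv : Plane →L[ℝ] Plane)).hasFDerivAt

theorem fderiv_shear_apply (hγ : ContDiff ℝ ∞ γ) (h : ℝ) (x v : Plane) :
    fderiv ℝ (shear L γ h) x v =
      v + (L v 0 * (deriv γ (L x 0 + h) - deriv γ (L x 0))) • frame L 1 := by
  have hd : ∀ y, HasDerivAt γ (deriv γ y) y := fun y =>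
    (hγ.differentiable (by simp) y).hasDerivAt
  have h0 := hasFDerivAt_coord L x 0
  have h1 := (hd (L x 0 + h)).comp_hasFDerivAt x (h0.add_const h)
  have h2 := (hd (L x 0)).comp_hasFDerivAt x h0
  have h3 := (hasFDerivAt_id x).add
    (((h1.sub h2).smul_const (frame L 1)).const_add (h • frame L 0))
  have h4 : HasFDerivAt (shear L γ h) _ x := h3
  rw [h4.fderiv]
  simp [mul_comm (L v 0), sub_mul]

theorem hasDerivAt_shear (hγ : ContDiff ℝ ∞ γ) (h : ℝ) (x : Plane) :
    HasDerivAt (fun h => shear L γ h x)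
      (frame L 0 + deriv γ (L (shear L γ h x) 0) • frame L 1) h := by
  have hd : HasDerivAt (fun h => γ (L x 0 + h)) (deriv γ (L x 0 + h)) h :=
    HasDerivAt.comp_const_add _ _ (hγ.differentiable (by simp) _).hasDerivAt
  rw [map_shear_zero]
  have := ((((hasDerivAt_id' h).smul_const (frame L 0)).fun_add
    ((hd.sub_const (γ (L x 0))).smul_const (frame L 1))).const_add x)
  exact this.congr_deriv (by simp)

/-- The derivative along the flow of shears. -/
def tangentDeriv (γ : ℝ → ℝ) (φ : Plane → ℂ) (x : Plane) : ℂ :=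
  dirDeriv (frame L 0) φ x + deriv γ (L x 0) * dirDeriv (frame L 1) φ x

variable {Ω : Set Plane} {φ ψ : Plane → ℂ}

theorem hasDerivAt_comp_shear (hγ : ContDiff ℝ ∞ γ) (hφ : Differentiable ℝ φ) (h : ℝ) (x : Plane) :
    HasDerivAt (fun h => φ (shear L γ h x)) (tangentDeriv L γ φ (shear L γ h x)) h := by
  refine ((hφ _).hasFDerivAt.comp_hasDerivAt h (hasDerivAt_shear L hγ h x)).congr_deriv ?_
  simp [tangentDeriv, dirDeriv]

/-- The differential of the shear is the identity plus a nilpotent term whose coefficient is a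
difference of slopes, of order `h`. This term is the commutator of shears and derivatives. -/
theorem dirDeriv_comp_shear (hγ : ContDiff ℝ ∞ γ) (hφ : Differentiable ℝ φ) (h : ℝ) (x v : Plane) :
    dirDeriv v (fun x => φ (shear L γ h x)) x = dirDeriv v φ (shear L γ h x) +
      ((L v 0 * (deriv γ (L x 0 + h) - deriv γ (L x 0)) : ℝ) : ℂ) *
        dirDeriv (frame L 1) φ (shear L γ h x) := by
  have hs : DifferentiableAt ℝ (shear L γ h) x :=
    (contDiff_shear L hγ h).differentiable (by simp) x
  simp only [dirDeriv]
  rw [fderiv_fun_comp x (hφ _) hs, ContinuousLinearMap.comp_apply, fderiv_shear_apply L hγ]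
  simp

theorem TestOn.comp_shear (hγ : ContDiff ℝ ∞ γ) (h : ℝ) (hφ : TestOn Set.univ φ)
    (hΩ : ∀ x, shear L γ h x ∈ tsupport φ → x ∈ Ω) : TestOn Ω fun x => φ (shear L γ h x) := by
  have hcont := (contDiff_shear L hγ h).continuous
  have e : tsupport (fun x => φ (shear L γ h x)) ⊆ shear L γ h ⁻¹' tsupport φ :=
    closure_minimal (fun x hx => subset_tsupport _ hx) ((isClosed_tsupport _).preimage hcont)
  refine ⟨hφ.smooth.comp (contDiff_shear L hγ h), ?_, fun x hx => hΩ x (e hx)⟩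
  refine HasCompactSupport.of_support_subset_isCompact
    (hφ.compact.isCompact.image (contDiff_shear L hγ (-h)).continuous) fun x hx => ?_
  exact ⟨shear L γ h x, subset_tsupport _ hx, shear_neg_shear L γ h x⟩

theorem continuous_tangentDeriv (hγ : ContDiff ℝ ∞ γ) (hφ : TestOn Ω φ) :
    Continuous (tangentDeriv L γ φ) := by
  have h1 := (hφ.dirDeriv (frame L 0)).continuous
  have h2 := (hφ.dirDeriv (frame L 1)).continuous
  have h3 := (hγ.continuous_deriv (by simp)).comp (contDiff_coord L 0).continuous
  exact h1.add ((Complex.continuous_ofReal.comp h3).mul h2)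

theorem norm_tangentDeriv_le {M : ℝ} (hM : ∀ t, |deriv γ t| ≤ M) (x : Plane) :
    ‖tangentDeriv L γ φ x‖ ≤ ‖dirDeriv (frame L 0) φ x‖ + M * ‖dirDeriv (frame L 1) φ x‖ := by
  refine (norm_add_le _ _).trans (add_le_add le_rfl ?_)
  rw [norm_mul, Complex.norm_real]
  exact mul_le_mul_of_nonneg_right (hM _) (norm_nonneg _)

theorem comp_shear_sub_eq_integral (hγ : ContDiff ℝ ∞ γ) (hφ : TestOn Ω φ) (h : ℝ) (x : Plane) :
    φ (shear L γ h x) - φ x = ∫ s in (0 : ℝ)..h, tangentDeriv L γ φ (shear L γ s x) := by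
  rw [intervalIntegral.integral_eq_sub_of_hasDerivAt
    (fun s _ => hasDerivAt_comp_shear L hγ hφ.differentiable s x), shear_zero]
  refine Continuous.intervalIntegrable ?_ _ _
  exact (continuous_tangentDeriv L hγ hφ).comp
    ((continuous_shear_uncurry L hγ).comp (Continuous.prodMk_left x))

/-- The increment is the integral of the tangential derivative along the flow; Cauchy-Schwarz in the
flow parameter, Tonelli and invariance of the volume give the bound. -/
theorem eLpNorm_comp_shear_sub_le (hγ : ContDiff ℝ ∞ γ) (hφ : TestOn Ω φ) (h : ℝ) :
    eLpNorm (fun x => φ (shear L γ h x) - φ x) 2 volume ≤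
      ENNReal.ofReal |h| * eLpNorm (tangentDeriv L γ φ) 2 volume := by
  set F := tangentDeriv L γ φ with hF
  have hFc : Continuous F := continuous_tangentDeriv L hγ hφ
  have hjoint : Continuous fun p : ℝ × Plane => F (shear L γ p.1 p.2) :=
    hFc.comp (continuous_shear_uncurry L hγ)
  have hvol : volume (Set.uIoc 0 h) = ENNReal.ofReal |h| := by
    rw [Set.uIoc, Real.volume_Ioc, max_sub_min_eq_abs, sub_zero]
  have hpt : ∀ x, ‖φ (shear L γ h x) - φ x‖ₑ ^ 2 ≤
      ENNReal.ofReal |h| * ∫⁻ s in Set.uIoc 0 h, ‖F (shear L γ s x)‖ₑ ^ 2 := by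
    intro x
    have hx : Continuous fun s => F (shear L γ s x) := hjoint.comp (Continuous.prodMk_left x)
    have h1 : ‖φ (shear L γ h x) - φ x‖ₑ ≤ ∫⁻ s in Set.uIoc 0 h, ‖F (shear L γ s x)‖ₑ := by
      rw [comp_shear_sub_eq_integral L hγ hφ, ← ofReal_norm,
        intervalIntegral.norm_intervalIntegral_eq, ofReal_norm]
      exact enorm_integral_le_lintegral_enorm _
    have h2 := eLpNorm_le_eLpNorm_mul_rpow_measure_univ (p := 1) (q := 2) (by norm_num)
      (hx.aestronglyMeasurable (μ := volume.restrict (Set.uIoc 0 h)))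
    rw [eLpNorm_one_eq_lintegral_enorm, Measure.restrict_apply_univ, hvol,
      eLpNorm_eq_lintegral_rpow_enorm_toReal (by norm_num) (by norm_num)] at h2
    refine (pow_le_pow_left' (h1.trans h2) 2).trans (le_of_eq ?_)
    rw [mul_pow, ← ENNReal.rpow_natCast, ← ENNReal.rpow_mul, ← ENNReal.rpow_natCast,
      ← ENNReal.rpow_mul, mul_comm]
    norm_num
  have hmeas : AEMeasurable (Function.uncurry fun (x : Plane) (s : ℝ) => ‖F (shear L γ s x)‖ₑ ^ 2)
      (volume.prod (volume.restrict (Set.uIoc 0 h))) :=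
    ((hjoint.comp continuous_swap).measurable.enorm.pow_const 2).aemeasurable
  have key : ∫⁻ x, ‖φ (shear L γ h x) - φ x‖ₑ ^ 2 ≤
      ENNReal.ofReal |h| ^ 2 * ∫⁻ x, ‖F x‖ₑ ^ 2 := by
    calc ∫⁻ x, ‖φ (shear L γ h x) - φ x‖ₑ ^ 2
        ≤ ∫⁻ x, ENNReal.ofReal |h| * ∫⁻ s in Set.uIoc 0 h, ‖F (shear L γ s x)‖ₑ ^ 2 :=
          lintegral_mono hpt
      _ = ENNReal.ofReal |h| * ∫⁻ s in Set.uIoc 0 h, ∫⁻ x, ‖F (shear L γ s x)‖ₑ ^ 2 := by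
          rw [lintegral_const_mul' _ _ ENNReal.ofReal_ne_top, lintegral_lintegral_swap hmeas]
      _ = ENNReal.ofReal |h| * ∫⁻ _ in Set.uIoc 0 h, ∫⁻ x, ‖F x‖ₑ ^ 2 := by
          congr 1
          refine lintegral_congr fun s => ?_
          exact (volume_preserving_shear L hγ s).lintegral_comp
            (f := fun x => ‖F x‖ₑ ^ 2) (hFc.measurable.enorm.pow_const 2)
      _ = _ := by
          rw [lintegral_const, Measure.restrict_apply_univ, hvol]; ring
  rw [eLpNorm_eq_lintegral_rpow_enorm_toReal (by norm_num) (by norm_num),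
    eLpNorm_eq_lintegral_rpow_enorm_toReal (by norm_num) (by norm_num)]
  simp only [ENNReal.toReal_ofNat, ENNReal.rpow_ofNat]
  refine (ENNReal.rpow_le_rpow key (by norm_num)).trans (le_of_eq ?_)
  rw [ENNReal.mul_rpow_of_nonneg _ _ (by norm_num), ← ENNReal.rpow_natCast, ← ENNReal.rpow_mul]
  norm_num

theorem TestOn.memLp_tangentDeriv {M : ℝ} (hγ : ContDiff ℝ ∞ γ) (hM : ∀ t, |deriv γ t| ≤ M)
    (hφ : TestOn Ω φ) : MemLp (tangentDeriv L γ φ) 2 volume := by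
  have hM0 : 0 ≤ M := (abs_nonneg _).trans (hM 0)
  refine ((hφ.dirDeriv (frame L 0)).memLp.norm.add
    ((hφ.dirDeriv (frame L 1)).memLp.norm.const_mul M)).mono'
    (continuous_tangentDeriv L hγ hφ).aestronglyMeasurable (Eventually.of_forall fun x => ?_)
  exact norm_tangentDeriv_le L hM x

theorem l2norm_comp_shear_sub_le {M : ℝ} (hγ : ContDiff ℝ ∞ γ) (hM : ∀ t, |deriv γ t| ≤ M)
    (hφ : TestOn Ω φ) (h : ℝ) :
    l2norm volume (fun x => φ (shear L γ h x) - φ x) ≤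
      (1 + M) * |h| * gradNorm (frame L) φ := by
  have hM0 : 0 ≤ M := (abs_nonneg _).trans (hM 0)
  have ht := hφ.memLp_tangentDeriv L hγ hM
  have h1 : l2norm volume (fun x => φ (shear L γ h x) - φ x) ≤
      |h| * l2norm volume (tangentDeriv L γ φ) := by
    rw [l2norm, l2norm, ← ENNReal.toReal_ofReal (abs_nonneg h), ← ENNReal.toReal_mul]
    exact ENNReal.toReal_mono (ENNReal.mul_lt_top (by simp) ht.2).ne
      (eLpNorm_comp_shear_sub_le L hγ hφ h)
  have h0 := (hφ.dirDeriv (frame L 0)).memLp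
  have h0' := (hφ.dirDeriv (frame L 1)).memLp
  have h2 : l2norm volume (tangentDeriv L γ φ) ≤ l2norm volume (dirDeriv (frame L 0) φ) +
      M * l2norm volume (dirDeriv (frame L 1) φ) := by
    have h3 : MemLp (fun x => ((deriv γ (L x 0) : ℝ) : ℂ) * dirDeriv (frame L 1) φ x) 2 volume := by
      refine h0'.of_le_mul (c := M) ?_ (Eventually.of_forall fun x => ?_)
      · have h3 := (hγ.continuous_deriv (by simp)).comp (contDiff_coord L 0).continuous
        exact ((Complex.continuous_ofReal.comp h3).mul
          (hφ.dirDeriv (frame L 1)).continuous).aestronglyMeasurable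
      · rw [norm_mul, Complex.norm_real]
        exact mul_le_mul_of_nonneg_right (hM _) (norm_nonneg _)
    refine (l2norm_add_le h0 h3).trans (add_le_add le_rfl (l2norm_le_mul h0' hM0 fun x => ?_))
    rw [norm_mul, Complex.norm_real]
    exact mul_le_mul_of_nonneg_right (hM _) (norm_nonneg _)
  have n0 := l2norm_nonneg (μ := volume) (dirDeriv (frame L 0) φ)
  have n1 := l2norm_nonneg (μ := volume) (dirDeriv (frame L 1) φ)
  refine h1.trans ?_
  rw [mul_comm (1 + M), mul_assoc]
  refine mul_le_mul_of_nonneg_left (h2.trans ?_) (abs_nonneg h)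
  rw [gradNorm]
  nlinarith

end Shear

/-! ### Energy estimate for localized difference quotients -/

section Caccioppoli

variable {L : Plane ≃ₗᵢ[ℝ] Plane} {γ : ℝ → ℝ} {Ω : Set Plane} {φ ψ u w : Plane → ℂ}

theorem map_frame (L : Plane ≃ₗᵢ[ℝ] Plane) (i j : Fin 2) :
    L (frame L i) j = if j = i then 1 else 0 := by
  simp [frame]

/-- The coefficient of the commutator of a shear with the derivative along the first axis. -/
def shearCoeff (L : Plane ≃ₗᵢ[ℝ] Plane) (γ : ℝ → ℝ) (h : ℝ) (x : Plane) : ℂ :=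
  ((deriv γ (L x 0 + h) - deriv γ (L x 0) : ℝ) : ℂ)

theorem contDiff_deriv (hγ : ContDiff ℝ ∞ γ) : ContDiff ℝ ∞ (deriv γ) :=
  (contDiff_infty_iff_deriv.1 hγ).2

theorem contDiff_shearCoeff (hγ : ContDiff ℝ ∞ γ) (h : ℝ) :
    ContDiff ℝ ∞ (shearCoeff L γ h) := by
  have h0 := contDiff_coord L 0
  have h1 := contDiff_deriv hγ
  exact Complex.ofRealCLM.contDiff.comp ((h1.comp (h0.add contDiff_const)).sub (h1.comp h0))

theorem norm_shearCoeff_le {M : ℝ} (hM : ∀ s t, |deriv γ s - deriv γ t| ≤ M * |s - t|) (h : ℝ)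
    (x : Plane) : ‖shearCoeff L γ h x‖ ≤ M * |h| := by
  rw [shearCoeff, Complex.norm_real]
  simpa using hM (L x 0 + h) (L x 0)

theorem dirDeriv_frame_zero_comp_shear (hγ : ContDiff ℝ ∞ γ) (hφ : Differentiable ℝ φ) (h : ℝ)
    (x : Plane) : dirDeriv (frame L 0) (fun x => φ (shear L γ h x)) x =
      dirDeriv (frame L 0) φ (shear L γ h x) +
        shearCoeff L γ h x * dirDeriv (frame L 1) φ (shear L γ h x) := by
  rw [dirDeriv_comp_shear L hγ hφ, map_frame]
  simp [shearCoeff]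

theorem dirDeriv_frame_one_comp_shear (hγ : ContDiff ℝ ∞ γ) (hφ : Differentiable ℝ φ) (h : ℝ)
    (x : Plane) : dirDeriv (frame L 1) (fun x => φ (shear L γ h x)) x =
      dirDeriv (frame L 1) φ (shear L γ h x) := by
  rw [dirDeriv_comp_shear L hγ hφ, map_frame]
  simp

theorem TestOn.comp_shear_univ (hγ : ContDiff ℝ ∞ γ) (h : ℝ) (hφ : TestOn Set.univ φ) :
    TestOn Set.univ fun x => φ (shear L γ h x) := hφ.comp_shear L hγ h fun _ _ => trivial

theorem integral_comp_shear {f : Plane → ℂ} (hγ : ContDiff ℝ ∞ γ) (h : ℝ)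
    (hf : AEStronglyMeasurable f volume) : ∫ x, f (shear L γ h x) = ∫ x, f x := by
  have hS := volume_preserving_shear L hγ h
  have := integral_map (μ := volume) hS.measurable.aemeasurable (f := f) (by rwa [hS.map_eq])
  rw [← this, hS.map_eq]

theorem integral_comp_shear_mul {f g : Plane → ℂ} (hγ : ContDiff ℝ ∞ γ) (h : ℝ)
    (hf : AEStronglyMeasurable f volume) (hg : AEStronglyMeasurable g volume) :
    ∫ x, f (shear L γ h x) * g x = ∫ x, f x * g (shear L γ (-h) x) := by
  have hg' := hg.comp_measurePreserving (volume_preserving_shear L hγ (-h))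
  rw [← integral_comp_shear (L := L) hγ h (f := fun x => f x * g (shear L γ (-h) x))
    (hf.mul hg')]
  simp only [shear_neg_shear]

/-- If shears commuted with derivatives, volume preservation would make the two forms equal. Only
the two commutator terms remain, each of order `h`. -/
theorem norm_dirichletForm_comp_shear_sub_le {M : ℝ} (hγ : ContDiff ℝ ∞ γ) (hM0 : 0 ≤ M)
    (hM : ∀ s t, |deriv γ s - deriv γ t| ≤ M * |s - t|) (h : ℝ)
    (hu : TestOn Set.univ u) (hw : TestOn Set.univ w) :
    ‖dirichletForm (frame L) (fun x => u (shear L γ h x)) w -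
      dirichletForm (frame L) u (fun x => w (shear L γ (-h) x))‖ ≤
      M * |h| * (gradNorm (frame L) u * gradNorm (frame L) w) := by
  set u0 := dirDeriv (frame L 0) u
  set u1 := dirDeriv (frame L 1) u
  set w0 := dirDeriv (frame L 0) w
  set w1 := dirDeriv (frame L 1) w
  have hu0 : TestOn Set.univ u0 := hu.dirDeriv _
  have hu1 : TestOn Set.univ u1 := hu.dirDeriv _
  have hw0 : TestOn Set.univ w0 := hw.dirDeriv _
  have hw1 : TestOn Set.univ w1 := hw.dirDeriv _
  have hu1S := (hu1.comp_shear_univ (L := L) hγ h).smul_smooth (contDiff_shearCoeff (L := L) hγ h)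
  have hw1S := (hw1.comp_shear_univ (L := L) hγ (-h)).smul_smooth
    (contDiff_shearCoeff (L := L) hγ (-h))
  have e : dirichletForm (frame L) (fun x => u (shear L γ h x)) w -
      dirichletForm (frame L) u (fun x => w (shear L γ (-h) x)) =
      (∫ x, shearCoeff L γ h x * u1 (shear L γ h x) * w0 x) -
      ∫ x, u0 x * (shearCoeff L γ (-h) x * w1 (shear L γ (-h) x)) := by
    simp only [dirichletForm, Fin.sum_univ_two, dirDeriv_frame_one_comp_shear hγ hu.differentiable,
      dirDeriv_frame_one_comp_shear hγ hw.differentiable,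
      dirDeriv_frame_zero_comp_shear hγ hu.differentiable,
      dirDeriv_frame_zero_comp_shear hγ hw.differentiable, add_mul, mul_add]
    rw [integral_add ((hu0.comp_shear_univ hγ h).integrable_mul hw0) (hu1S.integrable_mul hw0),
      integral_add (hu0.integrable_mul (hw0.comp_shear_univ hγ (-h))) (hu0.integrable_mul hw1S),
      integral_comp_shear_mul hγ h hu0.memLp.1 hw0.memLp.1,
      integral_comp_shear_mul hγ h hu1.memLp.1 hw1.memLp.1]
    ring
  rw [e]
  refine (norm_sub_le _ _).trans ?_
  have b1 := norm_integral_mul_le hu1S.memLp hw0.memLp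
  have b2 := norm_integral_mul_le hu0.memLp hw1S.memLp
  have hMh : 0 ≤ M * |h| := by positivity
  have c1 : l2norm volume (fun x => shearCoeff L γ h x * u1 (shear L γ h x)) ≤
      M * |h| * l2norm volume u1 := by
    rw [← l2norm_comp (volume_preserving_shear L hγ h) hu1.memLp]
    refine l2norm_le_mul (hu1.comp_shear_univ hγ h).memLp hMh fun x => ?_
    rw [norm_mul]
    exact mul_le_mul_of_nonneg_right (norm_shearCoeff_le hM _ _) (norm_nonneg _)
  have c2 : l2norm volume (fun x => shearCoeff L γ (-h) x * w1 (shear L γ (-h) x)) ≤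
      M * |h| * l2norm volume w1 := by
    rw [← l2norm_comp (volume_preserving_shear L hγ (-h)) hw1.memLp]
    refine l2norm_le_mul (hw1.comp_shear_univ hγ (-h)).memLp hMh fun x => ?_
    rw [norm_mul, ← abs_neg h]
    exact mul_le_mul_of_nonneg_right (norm_shearCoeff_le hM _ _) (norm_nonneg _)
  have n0 := l2norm_nonneg (μ := volume) u0
  have n1 := l2norm_nonneg (μ := volume) u1
  have m0 := l2norm_nonneg (μ := volume) w0
  have m1 := l2norm_nonneg (μ := volume) w1
  refine (add_le_add (b1.trans (mul_le_mul_of_nonneg_right c1 m0))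
    (b2.trans (mul_le_mul_of_nonneg_left c2 n0))).trans ?_
  have : gradNorm (frame L) u * gradNorm (frame L) w =
    (l2norm volume u0 + l2norm volume u1) * (l2norm volume w0 + l2norm volume w1) := rfl
  rw [this]
  have : 0 ≤ M * |h| *
      (l2norm volume u0 * l2norm volume w0 + l2norm volume u1 * l2norm volume w1) := by
    positivity
  nlinarith

/-- There is no factor `h` here, since the gradient cannot be differenced again. The bound is used
where the factor `|h|` is already present. -/
theorem gradNorm_comp_shear_sub_le {M : ℝ} (hγ : ContDiff ℝ ∞ γ) (hM0 : 0 ≤ M)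
    (hM : ∀ s t, |deriv γ s - deriv γ t| ≤ M * |s - t|) {h : ℝ} (hh : |h| ≤ 1)
    (hu : TestOn Set.univ u) :
    gradNorm (frame L) (fun x => u (shear L γ h x) - u x) ≤ (2 + M) * gradNorm (frame L) u := by
  have hu0 := hu.dirDeriv (frame L 0)
  have hu1 := hu.dirDeriv (frame L 1)
  have hS := hu.comp_shear_univ (L := L) hγ h
  have hu1S := (hu1.comp_shear_univ (L := L) hγ h).smul_smooth (contDiff_shearCoeff (L := L) hγ h)
  have hu0S := hu0.comp_shear_univ (L := L) hγ h
  have e1 : dirDeriv (frame L 1) (fun x => u (shear L γ h x) - u x) =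
      fun x => dirDeriv (frame L 1) u (shear L γ h x) - dirDeriv (frame L 1) u x := by
    funext x
    rw [dirDeriv_sub (hS.differentiable _) (hu.differentiable _),
      dirDeriv_frame_one_comp_shear hγ hu.differentiable]
  have e0 : dirDeriv (frame L 0) (fun x => u (shear L γ h x) - u x) =
      fun x => (dirDeriv (frame L 0) u (shear L γ h x) +
        shearCoeff L γ h x * dirDeriv (frame L 1) u (shear L γ h x)) - dirDeriv (frame L 0) u x := by
    funext x
    rw [dirDeriv_sub (hS.differentiable _) (hu.differentiable _),
      dirDeriv_frame_zero_comp_shear hγ hu.differentiable]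
  have c1 : l2norm volume (fun x => shearCoeff L γ h x * dirDeriv (frame L 1) u (shear L γ h x)) ≤
      M * l2norm volume (dirDeriv (frame L 1) u) := by
    rw [← l2norm_comp (volume_preserving_shear L hγ h) hu1.memLp]
    refine l2norm_le_mul (hu1.comp_shear_univ hγ h).memLp hM0 fun x => ?_
    rw [norm_mul]
    refine mul_le_mul_of_nonneg_right ((norm_shearCoeff_le hM _ _).trans ?_) (norm_nonneg _)
    exact mul_le_of_le_one_right hM0 hh
  have d0 := l2norm_sub_le (hu0S.add hu1S).memLp hu0.memLp
  have d0' := l2norm_add_le hu0S.memLp hu1S.memLp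
  have d1 := l2norm_sub_le (hu1.comp_shear_univ (L := L) hγ h).memLp hu1.memLp
  rw [l2norm_comp (volume_preserving_shear L hγ h) hu0.memLp] at d0'
  rw [l2norm_comp (volume_preserving_shear L hγ h) hu1.memLp] at d1
  rw [gradNorm, e0, e1, gradNorm]
  have n0 := l2norm_nonneg (μ := volume) (dirDeriv (frame L 0) u)
  nlinarith

theorem dirDeriv_ofReal {χ : Plane → ℝ} {x : Plane} (h : DifferentiableAt ℝ χ x) (v : Plane) :
    dirDeriv v (fun x => (χ x : ℂ)) x = ((fderiv ℝ χ x v : ℝ) : ℂ) := by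
  have := (Complex.ofRealCLM.hasFDerivAt.comp x h.hasFDerivAt).fderiv
  simp only [dirDeriv]
  erw [this]
  simp

theorem contDiff_ofReal {χ : Plane → ℝ} (h : ContDiff ℝ ∞ χ) :
    ContDiff ℝ ∞ fun x => (χ x : ℂ) := Complex.ofRealCLM.contDiff.comp h

/-- Pointwise Caccioppoli identity: testing against `χ² v̄` reproduces the square of `∂(χv)`, cross
terms included, up to the term with `(∂χ)²`. -/
theorem norm_sq_dirDeriv_mul {χ : Plane → ℝ} {v : Plane → ℂ} (hχ : Differentiable ℝ χ)
    (hv : Differentiable ℝ v) (e x : Plane) :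
    ‖dirDeriv e (fun x => (χ x : ℂ) * v x) x‖ ^ 2 =
      (dirDeriv e v x * dirDeriv e (fun x => (χ x : ℂ) *
        (starRingEnd ℂ) ((χ x : ℂ) * v x)) x).re + (fderiv ℝ χ x e) ^ 2 * ‖v x‖ ^ 2 := by
  have hχ' : Differentiable ℝ fun x => (χ x : ℂ) := Complex.ofRealCLM.differentiable.comp hχ
  have hp : Differentiable ℝ fun x => (χ x : ℂ) * v x := hχ'.mul hv
  have hp' : Differentiable ℝ fun x => (starRingEnd ℂ) ((χ x : ℂ) * v x) :=
    Complex.conjCLE.differentiable.comp hp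
  rw [dirDeriv_mul (hχ' x) (hp' x), dirDeriv_conj (hp x), dirDeriv_mul (hχ' x) (hv x),
    dirDeriv_ofReal (hχ x)]
  simp only [Complex.sq_norm, Complex.normSq_apply]
  simp
  ring

/-- Absorption of the linear term in `P`: if `P` exceeded the claimed bound, then `X ≤ P`, and both
terms on the right could be compared with `X * P`. -/
theorem le_of_sq_le_add {P X a b : ℝ} (hX : 0 ≤ X) (ha : 0 ≤ a) (hb : 0 ≤ b)
    (h : P ^ 2 ≤ a * X * P + b * X ^ 2) : P ≤ (a + b + 1) * X := by
  by_contra! hlt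
  have hP : 0 < P := lt_of_le_of_lt (by positivity) hlt
  have h1 : X ≤ P := by nlinarith [mul_nonneg ha hX, mul_nonneg hb hX]
  have h2 : (a + b + 1) * X * P < P ^ 2 := by nlinarith
  have h3 : b * X ^ 2 ≤ b * X * P := by nlinarith [mul_nonneg hb hX]
  nlinarith [mul_nonneg hX hP.le]

theorem sum_sq_dirDeriv_mul_le {χ : Plane → ℝ} {v : Plane → ℂ} {K : ℝ} (hχ : ContDiff ℝ ∞ χ)
    (hK : ∀ x j, |fderiv ℝ χ x (frame L j)| ≤ K) (hv : TestOn Set.univ v) :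
    gradNorm (frame L) (fun x => (χ x : ℂ) * v x) ^ 2 ≤
      2 * ‖dirichletForm (frame L) v (fun x => (χ x : ℂ) *
        (starRingEnd ℂ) ((χ x : ℂ) * v x))‖ + 4 * K ^ 2 * l2norm volume v ^ 2 := by
  have hp := hv.smul_smooth (contDiff_ofReal hχ)
  have hψ := hp.conj.smul_smooth (contDiff_ofReal hχ)
  set p := fun x => (χ x : ℂ) * v x
  set ψ := fun x => (χ x : ℂ) * (starRingEnd ℂ) ((χ x : ℂ) * v x)
  have hχd : Differentiable ℝ χ := hχ.differentiable (by simp)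
  have key : ∀ j, l2norm volume (dirDeriv (frame L j) p) ^ 2 ≤
      (∫ x, dirDeriv (frame L j) v x * dirDeriv (frame L j) ψ x).re +
        K ^ 2 * l2norm volume v ^ 2 := by
    intro j
    have i1 := (hv.dirDeriv (frame L j)).integrable_mul (hψ.dirDeriv (frame L j))
    have i2 : Integrable (fun x => K ^ 2 * ‖v x‖ ^ 2) volume :=
      (hv.memLp.integrable_norm_pow (p := 2) (by norm_num)).const_mul _
    have e1 : (∫ x, dirDeriv (frame L j) v x * dirDeriv (frame L j) ψ x).re =
        ∫ x, (dirDeriv (frame L j) v x * dirDeriv (frame L j) ψ x).re := (integral_re i1).symm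
    have i1' : Integrable (fun x => (dirDeriv (frame L j) v x * dirDeriv (frame L j) ψ x).re)
      volume := i1.re
    rw [sq_l2norm (hp.dirDeriv _).memLp, sq_l2norm hv.memLp, e1, ← integral_const_mul,
      ← integral_add i1' i2]
    refine integral_mono ((hp.dirDeriv _).memLp.integrable_norm_pow (p := 2) (by norm_num))
      (i1'.add i2) fun x => ?_
    simp only
    rw [norm_sq_dirDeriv_mul hχd hv.differentiable]
    refine add_le_add le_rfl (mul_le_mul_of_nonneg_right ?_ (by positivity))
    rw [← sq_abs]
    exact pow_le_pow_left₀ (abs_nonneg _) (hK x j) 2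
  have h0 := key 0
  have h1 := key 1
  have h2 : (∫ x, dirDeriv (frame L 0) v x * dirDeriv (frame L 0) ψ x).re +
      (∫ x, dirDeriv (frame L 1) v x * dirDeriv (frame L 1) ψ x).re ≤
      ‖dirichletForm (frame L) v ψ‖ := by
    rw [dirichletForm, Fin.sum_univ_two, ← Complex.add_re]
    exact Complex.re_le_norm _
  rw [gradNorm]
  -- `gradNorm` is a sum of two norms, so its square costs a factor `2`; the two directions double
  -- the `K²` term once more.
  nlinarith [sq_nonneg (l2norm volume (dirDeriv (frame L 0) p) -
    l2norm volume (dirDeriv (frame L 1) p))]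

theorem gradNorm_cutoff_le_add {χ : Plane → ℝ} {p : Plane → ℂ} {K : ℝ} (hK0 : 0 ≤ K)
    (hχ : ContDiff ℝ ∞ χ)
    (hχ1 : ∀ x, |χ x| ≤ 1) (hK : ∀ x j, |fderiv ℝ χ x (frame L j)| ≤ K)
    (hp : TestOn Set.univ p) :
    gradNorm (frame L) (fun x => (χ x : ℂ) * (starRingEnd ℂ) (p x)) ≤
      gradNorm (frame L) p + 2 * K * l2norm volume p := by
  have key : ∀ j, l2norm volume (dirDeriv (frame L j)
      fun x => (χ x : ℂ) * (starRingEnd ℂ) (p x)) ≤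
      l2norm volume (dirDeriv (frame L j) p) + K * l2norm volume p := by
    intro j
    have hχd : Differentiable ℝ χ := hχ.differentiable (by simp)
    have hχ' : Differentiable ℝ fun x => (χ x : ℂ) := Complex.ofRealCLM.differentiable.comp hχd
    have e : (dirDeriv (frame L j) fun x => (χ x : ℂ) * (starRingEnd ℂ) (p x)) = fun x =>
        (χ x : ℂ) * (starRingEnd ℂ) (dirDeriv (frame L j) p x) +
          ((fderiv ℝ χ x (frame L j) : ℝ) : ℂ) * (starRingEnd ℂ) (p x) := by
      funext x
      rw [dirDeriv_mul (hχ' x) (hp.conj.differentiable x), dirDeriv_conj (hp.differentiable x),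
        dirDeriv_ofReal (hχd x), mul_comm (starRingEnd ℂ (p x))]
    have t1 := (hp.dirDeriv (frame L j)).conj.smul_smooth (contDiff_ofReal hχ)
    have hχj : ContDiff ℝ ∞ fun x => fderiv ℝ χ x (frame L j) :=
      (hχ.fderiv_right (m := ∞) (by simp)).clm_apply contDiff_const
    have t2 := hp.conj.smul_smooth (contDiff_ofReal hχj)
    rw [e]
    refine (l2norm_add_le t1.memLp t2.memLp).trans (add_le_add ?_ ?_)
    · refine l2norm_mono (hp.dirDeriv (frame L j)).memLp fun x => ?_
      rw [norm_mul, Complex.norm_real, RCLike.norm_conj]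
      exact mul_le_of_le_one_left (norm_nonneg _) (hχ1 x)
    · refine l2norm_le_mul hp.memLp hK0 fun x => ?_
      rw [norm_mul, Complex.norm_real, RCLike.norm_conj]
      exact mul_le_mul_of_nonneg_right (hK x j) (norm_nonneg _)
  have := key 0
  have := key 1
  rw [gradNorm, gradNorm]
  linarith

theorem dirichletForm_sub_left {v : Plane → ℂ} {e : Fin 2 → Plane} (hu : TestOn Set.univ u)
    (hv : TestOn Set.univ v) (hw : TestOn Set.univ w) :
    dirichletForm e (fun x => u x - v x) w = dirichletForm e u w - dirichletForm e v w := by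
  rw [dirichletForm, dirichletForm, dirichletForm, ← Finset.sum_sub_distrib]
  refine Finset.sum_congr rfl fun j _ => ?_
  rw [← integral_sub ((hu.dirDeriv _).integrable_mul (hw.dirDeriv _))
    ((hv.dirDeriv _).integrable_mul (hw.dirDeriv _))]
  refine integral_congr_ae (Eventually.of_forall fun x => ?_)
  simp only [dirDeriv_sub (hu.differentiable x) (hv.differentiable x), sub_mul]

theorem dirichletForm_sub_right {v : Plane → ℂ} {e : Fin 2 → Plane} (hu : TestOn Set.univ u)
    (hv : TestOn Set.univ v) (hw : TestOn Set.univ w) :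
    dirichletForm e w (fun x => u x - v x) = dirichletForm e w u - dirichletForm e w v := by
  rw [dirichletForm, dirichletForm, dirichletForm, ← Finset.sum_sub_distrib]
  refine Finset.sum_congr rfl fun j _ => ?_
  rw [← integral_sub ((hw.dirDeriv _).integrable_mul (hu.dirDeriv _))
    ((hw.dirDeriv _).integrable_mul (hv.dirDeriv _))]
  refine integral_congr_ae (Eventually.of_forall fun x => ?_)
  simp only [dirDeriv_sub (hu.differentiable x) (hv.differentiable x), mul_sub]

/-- The localized difference quotient. -/
def cutDiff (L : Plane ≃ₗᵢ[ℝ] Plane) (γ : ℝ → ℝ) (χ : Plane → ℝ) (h : ℝ) (u : Plane → ℂ)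
    (x : Plane) : ℂ := (χ x : ℂ) * (u (shear L γ h x) - u x)

/-- The test function used to bound the localized difference quotient. -/
def cutTest (L : Plane ≃ₗᵢ[ℝ] Plane) (γ : ℝ → ℝ) (χ : Plane → ℝ) (h : ℝ) (u : Plane → ℂ)
    (x : Plane) : ℂ := (χ x : ℂ) * (starRingEnd ℂ) (cutDiff L γ χ h u x)

/-- The energy of the localized difference is the Dirichlet form of `u ∘ S - u` against `ψ =
cutTest`, up to lower order. A change of variables moves the difference onto `ψ` with an error of
order `h`, and `hθ`, an approximate weak equation for `u`, bounds the result. With `X = |h| B` this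
reads `P² ≤ a X P + b X²`, and absorption gives a gradient of order `h`. -/
theorem gradNorm_cutDiff_le {M K G h : ℝ} {χ : Plane → ℝ} (hγ : ContDiff ℝ ∞ γ) (hM0 : 0 ≤ M)
    (hM1 : ∀ t, |deriv γ t| ≤ M) (hM : ∀ s t, |deriv γ s - deriv γ t| ≤ M * |s - t|)
    (hK0 : 0 ≤ K) (hχ : ContDiff ℝ ∞ χ) (hχ1 : ∀ x, |χ x| ≤ 1)
    (hK : ∀ x j, |fderiv ℝ χ x (frame L j)| ≤ K) (hu : TestOn Set.univ u) (hh : |h| ≤ 1)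
    (hG : 0 ≤ G)
    (hθ : ‖dirichletForm (frame L) u
      (fun x => cutTest L γ χ h u (shear L γ (-h) x) - cutTest L γ χ h u x)‖ ≤
      G * l2norm volume (fun x => cutTest L γ χ h u (shear L γ (-h) x) - cutTest L γ χ h u x) +
      |h| * gradNorm (frame L)
        (fun x => cutTest L γ χ h u (shear L γ (-h) x) - cutTest L γ χ h u x)) :
    gradNorm (frame L) (cutDiff L γ χ h u) ≤
      (2 * (2 + M) + (4 * (2 + M) * K * (1 + M) + 4 * K ^ 2 * (1 + M) ^ 2) + 1) *
        (|h| * (gradNorm (frame L) u + G + 1)) := by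
  have huS := hu.comp_shear_univ (L := L) hγ h
  have hv := huS.sub hu
  have hp : TestOn Set.univ (cutDiff L γ χ h u) := hv.smul_smooth (contDiff_ofReal hχ)
  have hψ : TestOn Set.univ (cutTest L γ χ h u) := hp.conj.smul_smooth (contDiff_ofReal hχ)
  have hψS := hψ.comp_shear_univ (L := L) hγ (-h)
  set ψ := cutTest L γ χ h u
  have hn := abs_nonneg h
  set B := gradNorm (frame L) u + G + 1 with hB
  have hgu := gradNorm_nonneg (frame L) u
  have hgp := gradNorm_nonneg (frame L) (cutDiff L γ χ h u)
  have hgψ := gradNorm_nonneg (frame L) ψ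
  have hB0 : 0 ≤ B := by positivity
  set V := l2norm volume (fun x => u (shear L γ h x) - u x) with hV
  have hV0 : 0 ≤ V := l2norm_nonneg _
  have hV1 : V ≤ (1 + M) * (|h| * B) := by
    refine (l2norm_comp_shear_sub_le L hγ hM1 hu h).trans ?_
    rw [mul_assoc]
    gcongr
    linarith
  have hA : ‖dirichletForm (frame L) (fun x => u (shear L γ h x) - u x) ψ‖ ≤
      (2 + M) * (|h| * B) * gradNorm (frame L) ψ := by
    have e : dirichletForm (frame L) (fun x => u (shear L γ h x) - u x) ψ =
        (dirichletForm (frame L) (fun x => u (shear L γ h x)) ψ -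
          dirichletForm (frame L) u (fun x => ψ (shear L γ (-h) x))) +
        dirichletForm (frame L) u (fun x => ψ (shear L γ (-h) x) - ψ x) := by
      rw [dirichletForm_sub_left huS hu hψ, dirichletForm_sub_right hψS hψ hu]
      ring
    have t1 := norm_dirichletForm_comp_shear_sub_le (L := L) hγ hM0 hM h hu hψ
    have t2 := l2norm_comp_shear_sub_le L hγ hM1 hψ (-h)
    have t3 := gradNorm_comp_shear_sub_le (L := L) hγ hM0 hM (h := -h) (by rwa [abs_neg]) hψ
    rw [abs_neg] at t2
    rw [e]
    refine (norm_add_le _ _).trans ((add_le_add t1 (hθ.trans (add_le_add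
      (mul_le_mul_of_nonneg_left t2 hG) (mul_le_mul_of_nonneg_left t3 hn)))).trans ?_)
    have : M * |h| * (gradNorm (frame L) u * gradNorm (frame L) ψ) +
        (G * ((1 + M) * |h| * gradNorm (frame L) ψ) + |h| * ((2 + M) * gradNorm (frame L) ψ)) =
        (M * gradNorm (frame L) u + (1 + M) * G + (2 + M)) * (|h| * gradNorm (frame L) ψ) := by
      ring
    rw [this, show (2 + M) * (|h| * B) * gradNorm (frame L) ψ =
      ((2 + M) * B) * (|h| * gradNorm (frame L) ψ) by ring]
    refine mul_le_mul_of_nonneg_right ?_ (by positivity)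
    rw [hB]
    nlinarith
  have hψ1 : gradNorm (frame L) ψ ≤ gradNorm (frame L) (cutDiff L γ χ h u) + 2 * K * V := by
    refine (gradNorm_cutoff_le_add hK0 hχ hχ1 hK hp).trans ?_
    gcongr
    refine l2norm_mono hv.memLp fun x => ?_
    rw [cutDiff, norm_mul, Complex.norm_real]
    exact mul_le_of_le_one_left (norm_nonneg _) (hχ1 x)
  have h1 : gradNorm (frame L) (cutDiff L γ χ h u) ^ 2 ≤
      2 * ‖dirichletForm (frame L) (fun x => u (shear L γ h x) - u x) ψ‖ + 4 * K ^ 2 * V ^ 2 :=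
    sum_sq_dirDeriv_mul_le hχ hK hv
  refine le_of_sq_le_add (by positivity) (by positivity) (by positivity) (h1.trans ?_)
  have h2 : V ^ 2 ≤ ((1 + M) * (|h| * B)) ^ 2 := pow_le_pow_left₀ hV0 hV1 2
  have h3 : ‖dirichletForm (frame L) (fun x => u (shear L γ h x) - u x) ψ‖ ≤
      (2 + M) * (|h| * B) *
        (gradNorm (frame L) (cutDiff L γ χ h u) + 2 * K * ((1 + M) * (|h| * B))) := by
    refine hA.trans (mul_le_mul_of_nonneg_left (hψ1.trans ?_) (by positivity))
    gcongr
  have h4 : 4 * K ^ 2 * V ^ 2 ≤ 4 * K ^ 2 * ((1 + M) * (|h| * B)) ^ 2 := by gcongr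
  refine (add_le_add (mul_le_mul_of_nonneg_left h3 zero_le_two) h4).trans (le_of_eq ?_)
  ring

end Caccioppoli

/-! ### Tangential difference quotients of a weak solution -/

section Tangential

/-- `U` is the gradient, in the frame `e`, of a weak solution of `-Δu = g` in `Ω` vanishing on the
boundary, extended by zero. -/
structure WeakSolution (Ω : Set Plane) (e : Fin 2 → Plane) (U : Fin 2 → Plane → ℂ)
    (g : Plane → ℂ) : Prop where
  memLp : ∀ j, MemLp (U j) 2 volume
  integrable : ∀ j, Integrable (U j) volume
  memLp_rhs : MemLp g 2 volume
  approx : ∀ ε : ℝ, 0 < ε → ∃ φ, TestOn Ω φ ∧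
    ∀ j, l2norm volume (fun x => U j x - dirDeriv (e j) φ x) ≤ ε
  eqn : ∀ φ, TestOn Ω φ → ∑ j, ∫ x, U j x * dirDeriv (e j) φ x = ∫ x, g x * φ x

variable {L : Plane ≃ₗᵢ[ℝ] Plane} {γ : ℝ → ℝ} {Ω W : Set Plane} {φ ψ u w : Plane → ℂ}
variable {U : Fin 2 → Plane → ℂ} {g : Plane → ℂ} {χ : Plane → ℝ}

theorem tsupport_ofReal_mul_subset {f : Plane → ℂ} :
    tsupport (fun x => (χ x : ℂ) * f x) ⊆ tsupport χ :=
  closure_mono fun x hx h0 => hx (by simp [h0])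

/-- Where the cutoff lives, points carried into `Ω` already lie in `Ω`; so shifting along the
boundary does not destroy the vanishing at the boundary. -/
theorem testOn_cutDiff (hγ : ContDiff ℝ ∞ γ) (hχ : ContDiff ℝ ∞ χ) {h : ℝ}
    (hloc : ∀ x ∈ tsupport χ, shear L γ h x ∈ Ω → x ∈ Ω) (hu : TestOn Ω u) :
    TestOn Ω (cutDiff L γ χ h u) := by
  have h1 := ((hu.univ.comp_shear_univ (L := L) hγ h).sub hu.univ).smul_smooth (contDiff_ofReal hχ)
  refine ⟨h1.smooth, h1.compact, fun x hx => ?_⟩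
  have hx1 : x ∈ tsupport fun x => u (shear L γ h x) - u x := tsupport_mul_subset_right hx
  rcases (tsupport_sub _ _ hx1 : x ∈ tsupport (fun x => u (shear L γ h x)) ∪ tsupport u) with h2 | h2
  · refine hloc x (tsupport_ofReal_mul_subset hx) (hu.support ?_)
    have e : tsupport (fun x => u (shear L γ h x)) ⊆ shear L γ h ⁻¹' tsupport u :=
      closure_minimal (fun x hx => subset_tsupport _ hx)
        ((isClosed_tsupport _).preimage (contDiff_shear L hγ h).continuous)
    exact e h2
  · exact hu.support h2

/-- The solution is replaced by a test function `u` that depends on `h` and approximates its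
gradient within `|h|`. The approximation error is then of the order of the difference quotient
itself, while the constant does not depend on `h`. -/
theorem WeakSolution.exists_gradNorm_cutDiff_le (hU : WeakSolution Ω (frame L) U g) {M K : ℝ}
    (hγ : ContDiff ℝ ∞ γ) (hM0 : 0 ≤ M)
    (hM1 : ∀ t, |deriv γ t| ≤ M) (hM : ∀ s t, |deriv γ s - deriv γ t| ≤ M * |s - t|)
    (hK0 : 0 ≤ K) (hχ : ContDiff ℝ ∞ χ) (hχ1 : ∀ x, |χ x| ≤ 1)
    (hK : ∀ x j, |fderiv ℝ χ x (frame L j)| ≤ K) :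
    ∃ C, 0 ≤ C ∧ ∀ h : ℝ, h ≠ 0 → |h| ≤ 1 → (∀ x ∈ tsupport χ, shear L γ h x ∈ Ω ↔ x ∈ Ω) →
      ∃ u, TestOn Ω u ∧ (∀ j, l2norm volume (fun x => U j x - dirDeriv (frame L j) u x) ≤ |h|) ∧
        gradNorm (frame L) u ≤ C ∧ gradNorm (frame L) (cutDiff L γ χ h u) ≤ C * |h| := by
  -- The summand `2` covers the two approximation errors, each at most `|h| ≤ 1`.
  set N := l2norm volume (U 0) + l2norm volume (U 1) + 2 with hN
  have hN0 : 0 ≤ N := by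
    have := l2norm_nonneg (μ := volume) (U 0)
    have := l2norm_nonneg (μ := volume) (U 1)
    positivity
  set G := l2norm volume g
  have hG : 0 ≤ G := l2norm_nonneg _
  set A := 2 * (2 + M) + (4 * (2 + M) * K * (1 + M) + 4 * K ^ 2 * (1 + M) ^ 2) + 1 with hA
  have hA0 : 0 ≤ A := by positivity
  refine ⟨N + A * (N + G + 1), by positivity, fun h h0 h1 hloc => ?_⟩
  obtain ⟨u, hu, hue⟩ := hU.approx |h| (abs_pos.2 h0)
  have hgu : gradNorm (frame L) u ≤ N := by
    have key : ∀ j, l2norm volume (dirDeriv (frame L j) u) ≤ l2norm volume (U j) + 1 := by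
      intro j
      have hd := (hu.dirDeriv (frame L j)).memLp
      have := l2norm_sub_le (hU.memLp j) ((hU.memLp j).sub hd)
      simp only [Pi.sub_apply, sub_sub_cancel] at this
      exact this.trans (add_le_add le_rfl ((hue j).trans h1))
    rw [gradNorm]
    linarith [key 0, key 1]
  have hcut := testOn_cutDiff hγ hχ (fun x hx => (hloc x hx).1) hu
  have hψ : TestOn Ω (cutTest L γ χ h u) := hcut.conj.smul_smooth (contDiff_ofReal hχ)
  have hψS : TestOn Ω fun x => cutTest L γ χ h u (shear L γ (-h) x) := by
    refine hψ.univ.comp_shear L hγ (-h) fun x hx => ?_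
    have hx' : shear L γ (-h) x ∈ tsupport χ := tsupport_ofReal_mul_subset hx
    rw [← shear_shear_neg L γ h x]
    exact (hloc _ hx').2 (hψ.support hx)
  have hθt := hψS.sub hψ
  set θ := fun x => cutTest L γ χ h u (shear L γ (-h) x) - cutTest L γ χ h u x
  have hθ : ‖dirichletForm (frame L) u θ‖ ≤ G * l2norm volume θ + |h| * gradNorm (frame L) θ := by
    have e : dirichletForm (frame L) u θ = (∫ x, g x * θ x) -
        ∑ j, ∫ x, (U j x - dirDeriv (frame L j) u x) * dirDeriv (frame L j) θ x := by
      rw [← hU.eqn θ hθt, dirichletForm, ← Finset.sum_sub_distrib]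
      refine Finset.sum_congr rfl fun j _ => ?_
      have hd := (hu.dirDeriv (frame L j)).memLp
      have hd' := (hθt.dirDeriv (frame L j)).memLp
      rw [integral_sub_mul (hU.memLp j) hd hd', sub_sub_cancel]
    rw [e]
    refine (norm_sub_le _ _).trans (add_le_add (norm_integral_mul_le hU.memLp_rhs hθt.memLp) ?_)
    refine (norm_sum_le _ _).trans ?_
    rw [gradNorm, mul_add, Fin.sum_univ_two]
    have key : ∀ j, ‖∫ x, (U j x - dirDeriv (frame L j) u x) * dirDeriv (frame L j) θ x‖ ≤
        |h| * l2norm volume (dirDeriv (frame L j) θ) := fun j =>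
      (norm_integral_mul_le ((hU.memLp j).sub (hu.dirDeriv (frame L j)).memLp)
        (hθt.dirDeriv (frame L j)).memLp).trans
        (mul_le_mul_of_nonneg_right (hue j) (l2norm_nonneg _))
    exact add_le_add (key 0) (key 1)
  have main := gradNorm_cutDiff_le hγ hM0 hM1 hM hK0 hχ hχ1 hK hu.univ h1 hG hθ
  have hp : 0 ≤ A * (N + G + 1) := by positivity
  refine ⟨u, hu, hue, by linarith, main.trans ?_⟩
  rw [← hA]
  have hn := abs_nonneg h
  calc A * (|h| * (gradNorm (frame L) u + G + 1)) ≤ A * (|h| * (N + G + 1)) := by gcongr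
    _ ≤ (N + A * (N + G + 1)) * |h| := by nlinarith

/-- Dual form of the previous estimate, stated for `U` itself. Replacing `U j` by the derivative of
`u` costs `|h| * 2‖φ‖`; the difference then moves from `φ` to that derivative. On `W`, where `χ =
1`, the result is the derivative of `cutDiff` up to the commutator. -/
theorem WeakSolution.exists_norm_integral_shear_le (hU : WeakSolution Ω (frame L) U g) {M K : ℝ}
    (hγ : ContDiff ℝ ∞ γ) (hM0 : 0 ≤ M)
    (hM1 : ∀ t, |deriv γ t| ≤ M) (hM : ∀ s t, |deriv γ s - deriv γ t| ≤ M * |s - t|)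
    (hK0 : 0 ≤ K) (hχ : ContDiff ℝ ∞ χ) (hχ1 : ∀ x, |χ x| ≤ 1)
    (hK : ∀ x j, |fderiv ℝ χ x (frame L j)| ≤ K) (hW : IsOpen W) (hχW : ∀ x ∈ W, χ x = 1) :
    ∃ C, 0 ≤ C ∧ ∀ h : ℝ, h ≠ 0 → |h| ≤ 1 → (∀ x ∈ tsupport χ, shear L γ h x ∈ Ω ↔ x ∈ Ω) →
      ∀ φ, TestOn W φ → ∀ j,
        ‖∫ x, U j x * (φ (shear L γ (-h) x) - φ x)‖ ≤ C * |h| * l2norm volume φ := by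
  obtain ⟨C, hC0, hC⟩ := hU.exists_gradNorm_cutDiff_le hγ hM0 hM1 hM hK0 hχ hχ1 hK
  refine ⟨2 + (C + M * C), by positivity, fun h h0 h1 hloc φ hφ j => ?_⟩
  obtain ⟨u, hu, hue, hgu, hcut⟩ := hC h h0 h1 hloc
  have hφS := hφ.univ.comp_shear_univ (L := L) hγ (-h)
  have hdj := hu.univ.dirDeriv (frame L j)
  have hφn := l2norm_nonneg (μ := volume) φ
  have hn := abs_nonneg h
  have hdiff := hφS.sub hφ.univ
  have huS := hu.univ.comp_shear_univ (L := L) hγ h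
  have hp : TestOn Set.univ (cutDiff L γ χ h u) :=
    (huS.sub hu.univ).smul_smooth (contDiff_ofReal hχ)
  have e1 : ∫ x, U j x * (φ (shear L γ (-h) x) - φ x) =
      (∫ x, (U j x - dirDeriv (frame L j) u x) * (φ (shear L γ (-h) x) - φ x)) +
      ∫ x, dirDeriv (frame L j) u x * (φ (shear L γ (-h) x) - φ x) := by
    rw [integral_sub_mul (hU.memLp j) hdj.memLp hdiff.memLp, sub_add_cancel]
  have e2 : ∫ x, dirDeriv (frame L j) u x * (φ (shear L γ (-h) x) - φ x) =
      ∫ x, (dirDeriv (frame L j) u (shear L γ h x) - dirDeriv (frame L j) u x) * φ x := by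
    simp only [mul_sub, sub_mul]
    rw [integral_sub (hdj.integrable_mul hφS) (hdj.integrable_mul hφ),
      integral_sub ((hdj.comp_shear_univ (L := L) hγ h).integrable_mul hφ) (hdj.integrable_mul hφ),
      integral_comp_shear_mul hγ h hdj.memLp.1 hφ.memLp.1]
  have hd1 := (hu.univ.dirDeriv (frame L 1))
  have hc := (hd1.comp_shear_univ (L := L) hγ h).smul_smooth (contDiff_shearCoeff (L := L) hγ h)
  have hcn : l2norm volume (fun x => shearCoeff L γ h x * dirDeriv (frame L 1) u (shear L γ h x)) ≤
      M * |h| * gradNorm (frame L) u := by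
    refine le_trans ?_ (mul_le_mul_of_nonneg_left (l2norm_dirDeriv_le (frame L) u 1) (by positivity))
    rw [← l2norm_comp (volume_preserving_shear L hγ h) hd1.memLp]
    refine l2norm_le_mul (hd1.comp_shear_univ hγ h).memLp (by positivity) fun x => ?_
    rw [norm_mul]
    exact mul_le_mul_of_nonneg_right (norm_shearCoeff_le hM _ _) (norm_nonneg _)
  have hpx : ∀ x ∈ W, dirDeriv (frame L j) (cutDiff L γ χ h u) x =
      dirDeriv (frame L j) (fun x => u (shear L γ h x) - u x) x := by
    intro x hx
    have : cutDiff L γ χ h u =ᶠ[𝓝 x] fun x => u (shear L γ h x) - u x := by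
      filter_upwards [hW.mem_nhds hx] with y hy
      simp [cutDiff, hχW y hy]
    rw [dirDeriv, dirDeriv, this.fderiv_eq]
  have hφW : ∀ x, x ∉ W → φ x = 0 := fun x hx => by
    by_contra h
    exact hx (hφ.support (subset_tsupport _ h))
  have hcut' := (l2norm_dirDeriv_le (frame L) (cutDiff L γ χ h u) j).trans hcut
  have e3 : ‖∫ x, (dirDeriv (frame L j) u (shear L γ h x) - dirDeriv (frame L j) u x) * φ x‖ ≤
      (C * |h| + M * |h| * C) * l2norm volume φ := by
    have hcn' := hcn.trans (mul_le_mul_of_nonneg_left hgu (by positivity))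
    fin_cases j
    · have e : ∫ x, (dirDeriv (frame L 0) u (shear L γ h x) - dirDeriv (frame L 0) u x) * φ x =
          (∫ x, dirDeriv (frame L 0) (cutDiff L γ χ h u) x * φ x) -
          ∫ x, (shearCoeff L γ h x * dirDeriv (frame L 1) u (shear L γ h x)) * φ x := by
        rw [← integral_sub ((hp.dirDeriv _).integrable_mul hφ) (hc.integrable_mul hφ)]
        refine integral_congr_ae (Eventually.of_forall fun x => ?_)
        by_cases hx : x ∈ W
        · have := hpx x hx
          simp only [Fin.zero_eta] at this
          simp only
          rw [this, dirDeriv_sub (huS.differentiable x) (hu.differentiable x),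
            dirDeriv_frame_zero_comp_shear hγ hu.differentiable]
          ring
        · simp [hφW x hx]
      simp only [Fin.zero_eta] at hcut' ⊢
      rw [e, add_mul]
      refine (norm_sub_le _ _).trans (add_le_add ?_ ?_)
      · exact (norm_integral_mul_le (hp.dirDeriv _).memLp hφ.memLp).trans
          (mul_le_mul_of_nonneg_right hcut' hφn)
      · exact (norm_integral_mul_le hc.memLp hφ.memLp).trans
          (mul_le_mul_of_nonneg_right hcn' hφn)
    · have e : ∫ x, (dirDeriv (frame L 1) u (shear L γ h x) - dirDeriv (frame L 1) u x) * φ x =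
          ∫ x, dirDeriv (frame L 1) (cutDiff L γ χ h u) x * φ x := by
        refine integral_congr_ae (Eventually.of_forall fun x => ?_)
        by_cases hx : x ∈ W
        · have := hpx x hx
          simp only [Fin.mk_one] at this
          simp only
          rw [this, dirDeriv_sub (huS.differentiable x) (hu.differentiable x),
            dirDeriv_frame_one_comp_shear hγ hu.differentiable]
        · simp [hφW x hx]
      simp only [Fin.mk_one] at hcut' ⊢
      rw [e]
      refine (norm_integral_mul_le (hp.dirDeriv _).memLp hφ.memLp).trans
        (mul_le_mul_of_nonneg_right (hcut'.trans (le_add_of_nonneg_right (by positivity))) hφn)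
  have e4 : l2norm volume (fun x => φ (shear L γ (-h) x) - φ x) ≤ 2 * l2norm volume φ := by
    have := l2norm_sub_le hφS.memLp hφ.memLp
    rw [l2norm_comp (volume_preserving_shear L hγ (-h)) hφ.memLp] at this
    linarith
  rw [e1, e2]
  refine (norm_add_le _ _).trans ((add_le_add ((norm_integral_mul_le
    ((hU.memLp j).sub hdj.memLp) hdiff.memLp).trans
    (mul_le_mul (hue j) e4 (l2norm_nonneg _) hn)) e3).trans (le_of_eq ?_))
  ring

end Tangential

/-! ### From tangential to full second derivatives -/

section LocalRegularity

variable {L : Plane ≃ₗᵢ[ℝ] Plane} {γ : ℝ → ℝ} {Ω W : Set Plane} {φ ψ u w : Plane → ℂ}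
variable {U : Fin 2 → Plane → ℂ} {g : Plane → ℂ} {χ : Plane → ℝ}

theorem hasDerivAt_integral_shear {f : Plane → ℂ} (hf : Integrable f volume) {M : ℝ}
    (hγ : ContDiff ℝ ∞ γ) (hM1 : ∀ t, |deriv γ t| ≤ M) (hφ : TestOn W φ) :
    HasDerivAt (fun k => ∫ x, f x * φ (shear L γ k x)) (∫ x, f x * tangentDeriv L γ φ x) 0 := by
  have hM0 : 0 ≤ M := (abs_nonneg _).trans (hM1 0)
  obtain ⟨B0, hB0⟩ := (hφ.dirDeriv (frame L 0)).continuous.bounded_above_of_compact_support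
    (hφ.dirDeriv (frame L 0)).compact
  obtain ⟨B1, hB1⟩ := (hφ.dirDeriv (frame L 1)).continuous.bounded_above_of_compact_support
    (hφ.dirDeriv (frame L 1)).compact
  have hB : ∀ x, ‖tangentDeriv L γ φ x‖ ≤ B0 + M * B1 := fun x =>
    (norm_tangentDeriv_le L hM1 x).trans
      (add_le_add (hB0 x) (mul_le_mul_of_nonneg_left (hB1 x) hM0))
  have hcs : ∀ k, Continuous (shear L γ k) := fun k => (contDiff_shear L hγ k).continuous
  have hτ := continuous_tangentDeriv L hγ hφ
  have := (hasDerivAt_integral_of_dominated_loc_of_deriv_le (μ := volume) (x₀ := (0 : ℝ))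
    (F := fun k x => f x * φ (shear L γ k x))
    (F' := fun k x => f x * tangentDeriv L γ φ (shear L γ k x))
    (bound := fun x => ‖f x‖ * (B0 + M * B1)) (s := Set.univ) Filter.univ_mem
    (Eventually.of_forall fun k =>
      hf.1.mul (hφ.continuous.comp (hcs k)).aestronglyMeasurable)
    ?_ (hf.1.mul (hτ.comp (hcs 0)).aestronglyMeasurable)
    (Eventually.of_forall fun x k _ => ?_) (hf.norm.mul_const _)
    (Eventually.of_forall fun x k _ => ?_)).2
  · simpa only [shear_zero] using this
  · obtain ⟨B, hB⟩ := hφ.continuous.bounded_above_of_compact_support hφ.compact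
    refine hf.mul_bdd (c := B) (hφ.continuous.comp (hcs 0)).aestronglyMeasurable
      (Eventually.of_forall fun x => hB _)
  · rw [norm_mul]
    exact mul_le_mul_of_nonneg_left (hB _) (norm_nonneg _)
  · exact (hasDerivAt_comp_shear L hγ hφ.differentiable k x).const_mul (f x)

/-- A function of `h` with increments at most `C|h|` has derivative at most `C`; here the derivative
at `h = 0` is the pairing with the tangential derivative. -/
theorem WeakSolution.exists_norm_integral_tangentDeriv_le (hU : WeakSolution Ω (frame L) U g)
    {M K h₀ : ℝ} (hγ : ContDiff ℝ ∞ γ) (hM0 : 0 ≤ M)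
    (hM1 : ∀ t, |deriv γ t| ≤ M) (hM : ∀ s t, |deriv γ s - deriv γ t| ≤ M * |s - t|)
    (hK0 : 0 ≤ K) (hχ : ContDiff ℝ ∞ χ) (hχ1 : ∀ x, |χ x| ≤ 1)
    (hK : ∀ x j, |fderiv ℝ χ x (frame L j)| ≤ K) (hW : IsOpen W) (hχW : ∀ x ∈ W, χ x = 1)
    (hh₀ : 0 < h₀)
    (hloc : ∀ h : ℝ, |h| < h₀ → ∀ x ∈ tsupport χ, shear L γ h x ∈ Ω ↔ x ∈ Ω) :
    ∃ C, 0 ≤ C ∧ ∀ φ, TestOn W φ → ∀ j,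
      ‖∫ x, U j x * tangentDeriv L γ φ x‖ ≤ C * l2norm volume φ := by
  obtain ⟨C, hC0, hC⟩ := hU.exists_norm_integral_shear_le hγ hM0 hM1 hM hK0 hχ hχ1 hK hW hχW
  refine ⟨C, hC0, fun φ hφ j => ?_⟩
  refine (hasDerivAt_integral_shear (hU.integrable j) hγ hM1 hφ).le_of_lip'
    (mul_nonneg hC0 (l2norm_nonneg _)) ?_
  have h1 : ∀ᶠ k : ℝ in 𝓝 0, |k| < min h₀ 1 :=
    continuous_abs.continuousAt.eventually_lt_const (by simpa using hh₀)
  filter_upwards [h1] with k hk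
  rcases eq_or_ne k 0 with rfl | hk0
  · simp
  have := hC (-k) (neg_ne_zero.2 hk0) (by rw [abs_neg]; exact (hk.trans_le (min_le_right _ _)).le)
    (hloc (-k) (by rw [abs_neg]; exact hk.trans_le (min_le_left _ _))) φ hφ j
  rw [neg_neg, abs_neg] at this
  have e : (∫ x, U j x * φ (shear L γ k x)) - ∫ x, U j x * φ (shear L γ 0 x) =
      ∫ x, U j x * (φ (shear L γ k x) - φ x) := by
    have i1 : Integrable (fun x => U j x * φ (shear L γ k x)) volume :=
      (hU.memLp j).integrable_mul (hφ.univ.comp_shear_univ hγ k).memLp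
    have i2 : Integrable (fun x => U j x * φ x) volume := (hU.memLp j).integrable_mul hφ.memLp
    simp only [shear_zero, mul_sub]
    rw [integral_sub i1 i2]
  rw [e, sub_zero, Real.norm_eq_abs]
  linarith

theorem integral_mul_dirDeriv_eq_neg (hu : TestOn Ω u) (hw : TestOn W w) (v : Plane) :
    ∫ x, u x * dirDeriv v w x = -∫ x, dirDeriv v u x * w x :=
  integral_mul_fderiv_eq_neg_fderiv_mul_of_integrable ((hu.dirDeriv v).integrable_mul hw)
    (hu.integrable_mul (hw.dirDeriv v)) (hu.integrable_mul hw)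
    (fun x _ => hu.differentiable x) (fun x _ => hw.differentiable x)

theorem dirDeriv_comm (hu : TestOn Ω u) (v v' x : Plane) :
    dirDeriv v (dirDeriv v' u) x = dirDeriv v' (dirDeriv v u) x := by
  have hd : ∀ v x, HasFDerivAt (dirDeriv v u)
      ((ContinuousLinearMap.apply ℝ ℂ v).comp (fderiv ℝ (fderiv ℝ u) x)) x := fun v x =>
    (ContinuousLinearMap.apply ℝ ℂ v).hasFDerivAt.comp x
      ((hu.smooth.fderiv_right (m := ∞) (by simp)).differentiable (by simp) x).hasFDerivAt
  have hs := (hu.smooth.contDiffAt (x := x)).isSymmSndFDerivAt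
    (by simp only [minSmoothness_of_isRCLikeNormedField]
        exact WithTop.coe_le_coe.2 (le_top (a := (2 : ℕ∞)))) v v'
  rw [dirDeriv, dirDeriv, (hd v' x).fderiv, (hd v x).fderiv]
  simpa using hs

theorem integral_dirDeriv_mul_dirDeriv_comm (hu : TestOn Ω u) (hw : TestOn W w) (v v' : Plane) :
    ∫ x, dirDeriv v u x * dirDeriv v' w x = ∫ x, dirDeriv v' u x * dirDeriv v w x := by
  rw [integral_mul_dirDeriv_eq_neg (hu.dirDeriv v) hw, integral_mul_dirDeriv_eq_neg
    (hu.dirDeriv v') hw]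
  simp only [dirDeriv_comm hu v v']

/-- A gradient is curl free. For test functions this is symmetry of second derivatives, and it
passes to the limit. `φ` need not be supported in `Ω`, since the approximants vanish near the
boundary. -/
theorem WeakSolution.integral_comm {e : Fin 2 → Plane} (hU : WeakSolution Ω e U g)
    (hφ : TestOn W φ) (j k : Fin 2) :
    ∫ x, U j x * dirDeriv (e k) φ x = ∫ x, U k x * dirDeriv (e j) φ x := by
  have hk := (hφ.dirDeriv (e k)).memLp
  have hj := (hφ.dirDeriv (e j)).memLp
  rw [← sub_eq_zero, ← norm_le_zero_iff]
  refine le_of_forall_pos_le_add fun ε hε => ?_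
  obtain ⟨δ, hδ, hδε⟩ : ∃ δ : ℝ, 0 < δ ∧ δ * l2norm volume (dirDeriv (e k) φ) +
      δ * l2norm volume (dirDeriv (e j) φ) ≤ ε := by
    have n1 := l2norm_nonneg (μ := volume) (dirDeriv (e k) φ)
    have n2 := l2norm_nonneg (μ := volume) (dirDeriv (e j) φ)
    refine ⟨ε / (l2norm volume (dirDeriv (e k) φ) + l2norm volume (dirDeriv (e j) φ) + 1),
      by positivity, ?_⟩
    rw [← mul_add, div_mul_eq_mul_div, div_le_iff₀ (by positivity)]
    nlinarith
  obtain ⟨u, hu, hue⟩ := hU.approx δ hδ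
  have hs := integral_dirDeriv_mul_dirDeriv_comm hu hφ (e j) (e k)
  have e1 := integral_sub_mul (hU.memLp j) (hu.dirDeriv (e j)).memLp hk
  have e2 := integral_sub_mul (hU.memLp k) (hu.dirDeriv (e k)).memLp hj
  have e3 : (∫ x, U j x * dirDeriv (e k) φ x) - ∫ x, U k x * dirDeriv (e j) φ x =
      (∫ x, (U j x - dirDeriv (e j) u x) * dirDeriv (e k) φ x) -
        ∫ x, (U k x - dirDeriv (e k) u x) * dirDeriv (e j) φ x := by
    rw [e1, e2, hs]; ring
  rw [e3, zero_add]
  refine (norm_sub_le _ _).trans (le_trans (add_le_add ?_ ?_) hδε)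
  · exact (norm_integral_mul_le ((hU.memLp j).sub (hu.dirDeriv _).memLp) hk).trans
      (mul_le_mul_of_nonneg_right (hue j) (l2norm_nonneg _))
  · exact (norm_integral_mul_le ((hU.memLp k).sub (hu.dirDeriv _).memLp) hj).trans
      (mul_le_mul_of_nonneg_right (hue k) (l2norm_nonneg _))

/-- Linear algebra for the distributions `E k j`, which are `-∂ₖUⱼ`. Two tangential combinations are
bounded, `E 0 1 = E 1 0`, and the equation bounds `E 0 0 + E 1 1`. Elimination leaves `E 1 1` with
the factor `1 + m²`, where `m` is the slope of the graph; since this factor never vanishes,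
everything is bounded. -/
theorem WeakSolution.bound_of_tangential (hU : WeakSolution Ω (frame L) U g)
    {M C : ℝ} (hγ : ContDiff ℝ ∞ γ) (hM0 : 0 ≤ M) (hM1 : ∀ t, |deriv γ t| ≤ M) (hC0 : 0 ≤ C)
    (hC : ∀ φ, TestOn W φ → ∀ j, ‖∫ x, U j x * tangentDeriv L γ φ x‖ ≤ C * l2norm volume φ) :
    ∃ C, 0 ≤ C ∧ ∀ φ, TestOn (Ω ∩ W) φ → ∀ j k,
      ‖∫ x, U j x * dirDeriv (frame L k) φ x‖ ≤ C * l2norm volume φ := by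
  set m : Plane → ℝ := fun x => deriv γ (L x 0) with hm
  have hmc : ContDiff ℝ ∞ m := (contDiff_deriv hγ).comp (contDiff_coord L 0)
  have hmC := contDiff_ofReal hmc
  set E : Fin 2 → Fin 2 → (Plane → ℂ) → ℂ := fun k j φ => ∫ x, U j x * dirDeriv (frame L k) φ x
    with hE
  have hcomm : ∀ φ, TestOn (Ω ∩ W) φ → E 0 1 φ = E 1 0 φ := fun φ hφ => hU.integral_comm hφ 1 0
  have heq : ∀ φ, TestOn (Ω ∩ W) φ → E 0 0 φ + E 1 1 φ = ∫ x, g x * φ x := fun φ hφ => by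
    rw [← hU.eqn φ (hφ.mono Set.inter_subset_left), Fin.sum_univ_two]
  have hmφ : ∀ φ, TestOn (Ω ∩ W) φ → TestOn (Ω ∩ W) fun x => (m x : ℂ) * φ x := fun φ hφ =>
    hφ.smul_smooth hmC
  have hmφn : ∀ φ, TestOn (Ω ∩ W) φ →
      l2norm volume (fun x => (m x : ℂ) * φ x) ≤ M * l2norm volume φ := fun φ hφ => by
    refine l2norm_le_mul hφ.memLp hM0 fun x => ?_
    rw [norm_mul, Complex.norm_real]
    exact mul_le_mul_of_nonneg_right (hM1 _) (norm_nonneg _)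
  -- The slope depends on the first coordinate only, so multiplication by `m` commutes with the
  -- derivative in the second direction.
  have hm1 : ∀ x, fderiv ℝ m x (frame L 1) = 0 := fun x => by
    have h1 := ((contDiff_deriv hγ).differentiable (by simp) (L x 0)).hasDerivAt.comp_hasFDerivAt
      x (hasFDerivAt_coord L x 0)
    have h2 : HasFDerivAt m _ x := h1
    rw [h2.fderiv]
    simp [map_frame]
  have hT : ∀ φ, TestOn (Ω ∩ W) φ → ∀ j,
      ‖E 0 j φ + E 1 j (fun x => (m x : ℂ) * φ x)‖ ≤ C * l2norm volume φ := by
    intro φ hφ j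
    refine le_trans (le_of_eq (congrArg _ ?_)) (hC φ (hφ.mono Set.inter_subset_right) j)
    have i1 : Integrable (fun x => U j x * dirDeriv (frame L 0) φ x) volume :=
      (hU.memLp j).integrable_mul (hφ.dirDeriv _).memLp
    have i2 : Integrable (fun x => U j x *
        dirDeriv (frame L 1) (fun x => (m x : ℂ) * φ x) x) volume :=
      (hU.memLp j).integrable_mul ((hmφ φ hφ).dirDeriv _).memLp
    rw [hE]
    simp only
    rw [← integral_add i1 i2]
    refine integral_congr_ae (Eventually.of_forall fun x => ?_)
    simp only
    rw [dirDeriv_mul (hmC.differentiable (by simp) x) (hφ.differentiable x), dirDeriv_ofReal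
      (hmc.differentiable (by simp) x), hm1, tangentDeriv]
    simp only [hm]
    push_cast
    ring
  have hadd : ∀ φ ψ, TestOn (Ω ∩ W) φ → TestOn (Ω ∩ W) ψ →
      E 1 1 (fun x => φ x + ψ x) = E 1 1 φ + E 1 1 ψ := by
    intro φ ψ hφ hψ
    have i1 : Integrable (fun x => U 1 x * dirDeriv (frame L 1) φ x) volume :=
      (hU.memLp 1).integrable_mul (hφ.dirDeriv _).memLp
    have i2 : Integrable (fun x => U 1 x * dirDeriv (frame L 1) ψ x) volume :=
      (hU.memLp 1).integrable_mul (hψ.dirDeriv _).memLp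
    rw [hE]
    simp only
    rw [← integral_add i1 i2]
    refine integral_congr_ae (Eventually.of_forall fun x => ?_)
    simp only [dirDeriv]
    rw [fderiv_fun_add (hφ.differentiable x) (hψ.differentiable x)]
    simp [mul_add]
  set G := l2norm volume g with hG
  have hG0 : 0 ≤ G := l2norm_nonneg _
  have hgφ : ∀ φ, TestOn (Ω ∩ W) φ → ‖∫ x, g x * φ x‖ ≤ G * l2norm volume φ := fun φ hφ =>
    norm_integral_mul_le hU.memLp_rhs hφ.memLp
  have h11' : ∀ φ, TestOn (Ω ∩ W) φ →
      ‖E 1 1 (fun x => φ x + (m x : ℂ) * ((m x : ℂ) * φ x))‖ ≤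
        (G + C * M + C) * l2norm volume φ := by
    intro φ hφ
    have hφ' := hmφ φ hφ
    have t1 := hT _ hφ' 1
    have t0 := hT φ hφ 0
    have e : E 1 1 (fun x => φ x + (m x : ℂ) * ((m x : ℂ) * φ x)) =
        (∫ x, g x * φ x) + (E 0 1 (fun x => (m x : ℂ) * φ x) +
          E 1 1 (fun x => (m x : ℂ) * ((m x : ℂ) * φ x))) -
          (E 0 0 φ + E 1 0 (fun x => (m x : ℂ) * φ x)) := by
      rw [hadd φ _ hφ (hmφ _ hφ'), ← heq φ hφ, hcomm _ hφ']
      ring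
    rw [e]
    refine (norm_sub_le _ _).trans ((add_le_add (norm_add_le _ _) le_rfl).trans ?_)
    have := mul_le_mul_of_nonneg_left (hmφn φ hφ) hC0
    linarith [hgφ φ hφ]
  -- The previous bound is applied to `φ / (1 + m²)`, whose norm does not exceed that of `φ`.
  have h11 : ∀ φ, TestOn (Ω ∩ W) φ → ‖E 1 1 φ‖ ≤ (G + C * M + C) * l2norm volume φ := by
    intro φ hφ
    have hpos : ∀ x, 0 < 1 + m x ^ 2 := fun x => by positivity
    have hinv : ContDiff ℝ ∞ fun x => (1 + m x ^ 2)⁻¹ :=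
      (contDiff_const.add (hmc.pow 2)).inv fun x => (hpos x).ne'
    have hψ := hφ.smul_smooth (contDiff_ofReal hinv)
    have := h11' _ hψ
    have e : (fun x => (((1 + m x ^ 2)⁻¹ : ℝ) : ℂ) * φ x +
        (m x : ℂ) * ((m x : ℂ) * ((((1 + m x ^ 2)⁻¹ : ℝ) : ℂ) * φ x))) = φ := by
      funext x
      have h1 : ((1 + m x ^ 2 : ℝ) : ℂ) ≠ 0 := Complex.ofReal_ne_zero.2 (hpos x).ne'
      push_cast at h1 ⊢
      field_simp
    rw [e] at this
    refine this.trans (mul_le_mul_of_nonneg_left ?_ (by positivity))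
    refine l2norm_mono hφ.memLp fun x => ?_
    rw [norm_mul, Complex.norm_real, norm_inv, Real.norm_of_nonneg (hpos x).le]
    exact mul_le_of_le_one_left (norm_nonneg _)
          (inv_le_one_of_one_le₀ (by nlinarith [sq_nonneg (m x)]))
  have h01 : ∀ φ, TestOn (Ω ∩ W) φ →
      ‖E 0 1 φ‖ ≤ (C + (G + C * M + C) * M) * l2norm volume φ := by
    intro φ hφ
    have t1 := hT φ hφ 1
    have e : E 0 1 φ = (E 0 1 φ + E 1 1 (fun x => (m x : ℂ) * φ x)) -
        E 1 1 (fun x => (m x : ℂ) * φ x) := by ring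
    rw [e]
    refine (norm_sub_le _ _).trans ?_
    have := (h11 _ (hmφ φ hφ)).trans
      (mul_le_mul_of_nonneg_left (hmφn φ hφ) (by positivity))
    linarith
  have h00 : ∀ φ, TestOn (Ω ∩ W) φ →
      ‖E 0 0 φ‖ ≤ (G + (G + C * M + C)) * l2norm volume φ := by
    intro φ hφ
    have e : E 0 0 φ = (∫ x, g x * φ x) - E 1 1 φ := by rw [← heq φ hφ]; ring
    rw [e]
    refine (norm_sub_le _ _).trans ?_
    linarith [hgφ φ hφ, h11 φ hφ]
  set A := (G + C * M + C) with hA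
  have hA0 : 0 ≤ A := by positivity
  refine ⟨A + (C + A * M) + (G + A), by positivity, fun φ hφ j k => ?_⟩
  have hn := l2norm_nonneg (μ := volume) φ
  have b1 : A ≤ A + (C + A * M) + (G + A) := by nlinarith [mul_nonneg hA0 hM0]
  have b2 : C + A * M ≤ A + (C + A * M) + (G + A) := by linarith
  have b3 : G + A ≤ A + (C + A * M) + (G + A) := by nlinarith [mul_nonneg hA0 hM0]
  have h10 : ‖E 1 0 φ‖ ≤ (C + A * M) * l2norm volume φ := hcomm φ hφ ▸ h01 φ hφ
  fin_cases j <;> fin_cases k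
  · exact (h00 φ hφ).trans (mul_le_mul_of_nonneg_right b3 hn)
  · exact h10.trans (mul_le_mul_of_nonneg_right b2 hn)
  · exact (h01 φ hφ).trans (mul_le_mul_of_nonneg_right b2 hn)
  · exact (h11 φ hφ).trans (mul_le_mul_of_nonneg_right b1 hn)

end LocalRegularity

/-! ### Charts, change of frame and global regularity -/

section Chart

variable {L : Plane ≃ₗᵢ[ℝ] Plane} {γ : ℝ → ℝ} {Ω W : Set Plane} {φ ψ u w : Plane → ℂ}
variable {U : Fin 2 → Plane → ℂ} {g : Plane → ℂ}

/-- `Ω` is the region above a smooth graph, in suitable coordinates, near `x`. -/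
def HasChartAt (Ω : Set Plane) (x : Plane) : Prop :=
  ∃ r : ℝ, 0 < r ∧ ∃ (L : Plane ≃ₗᵢ[ℝ] Plane) (γ : ℝ → ℝ), ContDiff ℝ ∞ γ ∧
    ∀ y ∈ Metric.ball x r, (y ∈ Ω ↔ γ ((L y) 0) < (L y) 1)

theorem abs_coord_le (L : Plane ≃ₗᵢ[ℝ] Plane) (x : Plane) (i : Fin 2) : |L x i| ≤ ‖x‖ := by
  rw [← L.norm_map x, ← Real.norm_eq_abs]
  exact PiLp.norm_apply_le (L x) i

/-- Interior points are given a chart too: a constant graph so low that the whole ball lies above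
it. Interior regularity thus needs no separate treatment. -/
theorem HasSmoothBoundary.hasChartAt (hΩ : IsOpen Ω) (h : HasSmoothBoundary Ω) {x : Plane}
    (hx : x ∈ closure Ω) : HasChartAt Ω x := by
  by_cases hxΩ : x ∈ Ω
  · obtain ⟨r, hr, hball⟩ := Metric.isOpen_iff.1 hΩ x hxΩ
    refine ⟨r, hr, LinearIsometryEquiv.refl ℝ Plane, fun _ => -(‖x‖ + r), contDiff_const,
      fun y hy => iff_of_true (hball hy) ?_⟩
    have h1 := abs_coord_le (LinearIsometryEquiv.refl ℝ Plane) y 1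
    have h2 : ‖y‖ < ‖x‖ + r := by
      have := norm_le_norm_add_norm_sub' y x
      rw [Metric.mem_ball, dist_eq_norm] at hy
      linarith
    linarith [neg_abs_le (LinearIsometryEquiv.refl ℝ Plane y 1)]
  · exact h x (by rw [hΩ.frontier_eq]; exact ⟨hx, hxΩ⟩)

/-- The function describing the boundary can be taken with bounded derivatives. -/
theorem HasChartAt.exists_bounded {x : Plane} (h : HasChartAt Ω x) :
    ∃ r : ℝ, 0 < r ∧ ∃ (L : Plane ≃ₗᵢ[ℝ] Plane) (γ : ℝ → ℝ) (M : ℝ), ContDiff ℝ ∞ γ ∧ 0 ≤ M ∧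
      (∀ t, |deriv γ t| ≤ M) ∧ (∀ s t, |γ s - γ t| ≤ M * |s - t|) ∧
      (∀ s t, |deriv γ s - deriv γ t| ≤ M * |s - t|) ∧
      ∀ y ∈ Metric.ball x r, (y ∈ Ω ↔ γ ((L y) 0) < (L y) 1) := by
  obtain ⟨r, hr, L, γ₀, hγ₀, hchart⟩ := h
  -- On the ball around `x` the first coordinate stays within `r` of `L x 0`, where the bump equals
  -- one; truncating `γ₀` therefore does not change the chart.
  let η : ContDiffBump (L x 0) := ⟨r, 2 * r, hr, by linarith⟩
  have hηs : ContDiff ℝ ∞ η := η.contDiff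
  set γ : ℝ → ℝ := fun t => η t * γ₀ t with hγdef
  have hγ : ContDiff ℝ ∞ γ := hηs.mul hγ₀
  have hγc : HasCompactSupport γ := η.hasCompactSupport.mul_right
  have hdγ := contDiff_deriv hγ
  obtain ⟨B, hB⟩ := (hdγ.continuous).bounded_above_of_compact_support hγc.deriv
  obtain ⟨C₁, hC₁⟩ := ContDiff.lipschitzWith_of_hasCompactSupport hγc hγ (by simp)
  obtain ⟨C₂, hC₂⟩ := ContDiff.lipschitzWith_of_hasCompactSupport hγc.deriv hdγ (by simp)
  have hB0 : 0 ≤ B := (norm_nonneg _).trans (hB 0)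
  refine ⟨r, hr, L, γ, B + C₁ + C₂, hγ, by positivity, fun t => ?_, fun s t => ?_, fun s t => ?_,
    fun y hy => ?_⟩
  · have := hB t
    rw [Real.norm_eq_abs] at this
    linarith [C₁.coe_nonneg, C₂.coe_nonneg]
  · have := hC₁.dist_le_mul s t
    rw [Real.dist_eq, Real.dist_eq] at this
    refine this.trans (mul_le_mul_of_nonneg_right ?_ (abs_nonneg _))
    linarith [C₂.coe_nonneg]
  · have := hC₂.dist_le_mul s t
    rw [Real.dist_eq, Real.dist_eq] at this
    refine this.trans (mul_le_mul_of_nonneg_right ?_ (abs_nonneg _))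
    linarith [C₁.coe_nonneg]
  · rw [hchart y hy]
    have h1 : η (L y 0) = 1 := by
      refine η.one_of_mem_closedBall ?_
      have := abs_coord_le L (y - x) 0
      rw [Metric.mem_ball, dist_eq_norm] at hy
      rw [Metric.mem_closedBall, Real.dist_eq]
      simp only [map_sub, PiLp.sub_apply] at this
      exact this.trans hy.le
    simp [hγdef, h1]

theorem norm_frame (L : Plane ≃ₗᵢ[ℝ] Plane) (j : Fin 2) : ‖frame L j‖ = 1 := by
  simp [frame]

theorem norm_shear_sub_le {M : ℝ} (hγL : ∀ s t, |γ s - γ t| ≤ M * |s - t|) (h : ℝ) (x : Plane) :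
    ‖shear L γ h x - x‖ ≤ (1 + M) * |h| := by
  rw [shear, add_sub_cancel_left]
  refine (norm_add_le _ _).trans ?_
  rw [norm_smul, norm_smul, norm_frame, norm_frame, mul_one, mul_one, Real.norm_eq_abs,
    Real.norm_eq_abs, add_mul, one_mul]
  have := hγL (L x 0 + h) (L x 0)
  rw [add_sub_cancel_left] at this
  linarith

/-- Regularity near a point at which the domain is the region above a smooth graph. -/
theorem exists_local_bound {x : Plane} (h : HasChartAt Ω x) :
    ∃ (L : Plane ≃ₗᵢ[ℝ] Plane) (ρ : ℝ), 0 < ρ ∧ ∀ U g, WeakSolution Ω (frame L) U g →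
      ∃ C, 0 ≤ C ∧ ∀ φ, TestOn (Ω ∩ Metric.ball x ρ) φ → ∀ j k,
        ‖∫ x, U j x * dirDeriv (frame L k) φ x‖ ≤ C * l2norm volume φ := by
  obtain ⟨r, hr, L, γ, M, hγ, hM0, hM1, hγL, hM, hchart⟩ := h.exists_bounded
  refine ⟨L, r / 4, by positivity, fun U g hU => ?_⟩
  let χ : ContDiffBump x := ⟨r / 4, r / 2, by positivity, by linarith⟩
  have hχ : ContDiff ℝ ∞ χ := χ.contDiff
  obtain ⟨K, hK⟩ := ContDiff.lipschitzWith_of_hasCompactSupport χ.hasCompactSupport hχ (by simp)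
  have hχts : tsupport χ = Metric.closedBall x (r / 2) := χ.tsupport_eq
  -- For `|h| < h₀` a shear moves points by less than `r / 4`, so from the support of `χ`, of radius
  -- `r / 2`, it stays inside the chart ball of radius `r`. There the invariance of `t - γ(s)` shows
  -- that membership in `Ω` is unchanged.
  obtain ⟨C, hC0, hC⟩ := hU.exists_norm_integral_tangentDeriv_le (χ := χ)
    (W := Metric.ball x (r / 4)) (K := K) (h₀ := r / (4 * (1 + M))) hγ hM0 hM1 hM K.coe_nonneg hχ
    (fun y => by rw [abs_of_nonneg χ.nonneg]; exact χ.le_one)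
    (fun y j => by
      refine (ContinuousLinearMap.le_opNorm (fderiv ℝ χ y) (frame L j)).trans ?_
      rw [norm_frame, mul_one]
      exact norm_fderiv_le_of_lipschitz ℝ hK)
    Metric.isOpen_ball (fun y hy => χ.one_of_mem_closedBall (Metric.ball_subset_closedBall hy))
    (by positivity)
    (fun h hh y hy => by
      rw [hχts, Metric.mem_closedBall, dist_eq_norm] at hy
      have hs := norm_shear_sub_le (L := L) hγL h y
      have h1 : (1 + M) * |h| < r / 4 := by
        rw [lt_div_iff₀ (by positivity)] at hh
        linarith
      have hy1 : y ∈ Metric.ball x r := by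
        rw [Metric.mem_ball, dist_eq_norm]; linarith
      have hy2 : shear L γ h y ∈ Metric.ball x r := by
        rw [Metric.mem_ball, dist_eq_norm]
        have := norm_sub_le_norm_sub_add_norm_sub (shear L γ h y) y x
        linarith
      rw [hchart _ hy1, hchart _ hy2, map_shear_zero, map_shear_one]
      constructor <;> intro <;> linarith)
  exact hU.bound_of_tangential hγ hM0 hM1 hC0 hC

theorem sum_map_mul_map (L : Plane ≃ₗᵢ[ℝ] Plane) (v w : Plane) :
    ∑ j, L v j * L w j = ∑ i, v i * w i := by
  have h1 : inner ℝ (L w) (L v) = inner ℝ w v := L.inner_map_map w v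
  rw [PiLp.inner_apply, PiLp.inner_apply] at h1
  exact h1

theorem frame_apply (L : Plane ≃ₗᵢ[ℝ] Plane) (i j : Fin 2) :
    frame L j i = L (EuclideanSpace.single i 1) j := by
  have h1 := sum_map_mul_map L (frame L j) (EuclideanSpace.single i 1)
  simp only [map_frame, ite_mul, one_mul, zero_mul] at h1
  simpa using h1.symm

theorem sum_frame_mul_frame (L : Plane ≃ₗᵢ[ℝ] Plane) (i k : Fin 2) :
    ∑ j, frame L j i * frame L j k = if i = k then 1 else 0 := by
  simp only [frame_apply]
  rw [sum_map_mul_map]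
  simp [eq_comm]

theorem dirDeriv_frame (L : Plane ≃ₗᵢ[ℝ] Plane) (j : Fin 2) (φ : Plane → ℂ) (x : Plane) :
    dirDeriv (frame L j) φ x =
      ∑ i, (frame L j i : ℂ) * dirDeriv (EuclideanSpace.single i 1) φ x := by
  have h1 : frame L j = ∑ i, frame L j i • EuclideanSpace.single i (1 : ℝ) := by
    ext k
    fin_cases k <;> simp
  simp only [dirDeriv]
  conv_lhs => rw [h1]
  simp

/-- The standard frame. -/
def stdFrame (i : Fin 2) : Plane := EuclideanSpace.single i 1

theorem dirDeriv_stdFrame (L : Plane ≃ₗᵢ[ℝ] Plane) (i : Fin 2) (φ : Plane → ℂ) (x : Plane) :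
    dirDeriv (stdFrame i) φ x = ∑ j, (frame L j i : ℂ) * dirDeriv (frame L j) φ x := by
  simp only [dirDeriv_frame, Finset.mul_sum, ← mul_assoc]
  rw [Finset.sum_comm]
  simp only [← Finset.sum_mul, ← Complex.ofReal_mul, ← Complex.ofReal_sum, sum_frame_mul_frame]
  fin_cases i <;> simp [stdFrame]

/-- The components of a vector field in the frame given by `L`. -/
def frameComponent (L : Plane ≃ₗᵢ[ℝ] Plane) (G : Fin 2 → Plane → ℂ) (j : Fin 2) (x : Plane) : ℂ :=
  ∑ i, (frame L j i : ℂ) * G i x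

theorem sum_frameComponent (L : Plane ≃ₗᵢ[ℝ] Plane) (G : Fin 2 → Plane → ℂ) (i : Fin 2)
    (x : Plane) : G i x = ∑ j, (frame L j i : ℂ) * frameComponent L G j x := by
  simp only [frameComponent, Finset.mul_sum, ← mul_assoc]
  rw [Finset.sum_comm]
  simp only [← Finset.sum_mul, ← Complex.ofReal_mul, ← Complex.ofReal_sum, sum_frame_mul_frame]
  fin_cases i <;> simp

theorem abs_frame_apply_le (L : Plane ≃ₗᵢ[ℝ] Plane) (i j : Fin 2) : |frame L j i| ≤ 1 := by
  rw [← norm_frame L j, ← Real.norm_eq_abs]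
  exact PiLp.norm_apply_le _ i

/-- The Laplacian is invariant under isometries: the frame is orthonormal, so the weak equation has
the same form in it. -/
theorem WeakSolution.frameComponent {G : Fin 2 → Plane → ℂ} (hG : WeakSolution Ω stdFrame G g)
    (L : Plane ≃ₗᵢ[ℝ] Plane) : WeakSolution Ω (frame L) (frameComponent L G) g := by
  refine ⟨fun j => ?_, fun j => ?_, hG.memLp_rhs, fun ε hε => ?_, fun φ hφ => ?_⟩
  · exact memLp_finsetSum _ fun i _ => (hG.memLp i).const_mul _
  · exact integrable_finsetSum _ fun i _ => (hG.integrable i).const_mul _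
  · obtain ⟨φ, hφ, hφe⟩ := hG.approx (ε / 2) (by positivity)
    refine ⟨φ, hφ, fun j => ?_⟩
    have hm : ∀ i, MemLp (fun x => G i x - dirDeriv (stdFrame i) φ x) 2 volume := fun i =>
      (hG.memLp i).sub (hφ.dirDeriv _).memLp
    have e : (fun x => _root_.frameComponent L G j x - dirDeriv (frame L j) φ x) = fun x =>
        (frame L j 0 : ℂ) * (G 0 x - dirDeriv (stdFrame 0) φ x) +
        (frame L j 1 : ℂ) * (G 1 x - dirDeriv (stdFrame 1) φ x) := by
      funext x
      rw [dirDeriv_frame, _root_.frameComponent, Fin.sum_univ_two, Fin.sum_univ_two]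
      simp only [stdFrame]
      ring
    have hle : ∀ i, l2norm volume (fun x => (frame L j i : ℂ) *
        (G i x - dirDeriv (stdFrame i) φ x)) ≤ ε / 2 := fun i => by
      refine (l2norm_mono (hm i) fun x => ?_).trans (hφe i)
      rw [norm_mul, Complex.norm_real]
      exact mul_le_of_le_one_left (norm_nonneg _) (abs_frame_apply_le L i j)
    rw [e]
    refine (l2norm_add_le ((hm 0).const_mul _) ((hm 1).const_mul _)).trans ?_
    linarith [hle 0, hle 1]
  · rw [← hG.eqn φ hφ]
    have i1 : ∀ j, Integrable (fun x => _root_.frameComponent L G j x * dirDeriv (frame L j) φ x)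
        volume := fun j =>
      (memLp_finsetSum _ fun i _ => (hG.memLp i).const_mul _).integrable_mul (hφ.dirDeriv _).memLp
    have i2 : ∀ j, Integrable (fun x => G j x * dirDeriv (stdFrame j) φ x) volume := fun j =>
      (hG.memLp j).integrable_mul (hφ.dirDeriv _).memLp
    rw [← integral_finsetSum _ fun j _ => i1 j, ← integral_finsetSum _ fun j _ => i2 j]
    refine integral_congr_ae (Eventually.of_forall fun x => ?_)
    simp only [dirDeriv_stdFrame L, _root_.frameComponent, Finset.sum_mul, Finset.mul_sum]
    rw [Finset.sum_comm]
    refine Finset.sum_congr rfl fun i _ => Finset.sum_congr rfl fun j _ => ?_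
    ring

/-- Regularity near a point, in the standard frame. -/
theorem WeakSolution.exists_local_bound {G : Fin 2 → Plane → ℂ}
    (hG : WeakSolution Ω stdFrame G g) {x : Plane} (h : HasChartAt Ω x) :
    ∃ ρ C : ℝ, 0 < ρ ∧ 0 ≤ C ∧ ∀ φ, TestOn (Ω ∩ Metric.ball x ρ) φ → ∀ i k,
      ‖∫ x, G i x * dirDeriv (stdFrame k) φ x‖ ≤ C * l2norm volume φ := by
  obtain ⟨L, ρ, hρ, hL⟩ := _root_.exists_local_bound h
  obtain ⟨C, hC0, hC⟩ := hL _ _ (hG.frameComponent L)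
  -- A standard pair of derivatives is a sum of four frame pairs with coefficients of modulus at
  -- most one.
  refine ⟨ρ, 4 * C, hρ, by positivity, fun φ hφ i k => ?_⟩
  have i1 : ∀ j l, Integrable (fun x => ((frame L j i * frame L l k : ℝ) : ℂ) *
      (_root_.frameComponent L G j x * dirDeriv (frame L l) φ x)) volume := fun j l =>
    (((hG.frameComponent L).memLp j).integrable_mul (hφ.dirDeriv _).memLp).const_mul _
  have e : ∫ x, G i x * dirDeriv (stdFrame k) φ x = ∑ j, ∑ l,
      ((frame L j i * frame L l k : ℝ) : ℂ) *
      ∫ x, _root_.frameComponent L G j x * dirDeriv (frame L l) φ x := by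
    simp only [← integral_const_mul]
    simp only [← integral_finsetSum _ fun l _ => i1 _ l]
    rw [← integral_finsetSum _ fun j _ => integrable_finsetSum _ fun l _ => i1 j l]
    refine integral_congr_ae (Eventually.of_forall fun x => ?_)
    simp only
    rw [sum_frameComponent L G i x, dirDeriv_stdFrame L, Finset.sum_mul_sum]
    refine Finset.sum_congr rfl fun j _ => Finset.sum_congr rfl fun l _ => ?_
    push_cast
    ring
  have key : ∀ j l, ‖((frame L j i * frame L l k : ℝ) : ℂ) *
      ∫ x, _root_.frameComponent L G j x * dirDeriv (frame L l) φ x‖ ≤ C * l2norm volume φ := by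
    intro j l
    rw [norm_mul, Complex.norm_real, norm_mul]
    refine (mul_le_of_le_one_left (norm_nonneg _) ?_).trans (hC φ hφ j l)
    exact mul_le_one₀ (abs_frame_apply_le L i j) (norm_nonneg _) (abs_frame_apply_le L k l)
  rw [e]
  refine (norm_sum_le _ _).trans ((Finset.sum_le_sum fun j _ => (norm_sum_le _ _).trans
    (Finset.sum_le_sum fun l _ => key j l)).trans (le_of_eq ?_))
  simp
  ring

/-- Global regularity: the components of the gradient have weak derivatives in `L²`. -/
theorem WeakSolution.exists_bound {G : Fin 2 → Plane → ℂ}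
    (hG : WeakSolution Ω stdFrame G g) (hb : Bornology.IsBounded Ω)
    (h : ∀ x ∈ closure Ω, HasChartAt Ω x) :
    ∃ C, 0 ≤ C ∧ ∀ φ, TestOn Ω φ → ∀ i k,
      ‖∫ x, G i x * dirDeriv (stdFrame k) φ x‖ ≤ C * l2norm volume φ := by
  have hK : IsCompact (closure Ω) := hb.isCompact_closure
  -- In place of a partition of unity, compactness induction yields one smooth weight `ρ`, positive
  -- on the closure, for which the bound holds on test functions of the form `ρφ`. Dividing `φ` by
  -- `ρ` afterwards removes the weight.
  obtain ⟨ρ, hρ, hρ0, hρs, C, hC0, hC⟩ : ∃ ρ : Plane → ℝ, ContDiff ℝ ∞ ρ ∧ (∀ x, 0 ≤ ρ x) ∧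
      (∀ x ∈ closure Ω, 0 < ρ x) ∧ ∃ C, 0 ≤ C ∧ ∀ φ, TestOn Ω φ → ∀ i k,
      ‖∫ x, G i x * dirDeriv (stdFrame k) (fun x => (ρ x : ℂ) * φ x) x‖ ≤ C * l2norm volume φ := by
    refine hK.induction_on (p := fun s => ∃ ρ : Plane → ℝ, ContDiff ℝ ∞ ρ ∧ (∀ x, 0 ≤ ρ x) ∧
      (∀ x ∈ s, 0 < ρ x) ∧ ∃ C, 0 ≤ C ∧ ∀ φ, TestOn Ω φ → ∀ i k,
      ‖∫ x, G i x * dirDeriv (stdFrame k) (fun x => (ρ x : ℂ) * φ x) x‖ ≤ C * l2norm volume φ)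
      ?_ ?_ ?_ ?_
    · exact ⟨fun _ => 0, contDiff_const, fun _ => le_rfl, by simp, 0, le_rfl, fun φ _ i k => by
        simp [dirDeriv]⟩
    · rintro s t hst ⟨ρ, h1, h2, h3, h4⟩
      exact ⟨ρ, h1, h2, fun x hx => h3 x (hst hx), h4⟩
    · rintro s t ⟨ρ, h1, h2, h3, C, h4, h5⟩ ⟨ρ', h1', h2', h3', C', h4', h5'⟩
      refine ⟨fun x => ρ x + ρ' x, h1.add h1', fun x => add_nonneg (h2 x) (h2' x), ?_, C + C',
        add_nonneg h4 h4', fun φ hφ i k => ?_⟩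
      · rintro x (hx | hx)
        · exact add_pos_of_pos_of_nonneg (h3 x hx) (h2' x)
        · exact add_pos_of_nonneg_of_pos (h2 x) (h3' x hx)
      · have t1 := hφ.smul_smooth (contDiff_ofReal h1)
        have t2 := hφ.smul_smooth (contDiff_ofReal h1')
        have i1 : Integrable (fun x => G i x * dirDeriv (stdFrame k) (fun x => (ρ x : ℂ) * φ x) x)
          volume := (hG.memLp i).integrable_mul (t1.dirDeriv _).memLp
        have i2 : Integrable (fun x => G i x * dirDeriv (stdFrame k) (fun x => (ρ' x : ℂ) * φ x) x)
          volume := (hG.memLp i).integrable_mul (t2.dirDeriv _).memLp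
        have e : ∫ x, G i x * dirDeriv (stdFrame k) (fun x => ((ρ x + ρ' x : ℝ) : ℂ) * φ x) x =
            (∫ x, G i x * dirDeriv (stdFrame k) (fun x => (ρ x : ℂ) * φ x) x) +
            ∫ x, G i x * dirDeriv (stdFrame k) (fun x => (ρ' x : ℂ) * φ x) x := by
          rw [← integral_add i1 i2]
          refine integral_congr_ae (Eventually.of_forall fun x => ?_)
          simp only [dirDeriv, Complex.ofReal_add, add_mul]
          rw [fderiv_fun_add (t1.differentiable x) (t2.differentiable x)]
          simp [mul_add]
        rw [e, add_mul]
        exact (norm_add_le _ _).trans (add_le_add (h5 φ hφ i k) (h5' φ hφ i k))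
    · intro x hx
      obtain ⟨r, C, hr, hC0, hC⟩ := hG.exists_local_bound (h x hx)
      let η : ContDiffBump x := ⟨r / 4, r / 2, by positivity, by linarith⟩
      have hη : ContDiff ℝ ∞ η := η.contDiff
      refine ⟨Metric.ball x (r / 4), mem_nhdsWithin_of_mem_nhds (Metric.ball_mem_nhds x
        (by positivity)), η, hη, fun y => η.nonneg, fun y hy => ?_, C, hC0, fun φ hφ i k => ?_⟩
      · refine η.pos_of_mem_ball ?_
        exact Metric.ball_subset_ball (by change r / 4 ≤ r / 2; linarith) hy
      · have t1 := hφ.smul_smooth (contDiff_ofReal hη)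
        have t2 : TestOn (Ω ∩ Metric.ball x r) fun x => (η x : ℂ) * φ x := by
          refine ⟨t1.smooth, t1.compact, Set.subset_inter t1.support ?_⟩
          refine (tsupport_ofReal_mul_subset (χ := η)).trans ?_
          rw [η.tsupport_eq]
          exact Metric.closedBall_subset_ball (by change r / 2 < r; linarith)
        refine (hC _ t2 i k).trans (mul_le_mul_of_nonneg_left ?_ hC0)
        refine l2norm_mono hφ.memLp fun y => ?_
        rw [norm_mul, Complex.norm_real, Real.norm_of_nonneg η.nonneg]
        exact mul_le_of_le_one_left (norm_nonneg _) η.le_one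
  obtain ⟨B, hB⟩ := hK.exists_bound_of_continuousOn (f := fun x => (ρ x)⁻¹)
    (hρ.continuous.continuousOn.inv₀ fun x hx => (hρs x hx).ne')
  refine ⟨C * |B|, by positivity, fun φ hφ i k => ?_⟩
  have hpos : ∀ x ∈ tsupport φ, 0 < ρ x := fun x hx => hρs x (subset_closure (hφ.support hx))
  have hsupp : tsupport (fun x => (((ρ x)⁻¹ : ℝ) : ℂ) * φ x) ⊆ tsupport φ :=
    tsupport_mul_subset_right
  have ht : TestOn Ω fun x => (((ρ x)⁻¹ : ℝ) : ℂ) * φ x := by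
    refine ⟨contDiff_iff_contDiffAt.2 fun x => ?_, hφ.compact.mul_left, hsupp.trans hφ.support⟩
    by_cases hx : x ∈ tsupport φ
    · exact (Complex.ofRealCLM.contDiff.contDiffAt.comp x
        (hρ.contDiffAt.inv (hpos x hx).ne')).mul hφ.smooth.contDiffAt
    · refine (contDiffAt_const (c := (0 : ℂ))).congr_of_eventuallyEq ?_
      filter_upwards [(isClosed_tsupport φ).isOpen_compl.mem_nhds hx] with y hy
      rw [image_eq_zero_of_notMem_tsupport hy, mul_zero]
  have e : (fun x => (ρ x : ℂ) * ((((ρ x)⁻¹ : ℝ) : ℂ) * φ x)) = φ := by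
    funext x
    by_cases hx : x ∈ tsupport φ
    · rw [← mul_assoc, ← Complex.ofReal_mul, mul_inv_cancel₀ (hpos x hx).ne', Complex.ofReal_one,
        one_mul]
    · rw [image_eq_zero_of_notMem_tsupport hx, mul_zero, mul_zero]
  have := hC _ ht i k
  rw [e] at this
  rw [mul_assoc]
  refine this.trans (mul_le_mul_of_nonneg_left
    (l2norm_le_mul hφ.memLp (abs_nonneg _) fun x => ?_) hC0)
  by_cases hx : x ∈ tsupport φ
  · rw [norm_mul, Complex.norm_real]
    exact mul_le_mul_of_nonneg_right ((hB x (subset_closure (hφ.support hx))).trans (le_abs_self _))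
      (norm_nonneg _)
  · rw [image_eq_zero_of_notMem_tsupport hx]
    simp

end Chart

/-! ### Poincaré inequality -/

section Poincare

variable {Ω : Set Plane} {φ : Plane → ℂ}

/-- For `γ = 0` the shear is a translation. Translating by `2R + 1`, more than the width of `Ω`,
leaves `Ω`; so the increment equals `-φ` wherever `φ ≠ 0`, and the increment estimate gives the
inequality. -/
theorem exists_poincare (hb : Bornology.IsBounded Ω) :
    ∃ C : ℝ, 0 ≤ C ∧ ∀ φ, TestOn Ω φ → l2norm volume φ ≤ C * gradNorm stdFrame φ := by
  obtain ⟨R, hR0, hR⟩ := hb.exists_pos_norm_le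
  refine ⟨(1 + 0) * |2 * R + 1|, by positivity, fun φ hφ => ?_⟩
  have h1 := l2norm_comp_shear_sub_le (LinearIsometryEquiv.refl ℝ Plane) (γ := fun _ => 0) (M := 0)
    contDiff_const (by simp) hφ (2 * R + 1)
  refine le_trans ?_ h1
  have hS := (hφ.univ.comp_shear_univ (L := LinearIsometryEquiv.refl ℝ Plane) (γ := fun _ => 0)
    contDiff_const (2 * R + 1)).sub hφ.univ
  refine l2norm_mono hS.memLp fun x => ?_
  by_cases hx : φ x = 0
  · simp [hx]
  · have hx1 : x ∈ Ω := hφ.support (subset_tsupport _ hx)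
    have hx2 : φ (shear (LinearIsometryEquiv.refl ℝ Plane) (fun _ => 0) (2 * R + 1) x) = 0 := by
      by_contra hne
      have hx2 := hR _ (hφ.support (subset_tsupport _ hne))
      have h3 := abs_coord_le (LinearIsometryEquiv.refl ℝ Plane)
        (shear (LinearIsometryEquiv.refl ℝ Plane) (fun _ => 0) (2 * R + 1) x) 0
      rw [map_shear_zero] at h3
      have h4 := abs_coord_le (LinearIsometryEquiv.refl ℝ Plane) x 0
      have h5 := hR x hx1
      have h6 := le_abs_self (LinearIsometryEquiv.refl ℝ Plane x 0 + (2 * R + 1))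
      have h7 := neg_abs_le (LinearIsometryEquiv.refl ℝ Plane x 0)
      linarith
    rw [hx2]
    simp

end Poincare

/-! ### Functions on `D`, uniqueness of weak derivatives, duality -/

section Restriction

variable {D : CrossSection} {φ : Plane → ℂ}

theorem IsTest.testOn (h : IsTest D φ) : TestOn D.carrier φ := ⟨h.smooth, h.compact, h.support⟩

theorem TestOn.isTest (h : TestOn D.carrier φ) : IsTest D φ := ⟨h.smooth, h.compact, h.support⟩

theorem measurableSet_carrier (D : CrossSection) : MeasurableSet D.carrier :=
  D.isOpen.measurableSet

theorem l2norm_indicator (F : Plane → ℂ) :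
    l2norm volume (D.carrier.indicator F) = l2norm D.vol F := by
  rw [l2norm, l2norm, eLpNorm_indicator_eq_eLpNorm_restrict (measurableSet_carrier D)]
  rfl

theorem TestOn.indicator_eq (h : TestOn D.carrier φ) : D.carrier.indicator φ = φ :=
  Set.indicator_eq_self.2 fun _ hx => h.support (subset_tsupport _ hx)

theorem TestOn.l2norm_vol (h : TestOn D.carrier φ) : l2norm D.vol φ = l2norm volume φ := by
  rw [← l2norm_indicator, h.indicator_eq]

theorem memLp_indicator {F : Plane → ℂ} (h : MemLp F 2 D.vol) :
    MemLp (D.carrier.indicator F) 2 volume :=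
  (memLp_indicator_iff_restrict (measurableSet_carrier D)).2 h

theorem integral_indicator_mul (F H : Plane → ℂ) :
    ∫ x, D.carrier.indicator F x * H x = ∫ x, F x * H x ∂D.vol := by
  rw [CrossSection.vol, ← integral_indicator (measurableSet_carrier D)]
  congr 1
  funext x
  by_cases hx : x ∈ D.carrier <;> simp [hx]

/-- A square integrable function annihilating all test functions vanishes. -/
theorem eq_zero_of_forall_test {h : L2 D}
    (H : ∀ φ, IsTest D φ → ∫ x, h x * φ x ∂D.vol = 0) : h = 0 := by
  have hint : Integrable h D.vol := (Lp.memLp h).integrable (by norm_num)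
  have hloc : LocallyIntegrableOn (fun x => h x) D.carrier volume :=
    IntegrableOn.locallyIntegrableOn hint
  have key := D.isOpen.ae_eq_zero_of_integral_contDiff_smul_eq_zero hloc fun g hg hgc hgs => by
    have e : tsupport (fun x => (g x : ℂ)) ⊆ tsupport g :=
      closure_mono fun x hx h0 => hx (by simp [h0])
    have ht : IsTest D fun x => (g x : ℂ) :=
      ⟨contDiff_ofReal hg, hgc.comp_left (g := fun t : ℝ => (t : ℂ)) (by simp), e.trans hgs⟩
    have h1 := H _ ht
    rw [← integral_indicator_mul] at h1
    rw [← h1]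
    refine integral_congr_ae (Eventually.of_forall fun x => ?_)
    by_cases hx : x ∈ D.carrier
    · simp [hx, mul_comm]
    · have : g x = 0 := by
        by_contra h0
        exact hx (hgs (subset_tsupport _ h0))
      simp [this]
  rw [Lp.eq_zero_iff_ae_eq_zero]
  have := (ae_restrict_iff' (measurableSet_carrier D)).2 key
  exact this

theorem IsWeakDeriv.unique {i : Fin 2} {u g g' : L2 D} (h : IsWeakDeriv i u g)
    (h' : IsWeakDeriv i u g') : g = g' := by
  have h0 := h.add (h'.smul (-1))
  rw [← sub_eq_zero]
  refine eq_zero_of_forall_test fun φ hφ => ?_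
  have h1 := h0 φ hφ
  simp only [neg_smul, one_smul, ← sub_eq_add_neg, sub_self] at h1
  have h2 := IsWeakDeriv.zero (D := D) i φ hφ
  rw [h1, neg_inj] at h2
  rw [h2, integral_congr_ae (g := fun _ => (0 : ℂ)), integral_zero]
  filter_upwards [Lp.coeFn_zero ℂ 2 D.vol] with x hx
  rw [hx, Pi.zero_apply, zero_mul]

theorem H2.fn_injective : Function.Injective (H2.fn : H2 D → L2 D) := by
  intro U V h
  have h1 : ∀ i, U.1 (.inr (.inl i)) = V.1 (.inr (.inl i)) := fun i => by
    refine IsWeakDeriv.unique (U.2.1 i) ?_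
    have := V.2.1 i
    rwa [show V.1 (.inl ()) = U.1 (.inl ()) from h.symm] at this
  ext1
  ext1 j
  rcases j with j | j | ⟨i, j⟩
  · exact h
  · exact h1 j
  · refine IsWeakDeriv.unique (U.2.2 i j) ?_
    have := V.2.2 i j
    rwa [← h1 j] at this

/-- The inclusion of `H²(D)` in `L²(D)`. -/
def H2.fnL (D : CrossSection) : H2 D →L[ℂ] L2 D :=
  (PiLp.proj 2 (fun _ : Jet => L2 D) (Sum.inl ())).comp (H2 D).subtypeL

theorem H2.fnL_apply (u : H2 D) : H2.fnL D u = H2.fn u := rfl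

/-- The Laplacian as a bounded operator from `H²(D)` to `L²(D)`. -/
def H2.lapL (D : CrossSection) : H2 D →L[ℂ] L2 D :=
  (∑ i : Fin 2, (PiLp.proj 2 (fun _ : Jet => L2 D) (Sum.inr (Sum.inr (i, i))) :
    (PiLp 2 fun _ : Jet => L2 D) →L[ℂ] L2 D)).comp (H2 D).subtypeL

theorem H2.lapL_apply (u : H2 D) : H2.lapL D u = H2.lap u := by
  simp [H2.lapL, H2.lap]

/-- A linear functional bounded by the norm of a linear map is represented by a vector. -/
theorem exists_inner_eq_of_le {T F : Type*} [AddCommGroup T] [Module ℂ T] [NormedAddCommGroup F]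
    [InnerProductSpace ℂ F] [CompleteSpace F] (A : T →ₗ[ℂ] F) (S : T →ₗ[ℂ] ℂ) {C : ℝ}
    (h : ∀ t, ‖S t‖ ≤ C * ‖A t‖) : ∃ f : F, ∀ t, S t = inner ℂ f (A t) := by
  obtain ⟨r, hr⟩ := A.rangeRestrict.exists_rightInverse_of_surjective A.range_rangeRestrict
  have hr' : ∀ y : A.range, A (r y) = y := fun y => congrArg Subtype.val (LinearMap.congr_fun hr y)
  -- The bound forces `S` to vanish on the kernel of `A`, so `S` descends to the range; the
  -- extension by Hahn-Banach is then represented by Riesz.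
  let S' : A.range →L[ℂ] ℂ := (S ∘ₗ r).mkContinuous C fun y => by
    refine (h (r y)).trans (le_of_eq ?_)
    rw [hr' y]
    rfl
  obtain ⟨S'', hS, -⟩ := exists_extension_norm_eq A.range S'
  refine ⟨(InnerProductSpace.toDual ℂ F).symm S'', fun t => ?_⟩
  rw [InnerProductSpace.toDual_symm_apply]
  have h1 := hS ⟨A t, LinearMap.mem_range_self A t⟩
  simp only at h1
  rw [h1]
  have h2 : S (t - r ⟨A t, LinearMap.mem_range_self A t⟩) = 0 := by
    rw [← norm_le_zero_iff]
    refine (h _).trans ?_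
    rw [map_sub, hr', sub_self, norm_zero, mul_zero]
  rw [map_sub, sub_eq_zero] at h2
  exact h2

end Restriction

/-! ### Energy space and the Dirichlet problem -/

section Energy

variable {D : CrossSection}

/-- The space `L²(D; ℂ²)` of gradients. -/
abbrev GradSpace (D : CrossSection) := PiLp 2 fun _ : Fin 2 => L2 D

theorem IsTest.conj {φ : Plane → ℂ} (h : IsTest D φ) :
    IsTest D fun x => (starRingEnd ℂ) (φ x) := h.testOn.conj.isTest

theorem IsTest.pderiv_conj {φ : Plane → ℂ} (h : IsTest D φ) (i : Fin 2) (x : Plane) :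
    pderiv i (fun x => (starRingEnd ℂ) (φ x)) x = (starRingEnd ℂ) (pderiv i φ x) :=
  dirDeriv_conj (h.testOn.differentiable x)

theorem inner_toLp {φ : Plane → ℂ} (h : MemLp φ 2 D.vol) (u : L2 D) :
    inner ℂ (h.toLp φ) u = ∫ x, u x * (starRingEnd ℂ) (φ x) ∂D.vol := by
  rw [L2.inner_def]
  apply integral_congr_ae
  filter_upwards [h.coeFn_toLp] with x hx
  simp [hx]

theorem TestOn.integral_toLp_mul {φ : Plane → ℂ} (h : TestOn D.carrier φ) (hm : MemLp φ 2 D.vol)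
    (ψ : Plane → ℂ) : ∫ x, hm.toLp φ x * ψ x ∂D.vol = ∫ x, φ x * ψ x := by
  have e : ∫ x, φ x * ψ x = ∫ x, φ x * ψ x ∂D.vol := by
    rw [← integral_indicator_mul, h.indicator_eq]
  rw [e]
  refine integral_congr_ae ?_
  filter_upwards [hm.coeFn_toLp] with x hx
  rw [hx]

theorem norm_toLp_eq {φ : Plane → ℂ} (h : MemLp φ 2 D.vol) : ‖h.toLp φ‖ = l2norm D.vol φ :=
  Lp.norm_toLp _ _

theorem IsTest.add {φ ψ : Plane → ℂ} (h : IsTest D φ) (h' : IsTest D ψ) : IsTest D (φ + ψ) :=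
  (h.testOn.add h'.testOn).isTest

theorem IsTest.const_smul {φ : Plane → ℂ} (c : ℂ) (h : IsTest D φ) : IsTest D (c • φ) :=
  (TestOn.smul_smooth (η := fun _ => c) contDiff_const h.testOn).isTest

theorem IsTest.zero : IsTest D (0 : Plane → ℂ) :=
  ⟨contDiff_const, HasCompactSupport.zero, by simp⟩

/-- The space of test functions. -/
def testSpace (D : CrossSection) : Submodule ℂ (Plane → ℂ) where
  carrier := {φ | IsTest D φ}
  zero_mem' := IsTest.zero
  add_mem' := IsTest.add
  smul_mem' := fun c _ h => IsTest.const_smul c h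

/-- The class in `L²(D)` of a test function. -/
def testL2 (D : CrossSection) : testSpace D →ₗ[ℂ] L2 D where
  toFun φ := φ.2.memLp.toLp φ.1
  map_add' φ ψ := MemLp.toLp_add φ.2.memLp ψ.2.memLp
  map_smul' c φ := MemLp.toLp_const_smul c φ.2.memLp

theorem pderiv_add {φ ψ : Plane → ℂ} (h : IsTest D φ) (h' : IsTest D ψ) (i : Fin 2) :
    pderiv i (φ + ψ) = pderiv i φ + pderiv i ψ := by
  funext x
  simp only [pderiv, Pi.add_apply]
  rw [fderiv_add (h.testOn.differentiable x) (h'.testOn.differentiable x)]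
  rfl

theorem pderiv_smul {φ : Plane → ℂ} (c : ℂ) (h : IsTest D φ) (i : Fin 2) :
    pderiv i (c • φ) = c • pderiv i φ := by
  funext x
  simp only [pderiv, Pi.smul_apply]
  rw [fderiv_const_smul (h.testOn.differentiable x)]
  rfl

/-- The gradient of a test function in `L²(D; ℂ²)`. -/
def testGrad (D : CrossSection) : testSpace D →ₗ[ℂ] GradSpace D where
  toFun φ := WithLp.toLp 2 fun i => (φ.2.pderiv_memLp i).toLp (pderiv i φ.1)
  map_add' φ ψ := by
    ext1 i
    rw [PiLp.add_apply]
    refine Eq.trans ?_ (MemLp.toLp_add (φ.2.pderiv_memLp i) (ψ.2.pderiv_memLp i))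
    refine MemLp.toLp_congr ((φ + ψ).2.pderiv_memLp i) _
      (Eventually.of_forall fun x => ?_)
    exact congrFun (pderiv_add φ.2 ψ.2 i) x
  map_smul' c φ := by
    ext1 i
    rw [PiLp.smul_apply]
    refine Eq.trans ?_ (MemLp.toLp_const_smul c (φ.2.pderiv_memLp i))
    refine MemLp.toLp_congr ((c • φ).2.pderiv_memLp i) _
      (Eventually.of_forall fun x => ?_)
    exact congrFun (pderiv_smul c φ.2 i) x

/-- The pairs `(u, ∇u)` with `u ∈ H¹₀(D)`. -/
def energySpace (D : CrossSection) : Submodule ℂ (L2 D × GradSpace D) :=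
  (LinearMap.range ((testL2 D).prod (testGrad D))).topologicalClosure

theorem test_mem_energySpace (φ : testSpace D) : (testL2 D φ, testGrad D φ) ∈ energySpace D :=
  Submodule.le_topologicalClosure _ ⟨φ, rfl⟩

/-- Density: a closed condition on pairs needs to be checked on test functions only. -/
theorem energySpace_induction {P : L2 D × GradSpace D → Prop} (hP : IsClosed {p | P p})
    (h : ∀ φ : testSpace D, P (testL2 D φ, testGrad D φ)) {p : L2 D × GradSpace D}
    (hp : p ∈ energySpace D) : P p := by
  have : closure (LinearMap.range ((testL2 D).prod (testGrad D)) : Set (L2 D × GradSpace D)) ⊆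
      {p | P p} := by
    refine closure_minimal ?_ hP
    rintro _ ⟨φ, rfl⟩
    exact h φ
  exact this hp

theorem memH10_iff {u : L2 D} : MemH10 u ↔ ∃ G, (u, G) ∈ energySpace D := by
  have key : ∀ (v : L2 D) (ψ : Plane → ℂ) (hψ : MemLp ψ 2 D.vol),
      eLpNorm (fun x => v x - ψ x) 2 D.vol = ‖v - hψ.toLp ψ‖ₑ := by
    intro v ψ hψ
    rw [Lp.enorm_def]
    refine eLpNorm_congr_ae ?_
    filter_upwards [Lp.coeFn_sub v (hψ.toLp ψ), hψ.coeFn_toLp] with x h1 h2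
    rw [h1, Pi.sub_apply, h2]
  constructor
  · rintro ⟨g, hg⟩
    refine ⟨WithLp.toLp 2 g, ?_⟩
    have hmem : ∀ n : ℕ, ∃ φ : testSpace D, ‖u - testL2 D φ‖ₑ ≤ (n + 1 : ℝ≥0∞)⁻¹ ∧
        ∀ i, ‖g i - testGrad D φ i‖ₑ ≤ (n + 1 : ℝ≥0∞)⁻¹ := fun n => by
      obtain ⟨φ, h1, h2, h3⟩ := hg (n + 1 : ℝ≥0∞)⁻¹ (by simp)
      refine ⟨⟨φ, h1⟩, ?_, fun i => ?_⟩
      · rw [key _ _ h1.memLp] at h2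
        exact h2
      · have := h3 i
        rw [key _ _ (h1.pderiv_memLp i)] at this
        exact this
    choose φ h1 h2 using hmem
    have h0 : Tendsto (fun n : ℕ => (n + 1 : ℝ≥0∞)⁻¹) atTop (𝓝 0) := by
      have := (ENNReal.tendsto_inv_nat_nhds_zero).comp (tendsto_add_atTop_nat 1)
      refine this.congr fun n => ?_
      simp
    have lim : ∀ {v : L2 D} {a : ℕ → L2 D}, (∀ n : ℕ, ‖v - a n‖ₑ ≤ (n + 1 : ℝ≥0∞)⁻¹) →
        Tendsto a atTop (𝓝 v) := by
      intro v a ha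
      rw [tendsto_iff_edist_tendsto_0]
      refine tendsto_of_tendsto_of_tendsto_of_le_of_le tendsto_const_nhds h0
        (fun _ => zero_le) fun n => ?_
      rw [edist_comm, edist_eq_enorm_sub]
      exact ha n
    refine mem_closure_of_tendsto (f := fun n => (testL2 D (φ n), testGrad D (φ n)))
      (b := atTop) ((lim h1).prodMk_nhds ?_) (Eventually.of_forall fun n => ⟨φ n, rfl⟩)
    have : Tendsto (fun n => WithLp.ofLp (testGrad D (φ n))) atTop (𝓝 g) :=
      tendsto_pi_nhds.2 fun i => lim fun n => h2 n i
    exact ((PiLp.continuous_toLp 2 _).tendsto g).comp this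
  · rintro ⟨G, hG⟩
    refine ⟨fun i => G i, fun ε hε => ?_⟩
    obtain ⟨_, ⟨φ, rfl⟩, hb⟩ := EMetric.mem_closure_iff.1 hG ε hε
    rw [Prod.edist_eq] at hb
    refine ⟨φ.1, φ.2, ?_, fun i => ?_⟩
    · rw [key _ _ φ.2.memLp, ← edist_eq_enorm_sub]
      exact (le_max_left _ _).trans hb.le
    · rw [key _ _ (φ.2.pderiv_memLp i), ← edist_eq_enorm_sub]
      refine le_trans ?_ ((le_max_right _ _).trans hb.le)
      exact PiLp.edist_apply_le (p := 2) (β := fun _ : Fin 2 => L2 D) G (testGrad D φ) i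

theorem energySpace_weakDeriv {p : L2 D × GradSpace D} (hp : p ∈ energySpace D) (i : Fin 2) :
    IsWeakDeriv i p.1 (p.2 i) := by
  intro ψ hψ
  refine energySpace_induction
    (P := fun p => ∫ x, p.1 x * pderiv i ψ x ∂D.vol = -∫ x, p.2 i x * ψ x ∂D.vol) ?_ ?_ hp
  · exact isClosed_eq ((continuous_integral_mul (hψ.pderiv_memLp i)).comp continuous_fst)
      (((continuous_integral_mul hψ.memLp).comp (PiLp.continuous_apply 2 (fun _ => L2 D) i)).comp
        continuous_snd).neg
  · intro φ
    have h := integral_mul_dirDeriv_eq_neg φ.2.testOn.univ hψ.testOn.univ (stdFrame i)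
    have e1 : ∫ x, (testL2 D φ) x * pderiv i ψ x ∂D.vol = ∫ x, φ.1 x * pderiv i ψ x :=
      φ.2.testOn.integral_toLp_mul φ.2.memLp _
    have e2 : ∫ x, (testGrad D φ) i x * ψ x ∂D.vol = ∫ x, pderiv i φ.1 x * ψ x :=
      (φ.2.testOn.dirDeriv (stdFrame i)).integral_toLp_mul (φ.2.pderiv_memLp i) _
    rw [e1, e2]
    exact h

theorem exists_norm_le_energySpace (D : CrossSection) :
    ∃ C : ℝ, 0 ≤ C ∧ ∀ p ∈ energySpace D, ‖p.1‖ ≤ C * ‖p.2‖ := by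
  obtain ⟨C, hC, h⟩ := exists_poincare D.isBounded
  refine ⟨C * 2, by positivity, fun p hp => ?_⟩
  refine energySpace_induction (P := fun p => ‖p.1‖ ≤ C * 2 * ‖p.2‖) ?_ ?_ hp
  · exact isClosed_le continuous_fst.norm (continuous_const.mul continuous_snd.norm)
  · intro φ
    have h1 := h φ.1 φ.2.testOn
    have h2 : ∀ i, l2norm volume (dirDeriv (stdFrame i) φ.1) ≤ ‖testGrad D φ‖ := fun i => by
      rw [← (φ.2.testOn.dirDeriv _).l2norm_vol]
      refine le_trans (le_of_eq ?_) (PiLp.norm_apply_le (testGrad D φ) i)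
      exact (norm_toLp_eq (φ.2.pderiv_memLp i)).symm
    have h3 : ‖testL2 D φ‖ = l2norm volume φ.1 := by
      rw [← φ.2.testOn.l2norm_vol]
      exact norm_toLp_eq φ.2.memLp
    simp only [h3]
    refine h1.trans ?_
    rw [mul_assoc]
    refine mul_le_mul_of_nonneg_left ?_ hC
    rw [gradNorm, two_mul]
    exact add_le_add (h2 0) (h2 1)

/-- The projection `(u, ∇u) ↦ ∇u`. -/
def energyGrad (D : CrossSection) : energySpace D →L[ℂ] GradSpace D :=
  (ContinuousLinearMap.snd ℂ _ _).comp (energySpace D).subtypeL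

instance (D : CrossSection) : CompleteSpace (energySpace D) :=
  (Submodule.isClosed_topologicalClosure _).completeSpace_coe

/-- Poincaré's inequality lets the gradient control the pair. Hence gradients form a closed
subspace, on which recovering the function is a bounded operator. -/
theorem exists_antilipschitz_energyGrad (D : CrossSection) :
    ∃ K, AntilipschitzWith K (energyGrad D) := by
  obtain ⟨C, hC, h⟩ := exists_norm_le_energySpace D
  refine ⟨⟨max C 1, by positivity⟩, ContinuousLinearMap.antilipschitz_of_bound _ fun p => ?_⟩
  change max ‖p.1.1‖ ‖p.1.2‖ ≤ max C 1 * ‖p.1.2‖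
  refine max_le ((h _ p.2).trans ?_) ?_
  · exact mul_le_mul_of_nonneg_right (le_max_left _ _) (norm_nonneg _)
  · exact le_mul_of_one_le_left (norm_nonneg _) (le_max_right _ _)

theorem energyGrad_injective (D : CrossSection) : Function.Injective (energyGrad D) :=
  (exists_antilipschitz_energyGrad D).choose_spec.injective

theorem isClosed_range_energyGrad (D : CrossSection) : IsClosed (Set.range (energyGrad D)) :=
  (exists_antilipschitz_energyGrad D).choose_spec.isClosed_range
    (energyGrad D).uniformContinuous

instance (D : CrossSection) : CompleteSpace (energyGrad D).range :=
  (isClosed_range_energyGrad D).completeSpace_coe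

/-- The map `∇u ↦ u` on the gradients of functions in `H¹₀(D)`. -/
def gradInv (D : CrossSection) : (energyGrad D).range →L[ℂ] L2 D :=
  ((ContinuousLinearMap.fst ℂ _ _).comp (energySpace D).subtypeL).comp
    ((energyGrad D).equivRange (energyGrad_injective D)
      (isClosed_range_energyGrad D)).symm.toContinuousLinearMap

theorem gradInv_apply (p : energySpace D) :
    gradInv D ⟨p.1.2, ⟨p, rfl⟩⟩ = p.1.1 := by
  have := (energyGrad D).equivRange_symm_apply (energyGrad_injective D)
    (isClosed_range_energyGrad D) p
  exact congrArg (fun q : energySpace D => q.1.1) this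

/-- The solution operator `(-Δ)⁻¹` of the Dirichlet problem in `D`. -/
def dirichletInv (D : CrossSection) : L2 D →L[ℂ] L2 D :=
  (gradInv D).comp (ContinuousLinearMap.adjoint (gradInv D))

/-- The gradient of the solution of the Dirichlet problem in `D`. -/
def dirichletGrad (D : CrossSection) : L2 D →L[ℂ] GradSpace D :=
  (energyGrad D).range.subtypeL.comp (ContinuousLinearMap.adjoint (gradInv D))

/-- The solution operator has the form `T T*`, where `T` recovers a function from its gradient. -/
theorem isSelfAdjoint_dirichletInv (D : CrossSection) : IsSelfAdjoint (dirichletInv D) :=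
  (ContinuousLinearMap.isPositive_self_comp_adjoint (gradInv D)).isSelfAdjoint

theorem dirichletInv_mem (g : L2 D) : (dirichletInv D g, dirichletGrad D g) ∈ energySpace D := by
  obtain ⟨p, hp⟩ := (ContinuousLinearMap.adjoint (gradInv D) g).2
  have h1 : ContinuousLinearMap.adjoint (gradInv D) g = ⟨p.1.2, ⟨p, rfl⟩⟩ := Subtype.ext hp.symm
  have h2 : dirichletInv D g = p.1.1 := by
    rw [← gradInv_apply, ← h1]
    rfl
  have h3 : dirichletGrad D g = p.1.2 := hp.symm
  rw [h2, h3]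
  exact p.2

/-- This is the weak form of `-Δu = g`; it is the defining relation of the adjoint of `gradInv`. -/
theorem inner_dirichletGrad (g : L2 D) {p : L2 D × GradSpace D} (hp : p ∈ energySpace D) :
    inner ℂ (dirichletGrad D g) p.2 = inner ℂ g p.1 := by
  have h1 : gradInv D ⟨p.2, ⟨(⟨p, hp⟩ : energySpace D), rfl⟩⟩ = p.1 := gradInv_apply ⟨p, hp⟩
  rw [← h1, ← ContinuousLinearMap.adjoint_inner_left]
  rfl

/-- The gradient of an element of `H²(D)`. -/
def H2.grad (U : H2 D) : GradSpace D := WithLp.toLp 2 fun i => U.1 (.inr (.inl i))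

theorem energySpace_grad_unique {p : L2 D × GradSpace D} (hp : p ∈ energySpace D) {U : H2 D}
    (hU : H2.fn U = p.1) : H2.grad U = p.2 := by
  ext1 i
  have h := energySpace_weakDeriv hp i
  rw [← hU] at h
  exact (U.2.1 i).unique h

theorem integral_conj_mul_toLp {φ : Plane → ℂ} (h : MemLp φ 2 D.vol) (u : L2 D) :
    inner ℂ u (h.toLp φ) = ∫ x, (starRingEnd ℂ) (u x) * φ x ∂D.vol := by
  rw [L2.inner_def]
  apply integral_congr_ae
  filter_upwards [h.coeFn_toLp] with x hx
  simp [hx, mul_comm]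

theorem inner_testGrad (φ : testSpace D) (G : GradSpace D) :
    inner ℂ (testGrad D φ) G =
      ∑ i, ∫ x, G i x * pderiv i (fun x => (starRingEnd ℂ) (φ.1 x)) x ∂D.vol := by
  rw [PiLp.inner_apply]
  refine Finset.sum_congr rfl fun i _ => ?_
  refine (inner_toLp (φ.2.pderiv_memLp i) (G i)).trans ?_
  simp only [φ.2.pderiv_conj]

/-- Green's formula. -/
theorem inner_lap (U : H2 D) {p : L2 D × GradSpace D} (hp : p ∈ energySpace D) :
    inner ℂ p.1 (H2.lap U) = -inner ℂ p.2 (H2.grad U) := by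
  refine energySpace_induction
    (P := fun p => inner ℂ p.1 (H2.lap U) = -inner ℂ p.2 (H2.grad U)) ?_ ?_ hp
  · exact isClosed_eq (continuous_fst.inner continuous_const)
      (continuous_snd.inner continuous_const).neg
  · intro φ
    simp only [inner_testGrad, H2.lap, inner_sum]
    rw [← Finset.sum_neg_distrib]
    refine Finset.sum_congr rfl fun i _ => ?_
    rw [eq_neg_iff_add_eq_zero, add_comm, ← eq_neg_iff_add_eq_zero]
    refine (U.2.2 i i _ φ.2.conj).trans ?_
    rw [← inner_toLp φ.2.memLp]
    rfl

/-- Passage to the setting of the regularity theory on the whole plane. Its pairings are bilinear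
and the inner products sesquilinear, so the conjugate of each test function is used. -/
theorem weakSolution_dirichletInv (g : L2 D) :
    WeakSolution D.carrier stdFrame (fun i => D.carrier.indicator (dirichletGrad D g i))
      (D.carrier.indicator g) where
  memLp j := memLp_indicator (Lp.memLp _)
  integrable j := by
    rw [integrable_indicator_iff (measurableSet_carrier D)]
    exact (Lp.memLp (dirichletGrad D g j)).integrable (by norm_num)
  memLp_rhs := memLp_indicator (Lp.memLp _)
  approx ε hε := by
    obtain ⟨_, ⟨φ, rfl⟩, hb⟩ := Metric.mem_closure_iff.1 (dirichletInv_mem g) ε hε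
    refine ⟨φ.1, φ.2.testOn, fun j => ?_⟩
    have h1 : dist (dirichletGrad D g j) (testGrad D φ j) ≤ ε :=
      ((PiLp.dist_apply_le (p := 2) (β := fun _ : Fin 2 => L2 D) _ _ j).trans
        (le_max_right _ _)).trans hb.le
    refine le_trans (le_of_eq ?_) h1
    rw [← (φ.2.testOn.dirDeriv (stdFrame j)).indicator_eq]
    have e : (fun x => D.carrier.indicator (dirichletGrad D g j) x -
        D.carrier.indicator (dirDeriv (stdFrame j) φ.1) x) =
        D.carrier.indicator fun x => dirichletGrad D g j x - dirDeriv (stdFrame j) φ.1 x := by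
      funext x
      by_cases hx : x ∈ D.carrier <;> simp [hx]
    rw [e, l2norm_indicator, dist_eq_norm, Lp.norm_def, l2norm]
    congr 1
    refine eLpNorm_congr_ae ?_
    filter_upwards [Lp.coeFn_sub (dirichletGrad D g j) (testGrad D φ j),
      (φ.2.pderiv_memLp j).coeFn_toLp] with x h1 h2
    rw [h1, Pi.sub_apply]
    exact congrArg (_ - ·) h2.symm
  eqn φ hφ := by
    simp only [integral_indicator_mul]
    have h := inner_dirichletGrad g (test_mem_energySpace ⟨_, hφ.isTest.conj⟩)
    rw [← inner_conj_symm, ← inner_conj_symm g] at h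
    have h := star_injective h
    rw [inner_testGrad] at h
    have h2 := inner_toLp hφ.isTest.conj.memLp g
    simp only [Complex.conj_conj] at h h2
    exact h.trans h2

/-- The hypothesis bounds the distributional derivative in the `L²` norm of the test function, so it
is represented by an `L²` function. -/
theorem exists_weakDeriv_of_bound {u : L2 D} {i : Fin 2} {C : ℝ}
    (h : ∀ φ, TestOn D.carrier φ → ‖∫ x, u x * pderiv i φ x ∂D.vol‖ ≤ C * l2norm volume φ) :
    ∃ v, IsWeakDeriv i u v := by
  have hint : ∀ φ : testSpace D, Integrable (fun x => u x * pderiv i φ.1 x) D.vol :=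
    fun φ => (Lp.memLp u).integrable_mul (φ.2.pderiv_memLp i)
  let S : testSpace D →ₗ[ℂ] ℂ :=
    { toFun := fun φ => ∫ x, u x * pderiv i φ.1 x ∂D.vol
      map_add' := fun φ ψ => by
        rw [← integral_add (hint φ) (hint ψ)]
        refine integral_congr_ae (Eventually.of_forall fun x => ?_)
        have := congrFun (pderiv_add φ.2 ψ.2 i) x
        simp only [Submodule.coe_add, this, Pi.add_apply, mul_add]
      map_smul' := fun c φ => by
        rw [RingHom.id_apply, smul_eq_mul, ← integral_const_mul]
        refine integral_congr_ae (Eventually.of_forall fun x => ?_)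
        have := congrFun (pderiv_smul c φ.2 i) x
        simp only [Submodule.coe_smul, this, Pi.smul_apply, smul_eq_mul]
        ring }
  obtain ⟨f, hf⟩ := exists_inner_eq_of_le (testL2 D) S (C := C) fun φ => by
    have h1 : ‖testL2 D φ‖ = l2norm volume φ.1 := by
      rw [← φ.2.testOn.l2norm_vol]
      exact norm_toLp_eq φ.2.memLp
    rw [h1]
    exact h φ.1 φ.2.testOn
  -- The sign comes from integration by parts, the conjugation from the conjugate-linear slot of the
  -- inner product.
  refine ⟨-star f, fun φ hφ => ?_⟩
  refine (hf ⟨φ, hφ⟩).trans ((integral_conj_mul_toLp hφ.memLp f).trans ?_)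
  rw [← integral_neg]
  refine integral_congr_ae ?_
  filter_upwards [Lp.coeFn_neg (star f), Lp.coeFn_star f] with x h1 h2
  rw [h1, Pi.neg_apply, h2]
  simp

/-- `H²` regularity for the Dirichlet problem. -/
theorem exists_H2_dirichletInv (g : L2 D) :
    ∃ U : H2 D, H2.fn U = dirichletInv D g ∧ H2.lap U = -g := by
  obtain ⟨C, -, hC⟩ := (weakSolution_dirichletInv g).exists_bound D.isBounded
    fun x hx => D.smooth.hasChartAt D.isOpen hx
  have h2 : ∀ i j, ∃ v, IsWeakDeriv i (dirichletGrad D g j) v := fun i j =>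
    exists_weakDeriv_of_bound (C := C) fun φ hφ => by
      have := hC φ hφ j i
      rw [integral_indicator_mul] at this
      exact this
  choose v hv using h2
  let U : H2 D := ⟨WithLp.toLp 2 (Sum.elim (fun _ => dirichletInv D g)
    (Sum.elim (fun i => dirichletGrad D g i) fun p => v p.1 p.2)),
    fun i => energySpace_weakDeriv (dirichletInv_mem g) i, fun i j => hv i j⟩
  refine ⟨U, rfl, ?_⟩
  -- Green's formula and the weak equation together show that `Δu + g` annihilates every test
  -- function.
  rw [← add_eq_zero_iff_eq_neg]
  refine eq_zero_of_forall_test fun φ hφ => ?_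
  have h1 := inner_lap U (test_mem_energySpace ⟨_, hφ.conj⟩)
  have h2 := inner_dirichletGrad g (test_mem_energySpace ⟨_, hφ.conj⟩)
  rw [← inner_conj_symm, ← inner_conj_symm g] at h2
  have h2 := star_injective h2
  have h3 : H2.grad U = dirichletGrad D g := energySpace_grad_unique (dirichletInv_mem g) rfl
  rw [h3] at h1
  simp only at h1 h2
  rw [h2, ← add_eq_zero_iff_eq_neg, ← inner_add_right] at h1
  have h4 := inner_toLp hφ.conj.memLp (H2.lap U + g)
  simp only [Complex.conj_conj] at h4
  exact h4.symm.trans h1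

end Energy

/-! ### The problem at a single frequency -/

section Modes

variable {D : CrossSection}

theorem H2.fn_add (U V : H2 D) : H2.fn (U + V) = H2.fn U + H2.fn V := rfl

theorem H2.fn_smul (c : ℂ) (U : H2 D) : H2.fn (c • U) = c • H2.fn U := rfl

/-- The solution operator of the Dirichlet problem, with values in `H²(D)`. -/
def dirichletSolₗ (D : CrossSection) : L2 D →ₗ[ℂ] H2 D where
  toFun g := (exists_H2_dirichletInv g).choose
  map_add' g h := H2.fn_injective <| by
    rw [H2.fn_add, (exists_H2_dirichletInv _).choose_spec.1,
      (exists_H2_dirichletInv _).choose_spec.1, (exists_H2_dirichletInv _).choose_spec.1, map_add]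
  map_smul' c g := H2.fn_injective <| by
    rw [RingHom.id_apply, H2.fn_smul, (exists_H2_dirichletInv _).choose_spec.1,
      (exists_H2_dirichletInv _).choose_spec.1, map_smul]

theorem fn_dirichletSolₗ (g : L2 D) : H2.fn (dirichletSolₗ D g) = dirichletInv D g :=
  (exists_H2_dirichletInv g).choose_spec.1

theorem lap_dirichletSolₗ (g : L2 D) : H2.lap (dirichletSolₗ D g) = -g :=
  (exists_H2_dirichletInv g).choose_spec.2

/-- The solution operator of the Dirichlet problem is bounded from `L²(D)` to `H²(D)`. -/
def dirichletSol (D : CrossSection) : L2 D →L[ℂ] H2 D where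
  toLinearMap := dirichletSolₗ D
  -- Closed graph theorem: the limit in `H²` is identified through the continuous injection into
  -- `L²`, where the solution operator is known to be bounded.
  cont := (dirichletSolₗ D).continuous_of_seq_closed_graph fun u x y hu hy => by
    refine H2.fn_injective ?_
    have h1 : Tendsto (fun n => H2.fn (dirichletSolₗ D (u n))) atTop (𝓝 (H2.fn y)) :=
      ((H2.fnL D).continuous.tendsto y).comp hy
    simp only [fn_dirichletSolₗ] at h1 ⊢
    exact tendsto_nhds_unique h1 (((dirichletInv D).continuous.tendsto x).comp hu)

theorem fn_dirichletSol (g : L2 D) : H2.fn (dirichletSol D g) = dirichletInv D g :=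
  fn_dirichletSolₗ g

theorem lap_dirichletSol (g : L2 D) : H2.lap (dirichletSol D g) = -g :=
  lap_dirichletSolₗ g

theorem memH10_dirichletSol (g : L2 D) : MemH10 (H2.fn (dirichletSol D g)) := by
  rw [fn_dirichletSol]
  exact memH10_iff.2 ⟨_, dirichletInv_mem g⟩

/-- An element of `H²(D) ∩ H¹₀(D)` is determined by its Laplacian. -/
theorem eq_dirichletSol {w : H2 D} (hw : MemH10 (H2.fn w)) :
    w = dirichletSol D (-H2.lap w) := by
  obtain ⟨G, hG⟩ := memH10_iff.1 hw
  have h1 := memH10_iff.1 (memH10_dirichletSol (-H2.lap w))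
  obtain ⟨G', hG'⟩ := h1
  set w' := dirichletSol D (-H2.lap w) with hw'
  have hp := (energySpace D).sub_mem hG hG'
  have hl : H2.lap (w - w') = 0 := by
    rw [← H2.lapL_apply, map_sub, H2.lapL_apply, H2.lapL_apply, hw', lap_dirichletSol]
    simp
  have h2 := inner_lap (w - w') hp
  have h3 : H2.grad (w - w') = G - G' := energySpace_grad_unique hp rfl
  rw [hl, h3, inner_zero_right] at h2
  have h4 : G - G' = 0 := by
    rw [← inner_self_eq_zero (𝕜 := ℂ), ← neg_eq_zero]
    exact h2.symm
  obtain ⟨C, -, hC⟩ := exists_norm_le_energySpace D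
  have h5 := hC _ hp
  simp only [Prod.mk_sub_mk, h4, norm_zero, mul_zero] at h5
  have h6 : H2.fn w - H2.fn w' = 0 := norm_le_zero_iff.1 h5
  exact H2.fn_injective (sub_eq_zero.1 h6)

/-- The constant function `1` in `L²(D)`. -/
def oneL2 (D : CrossSection) : L2 D := Lp.const 2 D.vol (1 : ℂ)

theorem const_eq_smul (c : ℂ) : Lp.const 2 D.vol c = c • oneL2 D := by
  have := (Lp.constₗ 2 D.vol ℂ (E := ℂ)).map_smul c 1
  rw [smul_eq_mul, mul_one] at this
  exact this

theorem inner_oneL2 (u : L2 D) : inner ℂ (oneL2 D) u = ∫ x, u x ∂D.vol := by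
  rw [L2.inner_def]
  refine integral_congr_ae ?_
  filter_upwards [Lp.coeFn_const 2 D.vol (1 : ℂ)] with x hx
  rw [show (oneL2 D) x = 1 from hx]
  simp

theorem oneL2_ne_zero (D : CrossSection) : oneL2 D ≠ 0 := by
  intro h
  have h1 := inner_oneL2 (oneL2 D)
  rw [h, inner_zero_left, ← h, oneL2, integral_congr_ae (Lp.coeFn_const 2 D.vol (1 : ℂ))] at h1
  simp only [Function.const_apply, integral_const, Complex.real_smul, mul_one] at h1
  have h2 : D.vol.real Set.univ = 0 := by exact_mod_cast h1.symm
  rw [measureReal_eq_zero_iff] at h2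
  rw [CrossSection.vol, Measure.restrict_apply_univ] at h2
  exact (D.isOpen.measure_pos volume D.isConnected.nonempty).ne' h2

/-- A test function of nonzero mean isolates the pressure in the weak equation; fixing one makes the
constants depend on `D` alone. -/
theorem exists_inner_testL2_ne_zero (D : CrossSection) :
    ∃ φ : testSpace D, inner ℂ (testL2 D φ) (oneL2 D) ≠ 0 := by
  by_contra! h
  refine oneL2_ne_zero D (eq_zero_of_forall_test fun φ hφ => ?_)
  have h1 := (inner_toLp hφ.conj.memLp (oneL2 D)).symm.trans (h ⟨_, hφ.conj⟩)
  simpa using h1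

/-- The basic-flow problem for a single frequency `ξ`. -/
structure IsFlowMode (D : CrossSection) (ν ξ : ℝ) (w : H2 D) (π F : ℂ) : Prop where
  boundary : MemH10 (H2.fn w)
  eqn : (Complex.I * (ξ : ℂ)) • H2.fn w - (ν : ℂ) • H2.lap w = Lp.const 2 D.vol π
  flux : inner ℂ (oneL2 D) (H2.fn w) = F

/-- Energy estimate with the pressure as unknown. Testing with `w` controls velocity and gradient by
`‖π‖‖F‖`; testing with a fixed function controls `‖π‖` by velocity and gradient; combining the two
closes the estimate without any loss in `ν` or `ξ`. -/
theorem IsFlowMode.exists_bound (D : CrossSection) :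
    ∃ C : ℝ, 0 < C ∧ ∀ (ν : ℝ), 0 < ν → ∀ (ξ : ℝ) (w : H2 D) (π F : ℂ), IsFlowMode D ν ξ w π F →
      ‖π‖ ≤ C * ((|ξ| + ν) * ‖F‖) ∧ |ξ| * ‖H2.fn w‖ ≤ C * ((|ξ| + ν) * ‖F‖) ∧
        ν * ‖H2.lap w‖ ≤ C * ((|ξ| + ν) * ‖F‖) := by
  obtain ⟨φ, hφ⟩ := exists_inner_testL2_ne_zero D
  set q := inner ℂ (testL2 D φ) (oneL2 D) with hq
  set N := ‖testL2 D φ‖ + ‖testGrad D φ‖ with hN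
  set C₀ := 2 * N ^ 2 / ‖q‖ ^ 2 with hC₀
  have hq0 : 0 < ‖q‖ := norm_pos_iff.2 hφ
  have hN0 : 0 ≤ N := by positivity
  have hC₀0 : 0 ≤ C₀ := by positivity
  -- `C₀` bounds the pressure and `C₀ + 1` the term `|ξ|‖w‖`; the last summand is the contribution
  -- of the pressure to `ν‖Δw‖`.
  refine ⟨C₀ + 1 + C₀ * ‖oneL2 D‖, by positivity, fun ν hν ξ w π F h => ?_⟩
  obtain ⟨G, hG⟩ := memH10_iff.1 h.boundary
  have hgrad : H2.grad w = G := energySpace_grad_unique hG rfl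
  have hpair : ∀ p ∈ energySpace D, (Complex.I * (ξ : ℂ)) * inner ℂ p.1 (H2.fn w) +
      (ν : ℂ) * inner ℂ p.2 G = π * inner ℂ p.1 (oneL2 D) := by
    intro p hp
    rw [← inner_smul_right, ← inner_smul_right, ← inner_smul_right, ← const_eq_smul, ← h.eqn,
      inner_sub_right, inner_smul_right _ (H2.lap w), inner_lap w hp, hgrad, inner_smul_right _ G]
    ring
  -- The mode tested against itself: the time term is purely imaginary and the viscous term real, so
  -- neither can cancel the other.
  have e1 := hpair _ hG
  rw [inner_self_eq_norm_sq_to_K, inner_self_eq_norm_sq_to_K, ← inner_conj_symm, h.flux] at e1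
  set a := ‖H2.fn w‖ with ha
  set b := ‖G‖ with hb
  have ha0 : 0 ≤ a := norm_nonneg _
  have hb0 : 0 ≤ b := norm_nonneg _
  have hR : ‖π * (starRingEnd ℂ) F‖ = ‖π‖ * ‖F‖ := by rw [norm_mul, RCLike.norm_conj]
  have i1 : |ξ| * a ^ 2 ≤ ‖π‖ * ‖F‖ := by
    rw [← hR, ← e1]
    refine le_trans (le_of_eq ?_) (Complex.abs_im_le_norm _)
    have : ((Complex.I * (ξ : ℂ)) * ((a : ℂ)) ^ 2 + (ν : ℂ) * ((b : ℂ)) ^ 2).im = ξ * a ^ 2 := by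
      have e : ((Complex.I * (ξ : ℂ)) * ((a : ℂ)) ^ 2 + (ν : ℂ) * ((b : ℂ)) ^ 2) =
        ((ν * b ^ 2 : ℝ) : ℂ) + ((ξ * a ^ 2 : ℝ) : ℂ) * Complex.I := by push_cast; ring
      rw [e, Complex.add_im, Complex.ofReal_im, Complex.im_ofReal_mul, Complex.I_im, zero_add,
        mul_one]
    erw [this]
    rw [abs_mul, abs_of_nonneg (sq_nonneg a)]
  have i2 : ν * b ^ 2 ≤ ‖π‖ * ‖F‖ := by
    rw [← hR, ← e1]
    refine le_trans (le_of_eq ?_) (Complex.re_le_norm _)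
    have : ((Complex.I * (ξ : ℂ)) * ((a : ℂ)) ^ 2 + (ν : ℂ) * ((b : ℂ)) ^ 2).re = ν * b ^ 2 := by
      have e : ((Complex.I * (ξ : ℂ)) * ((a : ℂ)) ^ 2 + (ν : ℂ) * ((b : ℂ)) ^ 2) =
        ((ν * b ^ 2 : ℝ) : ℂ) + ((ξ * a ^ 2 : ℝ) : ℂ) * Complex.I := by push_cast; ring
      rw [e, Complex.add_re, Complex.ofReal_re, Complex.re_ofReal_mul, Complex.I_re, mul_zero,
        add_zero]
    exact this.symm
  have e2 := hpair _ (test_mem_energySpace φ)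
  have i3 : ‖π‖ * ‖q‖ ≤ N * (|ξ| * a + ν * b) := by
    rw [← norm_mul, ← e2]
    refine (norm_add_le _ _).trans ?_
    have h1 : ‖(Complex.I * (ξ : ℂ)) * inner ℂ (testL2 D φ) (H2.fn w)‖ ≤
        |ξ| * (‖testL2 D φ‖ * a) := by
      rw [norm_mul, norm_mul, Complex.norm_I, one_mul, Complex.norm_real, Real.norm_eq_abs]
      exact mul_le_mul_of_nonneg_left (norm_inner_le_norm _ _) (abs_nonneg _)
    have h2 : ‖(ν : ℂ) * inner ℂ (testGrad D φ) G‖ ≤ ν * (‖testGrad D φ‖ * b) := by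
      rw [norm_mul, Complex.norm_real, Real.norm_eq_abs, abs_of_pos hν]
      exact mul_le_mul_of_nonneg_left (norm_inner_le_norm _ _) hν.le
    have h3 : ‖testL2 D φ‖ ≤ N := le_add_of_nonneg_right (norm_nonneg _)
    have h4 : ‖testGrad D φ‖ ≤ N := le_add_of_nonneg_left (norm_nonneg _)
    have h5 : |ξ| * (‖testL2 D φ‖ * a) ≤ |ξ| * (N * a) := by gcongr
    have h6 : ν * (‖testGrad D φ‖ * b) ≤ ν * (N * b) := by gcongr
    refine (add_le_add (h1.trans h5) (h2.trans h6)).trans (le_of_eq (by ring))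
  set S := |ξ| + ν with hS
  have hS0 : 0 < S := add_pos_of_nonneg_of_pos (abs_nonneg _) hν
  have hξ := abs_nonneg ξ
  have i4 : (|ξ| * a + ν * b) ^ 2 ≤ 2 * S * (‖π‖ * ‖F‖) := by
    have h1 : (|ξ| * a + ν * b) ^ 2 ≤ 2 * (|ξ| * (|ξ| * a ^ 2) + ν * (ν * b ^ 2)) := by
      nlinarith [sq_nonneg (|ξ| * a - ν * b)]
    have h2 := mul_le_mul_of_nonneg_left i1 hξ
    have h3 := mul_le_mul_of_nonneg_left i2 hν.le
    rw [hS]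
    linarith
  -- After squaring, both sides carry a factor `‖π‖`, which cancels unless it is zero.
  have i5 : ‖π‖ ≤ C₀ * (S * ‖F‖) := by
    by_cases hπ : ‖π‖ = 0
    · rw [hπ]; positivity
    have hπ0 : 0 < ‖π‖ := lt_of_le_of_ne (norm_nonneg _) (Ne.symm hπ)
    have h1 : (‖π‖ * ‖q‖) ^ 2 ≤ N ^ 2 * (2 * S * (‖π‖ * ‖F‖)) := by
      refine (pow_le_pow_left₀ (by positivity) i3 2).trans ?_
      rw [mul_pow]
      exact mul_le_mul_of_nonneg_left i4 (sq_nonneg _)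
    have h2 : ‖π‖ * ‖q‖ ^ 2 ≤ 2 * N ^ 2 * (S * ‖F‖) := by
      refine le_of_mul_le_mul_left ?_ hπ0
      linarith
    rw [hC₀, div_mul_eq_mul_div, le_div_iff₀ (by positivity)]
    exact h2
  have hT0 : 0 ≤ S * ‖F‖ := by positivity
  have i6 : |ξ| * a ≤ (C₀ + 1) * (S * ‖F‖) := by
    refine abs_le_of_sq_le_sq' ?_ (by positivity) |>.2
    calc (|ξ| * a) ^ 2 = |ξ| * (|ξ| * a ^ 2) := by ring
      _ ≤ S * (‖π‖ * ‖F‖) := by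
        refine mul_le_mul (le_add_of_nonneg_right hν.le) i1 (by positivity) hS0.le
      _ = ‖π‖ * (S * ‖F‖) := by ring
      _ ≤ C₀ * (S * ‖F‖) * (S * ‖F‖) := mul_le_mul_of_nonneg_right i5 hT0
      _ ≤ ((C₀ + 1) * (S * ‖F‖)) ^ 2 := by
        rw [mul_pow]
        nlinarith [mul_nonneg (sq_nonneg C₀) (sq_nonneg (S * ‖F‖)),
          mul_nonneg hC₀0 (sq_nonneg (S * ‖F‖)), sq_nonneg (S * ‖F‖)]
  have i7 : ν * ‖H2.lap w‖ ≤ |ξ| * a + ‖π‖ * ‖oneL2 D‖ := by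
    have h1 : (ν : ℂ) • H2.lap w = (Complex.I * (ξ : ℂ)) • H2.fn w - π • oneL2 D := by
      rw [← const_eq_smul, ← h.eqn]
      abel
    have h2 := congrArg norm h1
    rw [norm_smul, Complex.norm_real, Real.norm_eq_abs, abs_of_pos hν] at h2
    rw [h2]
    refine (norm_sub_le _ _).trans (le_of_eq ?_)
    rw [norm_smul, norm_smul, norm_mul, Complex.norm_I, one_mul, Complex.norm_real,
      Real.norm_eq_abs]
  have hone : 0 ≤ ‖oneL2 D‖ := norm_nonneg _
  have i8 : 0 ≤ C₀ * ‖oneL2 D‖ * (S * ‖F‖) := by positivity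
  have i9 : ‖π‖ * ‖oneL2 D‖ ≤ C₀ * (S * ‖F‖) * ‖oneL2 D‖ := mul_le_mul_of_nonneg_right i5 hone
  refine ⟨?_, ?_, ?_⟩
  · linarith
  · linarith
  · linarith

theorem IsFlowMode.eq_zero {ν ξ : ℝ} (hν : 0 < ν) {w : H2 D} {π : ℂ}
    (h : IsFlowMode D ν ξ w π 0) : w = 0 ∧ π = 0 := by
  obtain ⟨C, hC, hb⟩ := IsFlowMode.exists_bound D
  obtain ⟨h1, -, h3⟩ := hb ν hν ξ w π 0 h
  simp only [norm_zero, mul_zero] at h1 h3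
  have h4 : H2.lap w = 0 := by
    rw [← norm_le_zero_iff]
    exact nonpos_of_mul_nonpos_right h3 hν
  refine ⟨?_, norm_le_zero_iff.1 h1⟩
  rw [eq_dirichletSol h.boundary, h4, neg_zero, map_zero]

/-- For `ξ ≠ 0` the operator equals `-iξ (z - (-Δ)⁻¹)` with `z = iν/ξ`, and a non-real `z` lies
outside the spectrum of a self-adjoint operator. -/
theorem exists_resolvent_dirichletInv {ν : ℝ} (hν : 0 < ν) (ξ : ℝ) (f : L2 D) :
    ∃ g : L2 D, (Complex.I * (ξ : ℂ)) • dirichletInv D g + (ν : ℂ) • g = f := by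
  have hν' : (ν : ℂ) ≠ 0 := by exact_mod_cast hν.ne'
  by_cases hξ : ξ = 0
  · exact ⟨(ν : ℂ)⁻¹ • f, by simp [hξ, hν']⟩
  have hξ' : (ξ : ℂ) ≠ 0 := by exact_mod_cast hξ
  set z : ℂ := ((ν / ξ : ℝ) : ℂ) * Complex.I with hz
  have hz1 : z ∉ spectrum ℂ (dirichletInv D) := fun hmem => by
    have := (isSelfAdjoint_dirichletInv D).im_eq_zero_of_mem_spectrum hmem
    rw [hz, Complex.im_ofReal_mul, Complex.I_im, mul_one] at this
    exact div_ne_zero hν.ne' hξ this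
  obtain ⟨A, hA⟩ := spectrum.notMem_iff.1 hz1
  have h1 : (algebraMap ℂ (L2 D →L[ℂ] L2 D) z - dirichletInv D) ((A⁻¹ : (L2 D →L[ℂ] L2 D)ˣ).1 f) =
      f := by
    rw [← hA]
    have := congrArg (fun B : L2 D →L[ℂ] L2 D => B f) A.mul_inv
    exact this
  set g₀ := (A⁻¹ : (L2 D →L[ℂ] L2 D)ˣ).1 f
  -- The factor is the inverse of `-iξ`.
  refine ⟨(Complex.I / (ξ : ℂ)) • g₀, ?_⟩
  rw [← h1]
  rw [sub_apply, Algebra.algebraMap_eq_smul_one, smul_apply, one_apply_eq_self,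
    map_smul, smul_smul, smul_smul, hz]
  have e1 : Complex.I * (ξ : ℂ) * (Complex.I / ξ) = -1 := by
    field_simp
    simp
  have e2 : (ν : ℂ) * (Complex.I / ξ) = ((ν / ξ : ℝ) : ℂ) * Complex.I := by
    push_cast
    ring
  rw [e1, e2, neg_one_smul]
  abel

/-- In terms of `g = -Δw` the equation with pressure `1` is the resolvent equation. Its flux `m`
cannot vanish, as uniqueness would then force the pressure to be zero; scaling by `F / m` gives the
prescribed flux. -/
theorem exists_isFlowMode {ν : ℝ} (hν : 0 < ν) (ξ : ℝ) (F : ℂ) :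
    ∃ (w : H2 D) (π : ℂ), IsFlowMode D ν ξ w π F := by
  obtain ⟨g, hg⟩ := exists_resolvent_dirichletInv (D := D) hν ξ (oneL2 D)
  set m := inner ℂ (oneL2 D) (dirichletInv D g) with hm
  have h1 : IsFlowMode D ν ξ (dirichletSol D g) 1 m := by
    refine ⟨memH10_dirichletSol g, ?_, ?_⟩
    · rw [fn_dirichletSol, lap_dirichletSol, smul_neg, sub_neg_eq_add, hg]
      rfl
    · rw [fn_dirichletSol]
  have hm0 : m ≠ 0 := fun h0 => by
    rw [h0] at h1
    exact one_ne_zero (h1.eq_zero hν).2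
  refine ⟨dirichletSol D ((F / m) • g), F / m, memH10_dirichletSol _, ?_, ?_⟩
  · rw [fn_dirichletSol, lap_dirichletSol, smul_neg, sub_neg_eq_add, map_smul, const_eq_smul,
      ← hg, smul_add, smul_comm, smul_comm (ν : ℂ)]
  · rw [fn_dirichletSol, map_smul, inner_smul_right, ← hm, div_mul_cancel₀ _ hm0]

end Modes

/-! ### Summation over frequencies -/

section Flow

/-- Parseval for `u`, Minkowski in `ℓ²` on a finite set of frequencies, and Bessel for `f` and `g`.
This transfers mode bounds without changing the constants. -/
theorem besSeminorm_le_of_coeff_le {X : Type*} [NormedAddCommGroup X] [InnerProductSpace ℂ X]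
    [CompleteSpace X] {u : ℝ → X} (hu : MemBes u) {f g : ℝ → ℂ} {F G : ℝ → ℂ} (hf : MemBes f)
    (hg : MemBes g) (hF : ∀ ξ, HasBesCoeff f ξ (F ξ)) (hG : ∀ ξ, HasBesCoeff g ξ (G ξ)) {α β : ℝ}
    (hα : 0 ≤ α) (hβ : 0 ≤ β) (h : ∀ ξ, ‖besCoeff u ξ‖ ≤ α * ‖F ξ‖ + β * ‖G ξ‖) :
    besSeminorm u ≤ ENNReal.ofReal α * besSeminorm f + ENNReal.ofReal β * besSeminorm g := by
  refine hu.besSeminorm_le fun s => ?_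
  refine le_trans ?_ (add_le_add
    (mul_le_mul_right (sqrt_sum_le_besSeminorm hf.locL2 s F fun ξ _ => hF ξ) _)
    (mul_le_mul_right (sqrt_sum_le_besSeminorm hg.locL2 s G fun ξ _ => hG ξ) _))
  rw [← ENNReal.ofReal_mul hα, ← ENNReal.ofReal_mul hβ,
    ← ENNReal.ofReal_add (by positivity) (by positivity)]
  refine ENNReal.ofReal_le_ofReal (Real.sqrt_le_iff.2 ⟨by positivity, ?_⟩)
  set A := ∑ ξ ∈ s, ‖F ξ‖ ^ 2
  set B := ∑ ξ ∈ s, ‖G ξ‖ ^ 2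
  have hA : √A ^ 2 = A := Real.sq_sqrt (Finset.sum_nonneg fun _ _ => sq_nonneg _)
  have hB : √B ^ 2 = B := Real.sq_sqrt (Finset.sum_nonneg fun _ _ => sq_nonneg _)
  have hAB : ∑ ξ ∈ s, ‖F ξ‖ * ‖G ξ‖ ≤ √A * √B := Real.sum_mul_le_sqrt_mul_sqrt s _ _
  calc ∑ ξ ∈ s, ‖besCoeff u ξ‖ ^ 2 ≤ ∑ ξ ∈ s, (α * ‖F ξ‖ + β * ‖G ξ‖) ^ 2 :=
        Finset.sum_le_sum fun ξ _ => pow_le_pow_left₀ (norm_nonneg _) (h ξ) 2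
    _ = α ^ 2 * A + 2 * (α * β) * (∑ ξ ∈ s, ‖F ξ‖ * ‖G ξ‖) + β ^ 2 * B := by
        rw [Finset.mul_sum, Finset.mul_sum, Finset.mul_sum, ← Finset.sum_add_distrib,
          ← Finset.sum_add_distrib]
        exact Finset.sum_congr rfl fun ξ _ => by ring
    _ ≤ α ^ 2 * A + 2 * (α * β) * (√A * √B) + β ^ 2 * B := by gcongr
    _ = (α * √A + β * √B) ^ 2 := by
        rw [← hA, ← hB, Real.sqrt_sq (Real.sqrt_nonneg _), Real.sqrt_sq (Real.sqrt_nonneg _)]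
        ring

theorem apEquiv_of_besCoeff_eq {X : Type*} [NormedAddCommGroup X] [NormedSpace ℂ X]
    [CompleteSpace X] {u v : ℝ → X} (hu : MemBes u) (hv : MemBes v)
    (h : ∀ ξ, besCoeff u ξ = besCoeff v ξ) : ApEquiv u v := fun ξ => by
  have := (hu.hasBesCoeff ξ).sub hu.locL2 hv.locL2 (hv.hasBesCoeff ξ)
  rwa [h, sub_self] at this

theorem isDistribDeriv_of_hasDerivAt {X : Type*} [NormedAddCommGroup X] [NormedSpace ℂ X]
    [CompleteSpace X] {u v : ℝ → X} (h : ∀ t, HasDerivAt u (v t) t) (hv : Continuous v) :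
    IsDistribDeriv u v := by
  intro φ hφ hc
  have hu : Continuous u := continuous_iff_continuousAt.2 fun t => (h t).continuousAt
  have hφ' : Continuous (deriv φ) := hφ.continuous_deriv (by simp)
  have i1 : Integrable fun t => deriv φ t • u t :=
    (hφ'.smul hu).integrable_of_hasCompactSupport (hc.deriv.smul_right)
  have i2 : Integrable fun t => φ t • v t :=
    (hφ.continuous.smul hv).integrable_of_hasCompactSupport hc.smul_right
  have i3 : Integrable fun t => φ t • u t :=
    (hφ.continuous.smul hu).integrable_of_hasCompactSupport hc.smul_right
  have hd : ∀ t, HasDerivAt (fun t => φ t • u t) (φ t • v t + deriv φ t • u t) t := fun t =>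
    ((hφ.differentiable (by simp) t).hasDerivAt).smul (h t)
  have := integral_eq_zero_of_hasDerivAt_of_integrable hd (i2.add i1) i3
  rw [integral_add i2 i1, add_comm] at this
  exact eq_neg_of_add_eq_zero_left this

variable {D : CrossSection}

theorem MemH10.sub {u v : L2 D} (hu : MemH10 u) (hv : MemH10 v) : MemH10 (u - v) := by
  obtain ⟨G, hG⟩ := memH10_iff.1 hu
  obtain ⟨H, hH⟩ := memH10_iff.1 hv
  exact memH10_iff.2 ⟨_, (energySpace D).sub_mem hG hH⟩

theorem memH10_of_mem_span {a : ℝ → H2 D} (ha : ∀ ξ, MemH10 (H2.fn (a ξ))) {w : H2 D}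
    (hw : w ∈ Submodule.span ℂ (Set.range a)) : MemH10 (H2.fn w) := by
  have h : Submodule.span ℂ (Set.range a) ≤
      ((energySpace D).map (LinearMap.fst ℂ _ _)).comap (H2.fnL D).toLinearMap := by
    rw [Submodule.span_le]
    rintro _ ⟨ξ, rfl⟩
    obtain ⟨G, hG⟩ := memH10_iff.1 (ha ξ)
    exact ⟨_, hG, rfl⟩
  obtain ⟨p, hp, e⟩ := h hw
  refine memH10_iff.2 ⟨p.2, ?_⟩
  have e' : p.1 = H2.fn w := e
  rw [← e']
  exact hp

theorem IsFlowMode.unique {ν ξ : ℝ} (hν : 0 < ν) {w₁ w₂ : H2 D} {π₁ π₂ F : ℂ}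
    (h₁ : IsFlowMode D ν ξ w₁ π₁ F) (h₂ : IsFlowMode D ν ξ w₂ π₂ F) : w₁ = w₂ ∧ π₁ = π₂ := by
  have h : IsFlowMode D ν ξ (w₁ - w₂) (π₁ - π₂) 0 := by
    refine ⟨h₁.boundary.sub h₂.boundary, ?_, ?_⟩
    · rw [map_sub, ← h₁.eqn, ← h₂.eqn, ← H2.fnL_apply, ← H2.lapL_apply, map_sub, map_sub, smul_sub,
        smul_sub, H2.fnL_apply, H2.fnL_apply, H2.lapL_apply, H2.lapL_apply]
      abel
    · rw [← H2.fnL_apply, map_sub, inner_sub_right, H2.fnL_apply, H2.fnL_apply, h₁.flux, h₂.flux,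
        sub_self]
  obtain ⟨h1, h2⟩ := h.eq_zero hν
  exact ⟨sub_eq_zero.1 h1, sub_eq_zero.1 h2⟩

variable {ν : ℝ} {f : ℝ → ℂ} {w : ℝ → H2 D} {w' : ℝ → L2 D} {π : ℝ → ℂ}

theorem MemBes.hasBesCoeff_fn (hw : MemBes w) (ξ : ℝ) :
    HasBesCoeff (fun t => H2.fn (w t)) ξ (H2.fn (besCoeff w ξ)) :=
  (hw.hasBesCoeff ξ).clm_apply (H2.fnL D) hw.locL2

theorem MemBes.lap (hw : MemBes w) : MemBes fun t => H2.lap (w t) := by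
  have := hw.clm_apply (H2.lapL D)
  simpa only [H2.lapL_apply] using this

theorem MemBes.hasBesCoeff_lap (hw : MemBes w) (ξ : ℝ) :
    HasBesCoeff (fun t => H2.lap (w t)) ξ (H2.lap (besCoeff w ξ)) := by
  have := (hw.hasBesCoeff ξ).clm_apply (H2.lapL D) hw.locL2
  simpa only [H2.lapL_apply] using this

theorem MemBes.const_Lp (hπ : MemBes π) : MemBes fun t => Lp.const 2 D.vol (π t) := by
  have := hπ.clm_apply (ContinuousLinearMap.toSpanSingleton ℂ (oneL2 D))
  simpa only [ContinuousLinearMap.toSpanSingleton_apply, ← const_eq_smul] using this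

theorem MemBes.hasBesCoeff_const_Lp (hπ : MemBes π) (ξ : ℝ) :
    HasBesCoeff (fun t => Lp.const 2 D.vol (π t)) ξ (Lp.const 2 D.vol (besCoeff π ξ)) := by
  have := (hπ.hasBesCoeff ξ).clm_apply (ContinuousLinearMap.toSpanSingleton ℂ (oneL2 D)) hπ.locL2
  simpa only [ContinuousLinearMap.toSpanSingleton_apply, ← const_eq_smul] using this

/-- The flux through the cross section as a bounded functional. -/
def fluxL (D : CrossSection) : H2 D →L[ℂ] ℂ := (innerSL ℂ (oneL2 D)).comp (H2.fnL D)

theorem fluxL_apply (U : H2 D) : fluxL D U = ∫ x, (H2.fn U) x ∂D.vol :=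
  inner_oneL2 (H2.fn U)

theorem MemBes.flux (hw : MemBes w) : MemBes fun t => ∫ x, (H2.fn (w t)) x ∂D.vol := by
  simpa only [fluxL_apply] using hw.clm_apply (fluxL D)

theorem MemBes.hasBesCoeff_flux (hw : MemBes w) (ξ : ℝ) :
    HasBesCoeff (fun t => ∫ x, (H2.fn (w t)) x ∂D.vol) ξ
      (inner ℂ (oneL2 D) (H2.fn (besCoeff w ξ))) := by
  have := (hw.hasBesCoeff ξ).clm_apply (fluxL D) hw.locL2
  simp only [fluxL_apply] at this
  rwa [inner_oneL2]

/-- Inclusion into `L²`, Laplacian and flux are bounded linear maps on `H²`, so they commute with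
taking coefficients. -/
theorem IsBasicFlow.isFlowMode (hf : MemBes f) (h : IsBasicFlow D ν f w w' π) (ξ : ℝ) :
    IsFlowMode D ν ξ (besCoeff w ξ) (besCoeff π ξ) (besCoeff f ξ) := by
  have hfn := (h.mem_w.hasBesCoeff_fn ξ).eq_besCoeff
  refine ⟨hfn ▸ h.boundary ξ, ?_, ?_⟩
  · have h1 := h.deriv_w.coeff ξ
    rw [hfn] at h1
    have h2 := (h.mem_w.hasBesCoeff_lap ξ).const_smul (ν : ℂ)
    have hl : ∀ R : ℝ, MemLp (fun t => (ν : ℂ) • H2.lap (w t)) 2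
        (volume.restrict (Set.Icc (-R) R)) := fun R => (h.mem_w.lap.locL2 R).const_smul (ν : ℂ)
    have h3 := h1.sub h.deriv_w.mem.locL2 hl h2
    have h4 := h3.sub (fun R => (h.deriv_w.mem.locL2 R).sub (hl R)) h.mem_π.const_Lp.locL2
      (h.mem_π.hasBesCoeff_const_Lp ξ)
    exact sub_eq_zero.1 (h4.unique (h.eqn ξ))
  · have h1 := (h.mem_w.hasBesCoeff_flux ξ).sub h.mem_w.flux.locL2 hf.locL2 (hf.hasBesCoeff ξ)
    exact sub_eq_zero.1 (h1.unique (h.flux ξ))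

theorem MemBesSobolev.summable_one_add_sq (hf : MemBesSobolev 1 f) :
    Summable fun ξ : ℝ => (1 + ξ ^ 2) * ‖besCoeff f ξ‖ ^ 2 := by
  simpa only [Real.rpow_one] using hf.summable

/-- The place where `f ∈ B^{1,2}` enters: `(|ξ| + ν)² ≤ (2 + 2ν²)(1 + ξ²)`. -/
theorem summable_of_le_mul (hf : MemBesSobolev 1 f) {X : Type*} [NormedAddCommGroup X] {a : ℝ → X}
    (C : ℝ) (h : ∀ ξ : ℝ, ‖a ξ‖ ≤ C * ((|ξ| + ν) * ‖besCoeff f ξ‖)) :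
    Summable fun ξ => ‖a ξ‖ ^ 2 := by
  refine Summable.of_nonneg_of_le (fun _ => sq_nonneg _) (fun ξ => ?_)
    (hf.summable_one_add_sq.mul_left (C ^ 2 * (2 + 2 * ν ^ 2)))
  refine (pow_le_pow_left₀ (norm_nonneg _) (h ξ) 2).trans ?_
  have h1 : (|ξ| + ν) ^ 2 ≤ (2 + 2 * ν ^ 2) * (1 + ξ ^ 2) := by
    have := sq_abs ξ
    nlinarith [sq_nonneg (|ξ| - ν), mul_nonneg (sq_nonneg ν) (sq_nonneg ξ)]
  have h2 : 0 ≤ C ^ 2 * ‖besCoeff f ξ‖ ^ 2 := by positivity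
  calc (C * ((|ξ| + ν) * ‖besCoeff f ξ‖)) ^ 2
      = C ^ 2 * ‖besCoeff f ξ‖ ^ 2 * (|ξ| + ν) ^ 2 := by ring
    _ ≤ C ^ 2 * ‖besCoeff f ξ‖ ^ 2 * ((2 + 2 * ν ^ 2) * (1 + ξ ^ 2)) :=
        mul_le_mul_of_nonneg_left h1 h2
    _ = _ := by ring

theorem exists_memBes_coeff (a : ℝ → ℂ) (ha : Summable fun ξ => ‖a ξ‖ ^ 2) :
    ∃ π : ℝ → ℂ, MemBes π ∧ ∀ ξ, HasBesCoeff π ξ (a ξ) := by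
  obtain ⟨π, -, h, -⟩ :=
    -- With `ι = 0` the condition on the derivative series is empty.
    exists_memBes_of_summable (0 : ℂ →L[ℂ] ℂ) a ha (by simp)
  exact ⟨π, h⟩

theorem MemBesSobolev.exists_isBesDeriv (hf : MemBesSobolev 1 f) : ∃ f', IsBesDeriv f f' := by
  have h : Summable fun ξ : ℝ => ‖(Complex.I * (ξ : ℂ)) • besCoeff f ξ‖ ^ 2 :=
    summable_of_le_mul (ν := 0) hf 1 fun ξ => by simp
  obtain ⟨f', h1, h2⟩ := exists_memBes_coeff _ h
  exact ⟨f', h1, h2⟩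

theorem exists_isBasicFlow (hν : 0 < ν) (hf : MemBesSobolev 1 f) :
    ∃ (w : ℝ → H2 D) (w' : ℝ → L2 D) (π : ℝ → ℂ), IsBasicFlow D ν f w w' π ∧
      (∀ t, MemH10 (H2.fn (w t))) ∧ IsDistribDeriv (fun t => H2.fn (w t)) w' := by
  obtain ⟨C, hC, hb⟩ := IsFlowMode.exists_bound D
  choose W Q h using fun ξ => exists_isFlowMode (D := D) hν ξ (besCoeff f ξ)
  -- The full `H²` norm is recovered from the Laplacian by the bounded solution operator. The factor
  -- `1 / ν` is harmless, as this bound serves only for summability.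
  have hW : ∀ ξ, ‖W ξ‖ ≤ ‖dirichletSol D‖ / ν * C * ((|ξ| + ν) * ‖besCoeff f ξ‖) := fun ξ => by
    have h1 := (hb ν hν ξ _ _ _ (h ξ)).2.2
    have h2 := (dirichletSol D).le_opNorm (-H2.lap (W ξ))
    rw [← eq_dirichletSol (h ξ).boundary, norm_neg] at h2
    refine h2.trans ?_
    rw [mul_assoc, div_mul_eq_mul_div, mul_div_assoc]
    refine mul_le_mul_of_nonneg_left ?_ (dirichletSol D).opNorm_nonneg
    rw [le_div_iff₀ hν, mul_comm]
    exact h1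
  obtain ⟨w, w', ⟨hw, hwc⟩, ⟨hw', hwc'⟩, hspan, hder, hcont⟩ :=
    exists_memBes_of_summable (H2.fnL D) W (summable_of_le_mul hf _ hW)
      (summable_of_le_mul (ν := ν) hf C fun ξ => by
        rw [norm_smul, norm_mul, Complex.norm_I, one_mul, Complex.norm_real, Real.norm_eq_abs]
        exact (hb ν hν ξ _ _ _ (h ξ)).2.1)
  obtain ⟨π, hπ, hπc⟩ := exists_memBes_coeff Q
    (summable_of_le_mul hf C fun ξ => (hb ν hν ξ _ _ _ (h ξ)).1)
  have eW : ∀ ξ, besCoeff w ξ = W ξ := fun ξ => (hwc ξ).eq_besCoeff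
  have eP : ∀ ξ, besCoeff π ξ = Q ξ := fun ξ => (hπc ξ).eq_besCoeff
  have efn : ∀ ξ, besCoeff (fun t => H2.fn (w t)) ξ = H2.fn (W ξ) := fun ξ => by
    rw [(hw.hasBesCoeff_fn ξ).eq_besCoeff, eW]
  refine ⟨w, w', π, ⟨hw, ⟨hw', fun ξ => ?_⟩, hπ, fun ξ => ?_, fun ξ => ?_, fun ξ => ?_⟩,
    fun t => ?_, isDistribDeriv_of_hasDerivAt hder hcont⟩
  · rw [efn]
    exact hwc' ξ
  · have h2 := (hw.hasBesCoeff_lap ξ).const_smul (ν : ℂ)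
    have hl : ∀ R : ℝ, MemLp (fun t => (ν : ℂ) • H2.lap (w t)) 2
        (volume.restrict (Set.Icc (-R) R)) := fun R => (hw.lap.locL2 R).const_smul (ν : ℂ)
    have h4 := ((hwc' ξ).sub hw'.locL2 hl h2).sub (fun R => (hw'.locL2 R).sub (hl R))
      hπ.const_Lp.locL2 (hπ.hasBesCoeff_const_Lp ξ)
    rw [eW, eP, H2.fnL_apply, (h ξ).eqn, sub_self] at h4
    exact h4
  · rw [efn]
    exact (h ξ).boundary
  · have h1 := (hw.hasBesCoeff_flux ξ).sub hw.flux.locL2 hf.mem.locL2 (hf.mem.hasBesCoeff ξ)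
    rw [eW, (h ξ).flux, sub_self] at h1
    exact h1
  · exact memH10_of_mem_span (fun ξ => (h ξ).boundary) (hspan t)

theorem IsBasicFlow.unique (hν : 0 < ν) (hf : MemBes f) {w₁ w₂ : ℝ → H2 D} {w₁' w₂' : ℝ → L2 D}
    {π₁ π₂ : ℝ → ℂ} (h₁ : IsBasicFlow D ν f w₁ w₁' π₁) (h₂ : IsBasicFlow D ν f w₂ w₂' π₂) :
    ApEquiv w₁ w₂ ∧ ApEquiv w₁' w₂' ∧ ApEquiv π₁ π₂ := by
  have h := fun ξ => (h₁.isFlowMode hf ξ).unique hν (h₂.isFlowMode hf ξ)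
  refine ⟨apEquiv_of_besCoeff_eq h₁.mem_w h₂.mem_w fun ξ => (h ξ).1,
    apEquiv_of_besCoeff_eq h₁.deriv_w.mem h₂.deriv_w.mem fun ξ => ?_,
    apEquiv_of_besCoeff_eq h₁.mem_π h₂.mem_π fun ξ => (h ξ).2⟩
  rw [(h₁.deriv_w.coeff ξ).eq_besCoeff, (h₂.deriv_w.coeff ξ).eq_besCoeff,
    (h₁.mem_w.hasBesCoeff_fn ξ).eq_besCoeff, (h₂.mem_w.hasBesCoeff_fn ξ).eq_besCoeff, (h ξ).1]

theorem IsBasicFlow.exists_estimate (D : CrossSection) :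
    ∃ C : ℝ, 0 < C ∧ ∀ (ν : ℝ), 0 < ν → ∀ (f f' : ℝ → ℂ) (w : ℝ → H2 D) (w' : ℝ → L2 D)
      (π : ℝ → ℂ), MemBes f → IsBesDeriv f f' → IsBasicFlow D ν f w w' π →
        besSeminorm (fun t => H2.lap (w t)) ≤
          ENNReal.ofReal C * besSeminorm f + ENNReal.ofReal (C / ν) * besSeminorm f' ∧
        besSeminorm π ≤
          ENNReal.ofReal (C * ν) * besSeminorm f + ENNReal.ofReal C * besSeminorm f' ∧
        besSeminorm w' ≤
          ENNReal.ofReal (C * ν) * besSeminorm f + ENNReal.ofReal C * besSeminorm f' := by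
  obtain ⟨C, hC, hb⟩ := IsFlowMode.exists_bound D
  refine ⟨C, hC, fun ν hν f f' w w' π hf hf' h => ?_⟩
  have hm := fun ξ => hb ν hν ξ _ _ _ (h.isFlowMode hf ξ)
  have hn : ∀ ξ : ℝ, ‖(Complex.I * (ξ : ℂ)) • besCoeff f ξ‖ = |ξ| * ‖besCoeff f ξ‖ := fun ξ => by
    simp
  refine ⟨besSeminorm_le_of_coeff_le h.mem_w.lap hf hf'.mem hf.hasBesCoeff hf'.coeff hC.le
      (by positivity) fun ξ => ?_,
    besSeminorm_le_of_coeff_le h.mem_π hf hf'.mem hf.hasBesCoeff hf'.coeff (by positivity)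
      hC.le fun ξ => ?_,
    besSeminorm_le_of_coeff_le h.deriv_w.mem hf hf'.mem hf.hasBesCoeff hf'.coeff (by positivity)
      hC.le fun ξ => ?_⟩
  · rw [(h.mem_w.hasBesCoeff_lap ξ).eq_besCoeff, hn]
    refine le_of_mul_le_mul_left ((hm ξ).2.2.trans (le_of_eq ?_)) hν
    field_simp
    ring
  · rw [hn]
    exact (hm ξ).1.trans (le_of_eq (by ring))
  · rw [(h.deriv_w.coeff ξ).eq_besCoeff, (h.mem_w.hasBesCoeff_fn ξ).eq_besCoeff, hn, norm_smul,
      norm_mul, Complex.norm_I, one_mul, Complex.norm_real, Real.norm_eq_abs]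
    exact (hm ξ).2.1.trans (le_of_eq (by ring))

end Flow

end

theorem theorem3p3 (D : CrossSection) :
    ∃ c : ℝ, 0 < c ∧ ∀ (ν : ℝ), 0 < ν → ∀ f : ℝ → ℂ, MemBesSobolev 1 f →
      -- the formal derivative of `f` exists in `B²(ℝ)`
      (∃ f' : ℝ → ℂ, IsBesDeriv f f') ∧
      -- existence, with a representative that vanishes on the boundary at every time and
      -- has `w'` as its distributional derivative in time
      (∃ (w : ℝ → H2 D) (w' : ℝ → L2 D) (π : ℝ → ℂ),
        IsBasicFlow D ν f w w' π ∧ (∀ t, MemH10 (H2.fn (w t))) ∧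
          IsDistribDeriv (fun t => H2.fn (w t)) w') ∧
      -- uniqueness up to identification
      (∀ (w₁ w₂ : ℝ → H2 D) (w₁' w₂' : ℝ → L2 D) (π₁ π₂ : ℝ → ℂ),
        IsBasicFlow D ν f w₁ w₁' π₁ → IsBasicFlow D ν f w₂ w₂' π₂ →
          ApEquiv w₁ w₂ ∧ ApEquiv w₁' w₂' ∧ ApEquiv π₁ π₂) ∧
      -- estimates
      (∀ (f' : ℝ → ℂ) (w : ℝ → H2 D) (w' : ℝ → L2 D) (π : ℝ → ℂ),
        IsBesDeriv f f' → IsBasicFlow D ν f w w' π →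
          besSeminorm (fun t => H2.lap (w t)) ≤
            ENNReal.ofReal c * besSeminorm f + ENNReal.ofReal (c / ν) * besSeminorm f' ∧
          besSeminorm π + besSeminorm w' ≤
            ENNReal.ofReal (c * ν) * besSeminorm f + ENNReal.ofReal c * besSeminorm f') := by
  obtain ⟨C, hC, hest⟩ := IsBasicFlow.exists_estimate D
  -- The factor `2` comes from adding the separate bounds for the pressure and the time derivative.
  refine ⟨2 * C, by positivity, fun ν hν f hf => ⟨hf.exists_isBesDeriv, exists_isBasicFlow hν hf,
    fun _ _ _ _ _ _ h₁ h₂ => h₁.unique hν hf.mem h₂, fun f' w w' π hf' h => ?_⟩⟩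
  obtain ⟨h1, h2, h3⟩ := hest ν hν f f' w w' π hf.mem hf' h
  have e : ∀ x : ℝ, 0 ≤ x → ENNReal.ofReal (2 * x) = ENNReal.ofReal x + ENNReal.ofReal x :=
    fun x hx => by rw [two_mul, ENNReal.ofReal_add hx hx]
  refine ⟨h1.trans ?_, (add_le_add h2 h3).trans (le_of_eq ?_)⟩
  · gcongr <;> linarith
  · rw [mul_assoc, e C hC.le, e (C * ν) (by positivity)]
    ring
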